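/- Let $(M,g)$ be a spacetime: a smooth $4$-manifold with a smooth metric of signature $(-,+,+,+)$. The following notions are local: each refers to a suitable coordinate system $(x^0,x^1,x^2,x^3)$ around every point. Below, $\hat v, v$ denote $2$-dimensional Lorentzian metrics in $(x^0,x^1)$ and $\hat h, h$ denote $2$-dimensional Riemannian metrics in $(x^2,x^3)$, all smooth, and $\lambda$ is a smooth function. * $g$ is a conformally $2+2$ product if $g=e^{2\lambda}(\hat v+\hat h)$ with $\lambda=\lambda(x^0,\dots,x^3)$. * $g$ is $2+2$ warped in the wide sense if, around every point, either $g=e^{2\lambda}\hat v+h$ with $\lambda=\lambda(x^2,x^3)$ (t-warped), or $g=v+e^{2\lambda}\hat h$ with $\lambda=\lambda(x^0,x^1)$ (s-warped). It is $2+2$ warped if in addition these $\lambda$ have $d\lambda\neq0$ everywhere (non-constant warping factor). Let $W$ be the Weyl tensor and put $G=\frac12\,g\wedge g$, where $(A\wedge B)_{\alpha\beta\mu\nu}=A_{\alpha\mu}B_{\beta\nu}+A_{\beta\nu}B_{\alpha\mu}-A_{\alpha\nu}B_{\beta\mu}-A_{\beta\mu}B_{\alpha\nu}$. Double $2$-forms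 are composed by $(P\circ Q)_{\alpha\beta\rho\sigma}=\frac12P_{\alpha\beta}{}^{\mu\nu}Q_{\mu\nu\rho\sigma}$, with trace $\mathrm{Tr}\,P=\frac12P^{\alpha\beta}{}_{\alpha\beta}$, and $*P=\eta\circ P$, where $\eta$ is the metric volume element of either local orientation. Set $$\rho=-\left(\tfrac1{12}\mathrm{Tr}\,W^3\right)^{1/3}\ \text{(real cube root)},\qquad S=\frac{1}{3\rho}(W-\rho\,G),\qquad \Phi=\mathrm{tr}\,[S(\nabla\cdot S)].$$ Here $(\nabla\cdot S)_{\beta,\mu\nu}=\nabla^\alpha S_{\alpha\beta\mu\nu}$, and for a vector-valued $2$-form $Y$ we write $S(Y)_{\lambda,\alpha\beta}=\frac12S_{\alpha\beta}{}^{\mu\nu}Y_{\lambda,\mu\nu}$ and $(\mathrm{tr}\,Y)_\alpha=g^{\lambda\mu}Y_{\lambda,\mu\alpha}$. Finally $P(\Phi;\Phi)_{\alpha\beta}=P_{\alpha\mu\beta\nu}\Phi^\mu\Phi^\nu$. **Proposition.** Let $g$ be a conformally $2+2$ product which is not conformally flat, in the sense that $W\neq0$ at every point. Then: 1. $g$ is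 $2+2$ warped if and only if $\Phi\neq0$ and $*S(\Phi;\Phi)=0$ everywhere; equivalently, if and only if $\Phi\neq0$ and $*W(\Phi;\Phi)=0$ everywhere. 2. $g$ is $2+2$ warped in the wide sense (points with $d\lambda=0$ allowed) if and only if $*S(\Phi;\Phi)=0$ everywhere; equivalently, if and only if $*W(\Phi;\Phi)=0$ everywhere. -/

import Mathlib

open Set Topology
open scoped Manifold ContDiff

noncomputable section

namespace Warped22

/-- The model space `ℝ⁴` of coordinates. -/
abbrev R4 : Type := EuclideanSpace ℝ (Fin 4)

/-- A smooth Lorentzian metric, signature `(-,+,+,+)`, on a smooth 4-manifold. -/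
structure LorentzMetric (M : Type*) [TopologicalSpace M] [ChartedSpace R4 M]
    [IsManifold (𝓡 4) ∞ M] where
  /-- The bilinear form on each tangent space. -/
  val : ∀ p : M, TangentSpace (𝓡 4) p →L[ℝ] TangentSpace (𝓡 4) p →L[ℝ] ℝ
  symm : ∀ (p : M) (u w : TangentSpace (𝓡 4) p), val p u w = val p w u
  /-- There is an orthonormal frame at each point, its first vector being time-like. -/
  signature : ∀ p : M, ∃ b : Fin 4 → TangentSpace (𝓡 4) p, ∀ i j : Fin 4,
    val p (b i) (b j) = if i = j then (if i = 0 then -1 else 1) else 0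
  smooth : ContMDiff (𝓡 4) ((𝓡 4).prod 𝓘(ℝ, R4 →L[ℝ] R4 →L[ℝ] ℝ)) ∞
    (fun p : M => Bundle.TotalSpace.mk' (R4 →L[ℝ] R4 →L[ℝ] ℝ)
      (E := fun p : M => TangentSpace (𝓡 4) p →L[ℝ] TangentSpace (𝓡 4) p →L[ℝ] ℝ) p (val p))

/-! ### Tensor calculus in a coordinate system

All tensors are given by their covariant components, as functions of the coordinates.
`g` is the matrix of components of the metric. -/

/-- Components of a 1-form. -/
abbrev Tensor1 : Type := Fin 4 → ℝ
/-- Components of a 3-tensor, such as a vector valued 2-form. -/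
abbrev Tensor3 : Type := Fin 4 → Fin 4 → Fin 4 → ℝ
/-- Components of a 4-tensor, such as a double 2-form. -/
abbrev Tensor4 : Type := Fin 4 → Fin 4 → Fin 4 → Fin 4 → ℝ

/-- The partial derivative `∂f/∂xⁱ`. -/
def pd (i : Fin 4) (f : R4 → ℝ) (x : R4) : ℝ :=
  fderiv ℝ f x (EuclideanSpace.single i (1 : ℝ))

section Coordinates

variable (g : R4 → Matrix (Fin 4) (Fin 4) ℝ)

/-- `Γᵏᵢⱼ`. -/
def christoffel (x : R4) (k i j : Fin 4) : ℝ :=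
  (1 / 2) * ∑ l, (g x)⁻¹ k l *
    (pd i (fun y => g y l j) x + pd j (fun y => g y l i) x - pd l (fun y => g y i j) x)

/-- `Rᵃ_{bcd} = ∂_c Γᵃ_{bd} - ∂_d Γᵃ_{bc} + Γᵃ_{ce} Γᵉ_{bd} - Γᵃ_{de} Γᵉ_{bc}`. -/
def riemannUp (x : R4) (a b c d : Fin 4) : ℝ :=
  pd c (fun y => christoffel g y a b d) x - pd d (fun y => christoffel g y a b c) x
    + ∑ e, (christoffel g x a c e * christoffel g x e b d
        - christoffel g x a d e * christoffel g x e b c)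

/-- `R_{abcd}`. -/
def riemann (x : R4) : Tensor4 := fun a b c d => ∑ e, g x a e * riemannUp g x e b c d

/-- `R_{bd} = Rᵃ_{bad}`. -/
def ricci (x : R4) : Matrix (Fin 4) (Fin 4) ℝ := fun b d => ∑ a, riemannUp g x a b a d

/-- The scalar curvature. -/
def scalarCurv (x : R4) : ℝ := ∑ b, ∑ d, (g x)⁻¹ b d * ricci g x b d

end Coordinates

/-- Exterior product of two 2-tensors as double 1-forms:
`(A ∧ B)_{abcd} = A_{ac}B_{bd} + A_{bd}B_{ac} - A_{ad}B_{bc} - A_{bc}B_{ad}`. -/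
def extProd (A B : Matrix (Fin 4) (Fin 4) ℝ) : Tensor4 := fun a b c d =>
  A a c * B b d + A b d * B a c - A a d * B b c - A b c * B a d

/-- Composition of double 2-forms as endomorphisms of the space of 2-forms:
`(P ∘ Q)_{abcd} = ½ P_{ab}^{mn} Q_{mncd}`; `γ` is the metric at the point. -/
def comp (γ : Matrix (Fin 4) (Fin 4) ℝ) (P Q : Tensor4) : Tensor4 := fun a b c d =>
  (1 / 2) * ∑ k, ∑ l, ∑ m, ∑ n, P a b k l * γ⁻¹ k m * γ⁻¹ l n * Q m n c d

/-- Trace of a double 2-form as an endomorphism of the space of 2-forms, `½ P^{ab}_{ab}`. -/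
def trace4 (γ : Matrix (Fin 4) (Fin 4) ℝ) (P : Tensor4) : ℝ :=
  (1 / 2) * ∑ a, ∑ b, ∑ m, ∑ n, γ⁻¹ a m * γ⁻¹ b n * P m n a b

/-- Action of a double 2-form on a vector valued 2-form:
`P(Y)_{l,ab} = ½ P_{ab}^{mn} Y_{l,mn}`. -/
def act3 (γ : Matrix (Fin 4) (Fin 4) ℝ) (P : Tensor4) (Y : Tensor3) : Tensor3 := fun l a b =>
  (1 / 2) * ∑ k, ∑ t, ∑ m, ∑ n, P a b k t * γ⁻¹ k m * γ⁻¹ t n * Y l m n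

/-- Trace of a vector valued 2-form: `(tr Y)_a = g^{lm} Y_{l,ma}`. -/
def trace3 (γ : Matrix (Fin 4) (Fin 4) ℝ) (Y : Tensor3) : Tensor1 := fun a =>
  ∑ l, ∑ m, γ⁻¹ l m * Y l m a

/-- The vector `α^m = g^{mk} α_k`. -/
def raise (γ : Matrix (Fin 4) (Fin 4) ℝ) (α : Tensor1) : Fin 4 → ℝ := fun m =>
  ∑ k, γ⁻¹ m k * α k

/-- `P(x;y)_{ab} = P_{ambn} x^m y^n`. -/
def act22 (P : Tensor4) (x y : Fin 4 → ℝ) : Matrix (Fin 4) (Fin 4) ℝ := fun a b =>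
  ∑ m, ∑ n, P a m b n * x m * y n

/-- The metric volume element `η_{abcd} = √|det g| ε_{abcd}` (for the orientation given by
the coordinates), with `ε` the Levi-Civita symbol. -/
def volElt (γ : Matrix (Fin 4) (Fin 4) ℝ) : Tensor4 := fun a b c d =>
  Real.sqrt |γ.det| * Matrix.det (fun i j : Fin 4 => if ![a, b, c, d] i = j then (1 : ℝ) else 0)

/-- The Hodge dual of a double 2-form, `*P = η ∘ P`. -/
def hodge (γ : Matrix (Fin 4) (Fin 4) ℝ) (P : Tensor4) : Tensor4 := comp γ (volElt γ) P

/-- The real cube root. -/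
def cbrt (t : ℝ) : ℝ := SignType.sign t * |t| ^ (1 / 3 : ℝ)

section Concomitants

variable (g : R4 → Matrix (Fin 4) (Fin 4) ℝ)

/-- `G = ½ g ∧ g`. -/
def bigG (x : R4) : Tensor4 := (1 / 2 : ℝ) • extProd (g x) (g x)

/-- The Weyl tensor `W = Riem - ½ g ∧ Ric + (r/6) G`. -/
def weyl (x : R4) : Tensor4 :=
  riemann g x - (1 / 2 : ℝ) • extProd (g x) (ricci g x) + (scalarCurv g x / 6) • bigG g x

/-- `ρ = -(Tr W³ / 12)^{1/3}`. -/
def rho (x : R4) : ℝ :=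
  -cbrt (trace4 (g x) (comp (g x) (weyl g x) (comp (g x) (weyl g x) (weyl g x))) / 12)

/-- `S = (W - ρ G) / (3 ρ)`. -/
def bigS (x : R4) : Tensor4 := (1 / (3 * rho g x)) • (weyl g x - rho g x • bigG g x)

/-- The divergence `(∇·P)_{b,cd} = ∇^a P_{abcd}` with respect to the Levi-Civita connection. -/
def diverg (P : R4 → Tensor4) (x : R4) : Tensor3 := fun b c d =>
  ∑ e, ∑ a, (g x)⁻¹ e a *
    (pd e (fun y => P y a b c d) x
      - ∑ f, (christoffel g x f e a * P x f b c d + christoffel g x f e b * P x a f c d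
        + christoffel g x f e c * P x a b f d + christoffel g x f e d * P x a b c f))

/-- `Φ = tr [S(∇·S)]`. -/
def phi (x : R4) : Tensor1 := trace3 (g x) (act3 (g x) (bigS g x) (diverg g (bigS g) x))

/-- `*S(Φ;Φ)`. -/
def starSPhi (x : R4) : Matrix (Fin 4) (Fin 4) ℝ :=
  act22 (hodge (g x) (bigS g x)) (raise (g x) (phi g x)) (raise (g x) (phi g x))

/-- `*W(Φ;Φ)`. -/
def starWPhi (x : R4) : Matrix (Fin 4) (Fin 4) ℝ :=
  act22 (hodge (g x) (weyl g x)) (raise (g x) (phi g x)) (raise (g x) (phi g x))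

end Concomitants

/-! ### Block forms of a metric in a coordinate system -/

/-- The first two coordinates. -/
def firstPair (x : R4) : Fin 2 → ℝ := fun i => x (Fin.castAdd 2 i)

/-- The last two coordinates. -/
def lastPair (x : R4) : Fin 2 → ℝ := fun i => x (Fin.natAdd 2 i)

/-- The block diagonal matrix with blocks `A` (indices 0, 1) and `D` (indices 2, 3). -/
def blockDiag (A D : Matrix (Fin 2) (Fin 2) ℝ) : Matrix (Fin 4) (Fin 4) ℝ :=
  (Matrix.fromBlocks A 0 0 D).reindex finSumFinEquiv finSumFinEquiv

/-- A smooth 2-dimensional Lorentzian metric on `s ⊆ ℝ²`. -/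
structure IsLorentz2 (v : (Fin 2 → ℝ) → Matrix (Fin 2) (Fin 2) ℝ) (s : Set (Fin 2 → ℝ)) :
    Prop where
  smooth : ∀ i j, ContDiffOn ℝ ∞ (fun u => v u i j) s
  symm : ∀ u ∈ s, (v u).IsSymm
  det_neg : ∀ u ∈ s, (v u).det < 0

/-- A smooth 2-dimensional Riemannian metric on `s ⊆ ℝ²`. -/
structure IsRiemann2 (h : (Fin 2 → ℝ) → Matrix (Fin 2) (Fin 2) ℝ) (s : Set (Fin 2 → ℝ)) :
    Prop where
  smooth : ∀ i j, ContDiffOn ℝ ∞ (fun u => h u i j) s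
  posDef : ∀ u ∈ s, (h u).PosDef

/-- `g = e^{2λ} (v + h)` on `O`, where `v` is a Lorentzian metric in the first two coordinates,
`h` a Riemannian metric in the last two, and `λ` a function of the four coordinates. -/
def IsConfProductOn (g : R4 → Matrix (Fin 4) (Fin 4) ℝ) (O : Set R4) : Prop :=
  ∃ (v h : (Fin 2 → ℝ) → Matrix (Fin 2) (Fin 2) ℝ) (lam : R4 → ℝ),
    IsLorentz2 v (firstPair '' O) ∧ IsRiemann2 h (lastPair '' O) ∧ ContDiffOn ℝ ∞ lam O ∧
    ∀ x ∈ O, g x = blockDiag (Real.exp (2 * lam x) • v (firstPair x))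
      (Real.exp (2 * lam x) • h (lastPair x))

/-- `g = e^{2λ} v + h` on `O`, where `v` is a Lorentzian metric in the first two coordinates,
and `h` (a Riemannian metric) and `λ` live in the last two.
The proposition `C` is a further condition on the differential of `λ` at each point. -/
def IsTWarpedOn (C : ((Fin 2 → ℝ) →L[ℝ] ℝ) → Prop) (g : R4 → Matrix (Fin 4) (Fin 4) ℝ)
    (O : Set R4) : Prop :=
  ∃ (v h : (Fin 2 → ℝ) → Matrix (Fin 2) (Fin 2) ℝ) (lam : (Fin 2 → ℝ) → ℝ),
    IsLorentz2 v (firstPair '' O) ∧ IsRiemann2 h (lastPair '' O) ∧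
    ContDiffOn ℝ ∞ lam (lastPair '' O) ∧ (∀ u ∈ lastPair '' O, C (fderiv ℝ lam u)) ∧
    ∀ x ∈ O, g x = blockDiag (Real.exp (2 * lam (lastPair x)) • v (firstPair x)) (h (lastPair x))

/-- `g = v + e^{2λ} h` on `O`, where `h` is a Riemannian metric in the last two coordinates,
and `v` (a Lorentzian metric) and `λ` live in the first two.
The proposition `C` is a further condition on the differential of `λ` at each point. -/
def IsSWarpedOn (C : ((Fin 2 → ℝ) →L[ℝ] ℝ) → Prop) (g : R4 → Matrix (Fin 4) (Fin 4) ℝ)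
    (O : Set R4) : Prop :=
  ∃ (v h : (Fin 2 → ℝ) → Matrix (Fin 2) (Fin 2) ℝ) (lam : (Fin 2 → ℝ) → ℝ),
    IsLorentz2 v (firstPair '' O) ∧ IsRiemann2 h (lastPair '' O) ∧
    ContDiffOn ℝ ∞ lam (firstPair '' O) ∧ (∀ u ∈ firstPair '' O, C (fderiv ℝ lam u)) ∧
    ∀ x ∈ O, g x = blockDiag (v (firstPair x)) (Real.exp (2 * lam (firstPair x)) • h (lastPair x))

/-! ### Notions on a spacetime -/

section Spacetime

variable {M : Type*} [TopologicalSpace M] [ChartedSpace R4 M] [IsManifold (𝓡 4) ∞ M]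

/-- The matrix of components `g(∂ᵢ, ∂ⱼ)` in the chart `φ`, as a function of the coordinates. -/
def metricIn (g : LorentzMetric M) (φ : OpenPartialHomeomorph M R4) (x : R4) :
    Matrix (Fin 4) (Fin 4) ℝ := fun i j =>
  g.val (φ.symm x) (mfderiv (𝓡 4) (𝓡 4) φ.symm x (EuclideanSpace.single i (1 : ℝ)))
    (mfderiv (𝓡 4) (𝓡 4) φ.symm x (EuclideanSpace.single j (1 : ℝ)))

/-- A property of components of tensors at a point holds at every point of `M`, in every chart.
It is only used for the vanishing and non-vanishing of a tensor, possibly up to sign, which do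
not depend on the chart. -/
def Everywhere (g : LorentzMetric M)
    (P : (R4 → Matrix (Fin 4) (Fin 4) ℝ) → R4 → Prop) : Prop :=
  ∀ φ ∈ IsManifold.maximalAtlas (𝓡 4) ∞ M, ∀ x ∈ φ.target, P (metricIn g φ) x

/-- Around every point there is a chart in which the metric has the form `P`. -/
def Locally (g : LorentzMetric M)
    (P : (R4 → Matrix (Fin 4) (Fin 4) ℝ) → Set R4 → Prop) : Prop :=
  ∀ p : M, ∃ φ ∈ IsManifold.maximalAtlas (𝓡 4) ∞ M, p ∈ φ.source ∧ P (metricIn g φ) φ.target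

/-- A conformally 2+2 product spacetime. -/
def IsConfProduct (g : LorentzMetric M) : Prop := Locally g IsConfProductOn

/-- A 2+2 (t- or s-)warped spacetime in the wide sense: no condition on the warping factor. -/
def IsWarpedWide (g : LorentzMetric M) : Prop :=
  Locally g fun γ O => IsTWarpedOn (fun _ => True) γ O ∨ IsSWarpedOn (fun _ => True) γ O

/-- A 2+2 (t- or s-)warped spacetime: the warping factor is non-constant, `dλ ≠ 0`. -/
def IsWarped (g : LorentzMetric M) : Prop :=
  Locally g fun γ O => IsTWarpedOn (fun l => l ≠ 0) γ O ∨ IsSWarpedOn (fun l => l ≠ 0) γ O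

/-- Non conformally flat: the Weyl tensor does not vanish. -/
def NonConfFlat (g : LorentzMetric M) : Prop := Everywhere g fun γ x => weyl γ x ≠ 0

end Spacetime

end Warped22

end

/-!
In a chart adapted to the conformal product, `g = e^{2λ}(v + h)`, and in any other chart `g` is its
pullback; the pulled back pieces `v`, `h` are parallel for `v + h`. By conformal invariance the Weyl
tensor is a multiple of `G - 3U`, where `U = ½ (V ∧ V + H ∧ H)` with `V = e^{2λ} v` and
`H = e^{2λ} h`. Hence `S = -U` wherever `W ≠ 0`, and computing the divergence by means of the
parallel splitting gives `Φ = -2 dλ`. As `*U` exchanges the two planes, `*S(Φ;Φ)` is the symmetrized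
product of the dual of the `v`-part of `Φ` with the dual of its `h`-part, so it vanishes at a point
if and only if one of the two parts of `dλ` does.

This pointwise alternative is global on boxes: where `∂_A λ ≠ 0` in one plane the derivatives of `λ`
in the other plane vanish, so `∂_A λ` is constant along it, and nonzero derivatives at two points in
the two planes would meet at a third point. Thus `λ` depends on two of the coordinates only, and the
conformal factor is absorbed in one of the two surface metrics.
-/

noncomputable section

namespace Warped22

/-! ### Partial derivatives -/

/-- Components of a 2-tensor, as a matrix. -/
abbrev Tensor2 : Type := Matrix (Fin 4) (Fin 4) ℝ

theorem differentiableAt_of_contDiffOn {E F : Type*} [NormedAddCommGroup E] [NormedSpace ℝ E]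
    [NormedAddCommGroup F] [NormedSpace ℝ F] {f : E → F} {U : Set E} (hU : IsOpen U)
    (hf : ContDiffOn ℝ ∞ f U) {x : E} (hx : x ∈ U) : DifferentiableAt ℝ f x :=
  (hf.contDiffAt (hU.mem_nhds hx)).differentiableAt (by simp)

theorem contDiffOn_det {E ι : Type*} [NormedAddCommGroup E] [NormedSpace ℝ E] [Fintype ι]
    [DecidableEq ι] {A : E → Matrix ι ι ℝ} {U : Set E}
    (hA : ∀ i j, ContDiffOn ℝ ∞ (fun y => A y i j) U) :
    ContDiffOn ℝ ∞ (fun y => (A y).det) U := by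
  simp only [Matrix.det_apply]
  exact ContDiffOn.sum fun σ _ => (contDiffOn_prod fun i _ => hA (σ i) i).const_smul _

theorem contDiffOn_matrix_inv {E ι : Type*} [NormedAddCommGroup E] [NormedSpace ℝ E] [Fintype ι]
    [DecidableEq ι] {A : E → Matrix ι ι ℝ} {U : Set E}
    (hA : ∀ i j, ContDiffOn ℝ ∞ (fun y => A y i j) U) (hdet : ∀ y ∈ U, (A y).det ≠ 0) (i j : ι) :
    ContDiffOn ℝ ∞ (fun y => (A y)⁻¹ i j) U := by
  simp only [Matrix.inv_def, Ring.inverse_eq_inv', Matrix.smul_apply, smul_eq_mul,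
    Matrix.adjugate_apply]
  refine ((contDiffOn_det hA).inv hdet).mul (contDiffOn_det fun k l => ?_)
  by_cases hk : k = j
  · simpa [hk] using contDiffOn_const
  · simpa only [Matrix.updateRow_ne hk] using hA k l

section PartialDerivatives

variable {f k : R4 → ℝ} {U : Set R4} {x : R4}

theorem pd_congr (hU : IsOpen U) (h : ∀ y ∈ U, f y = k y) (i : Fin 4) (hx : x ∈ U) :
    pd i f x = pd i k x := by
  have hfk : f =ᶠ[𝓝 x] k := Filter.eventually_of_mem (hU.mem_nhds hx) h
  simp only [pd, hfk.fderiv_eq]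

theorem pd_const (i : Fin 4) (c : ℝ) (x : R4) : pd i (fun _ => c) x = 0 := by
  simp [pd]

theorem pd_add (hf : DifferentiableAt ℝ f x) (hk : DifferentiableAt ℝ k x) (i : Fin 4) :
    pd i (fun y => f y + k y) x = pd i f x + pd i k x := by
  simp [pd, fderiv_fun_add hf hk]

theorem pd_sub (hf : DifferentiableAt ℝ f x) (hk : DifferentiableAt ℝ k x) (i : Fin 4) :
    pd i (fun y => f y - k y) x = pd i f x - pd i k x := by
  simp [pd, fderiv_fun_sub hf hk]

theorem pd_mul (hf : DifferentiableAt ℝ f x) (hk : DifferentiableAt ℝ k x) (i : Fin 4) :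
    pd i (fun y => f y * k y) x = pd i f x * k x + f x * pd i k x := by
  simp only [pd, fderiv_fun_mul hf hk, add_apply, smul_apply, smul_eq_mul]
  ring

theorem pd_const_mul (c : ℝ) (hf : DifferentiableAt ℝ f x) (i : Fin 4) :
    pd i (fun y => c * f y) x = c * pd i f x := by
  rw [pd_mul (differentiableAt_const c) hf, pd_const, zero_mul, zero_add]

theorem pd_sum {ι : Type*} (s : Finset ι) {f : ι → R4 → ℝ}
    (hf : ∀ j ∈ s, DifferentiableAt ℝ (f j) x) (i : Fin 4) :
    pd i (fun y => ∑ j ∈ s, f j y) x = ∑ j ∈ s, pd i (f j) x := by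
  simp [pd, fderiv_fun_sum hf]

theorem pd_sum_mul {ι : Type*} [Fintype ι] {f k : ι → R4 → ℝ}
    (hf : ∀ j, DifferentiableAt ℝ (f j) x) (hk : ∀ j, DifferentiableAt ℝ (k j) x) (i : Fin 4) :
    pd i (fun y => ∑ j, f j y * k j y) x =
      ∑ j, pd i (f j) x * k j x + ∑ j, f j x * pd i (k j) x := by
  rw [pd_sum _ fun j _ => (hf j).fun_mul (hk j), ← Finset.sum_add_distrib]
  exact Finset.sum_congr rfl fun j _ => pd_mul (hf j) (hk j) i

theorem pd_exp_two_mul (hf : DifferentiableAt ℝ f x) (i : Fin 4) :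
    pd i (fun y => Real.exp (2 * f y)) x = Real.exp (2 * f x) * (2 * pd i f x) := by
  rw [← pd_const_mul 2 hf]
  simp [pd, fderiv_exp (hf.const_mul 2)]

theorem contDiffOn_pd (hU : IsOpen U) (hf : ContDiffOn ℝ ∞ f U) (i : Fin 4) :
    ContDiffOn ℝ ∞ (fun y => pd i f y) U :=
  (hf.fderiv_of_isOpen hU (by simp)).clm_apply contDiffOn_const

theorem pd_comm (hU : IsOpen U) (hf : ContDiffOn ℝ ∞ f U) (i j : Fin 4) (hx : x ∈ U) :
    pd i (fun y => pd j f y) x = pd j (fun y => pd i f y) x := by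
  have hsymm : IsSymmSndFDerivAt ℝ f x :=
    (hf.contDiffAt (hU.mem_nhds hx)).isSymmSndFDerivAt <| by
      rw [minSmoothness_of_isRCLikeNormedField]
      exact WithTop.coe_le_coe.2 le_top
  have hd : DifferentiableAt ℝ (fderiv ℝ f) x :=
    differentiableAt_of_contDiffOn hU (hf.fderiv_of_isOpen hU (by simp)) hx
  have pd_pd : ∀ a b : Fin 4, pd a (fun y => pd b f y) x =
      fderiv ℝ (fderiv ℝ f) x (EuclideanSpace.single a 1) (EuclideanSpace.single b 1) := by
    intro a b
    simp only [pd]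
    rw [fderiv_clm_apply hd (differentiableAt_const _)]
    simp
  rw [pd_pd, pd_pd, hsymm.eq]

theorem fderiv_apply_eq_sum_pd (f : R4 → ℝ) (x w : R4) :
    fderiv ℝ f x w = ∑ i, w i * pd i f x := by
  have hw : w = ∑ i, w i • EuclideanSpace.single i (1 : ℝ) := by
    ext k; simp [Pi.single_apply]
  conv_lhs => rw [hw]
  simp [pd]

end PartialDerivatives

/-- The partial derivative of a vector of functions, entry by entry. -/
def pdVec (i : Fin 4) (v : R4 → Tensor1) (x : R4) : Tensor1 := fun a => pd i (fun y => v y a) x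

/-- The partial derivative of a matrix of functions, entry by entry. -/
def pdMat (i : Fin 4) (A : R4 → Tensor2) (x : R4) : Tensor2 :=
  fun a b => pd i (fun y => A y a b) x

section MatrixDerivatives

variable {A B : R4 → Tensor2} {U : Set R4} {x : R4}

theorem pdMat_congr (hU : IsOpen U) (h : ∀ y ∈ U, A y = B y) (i : Fin 4) (hx : x ∈ U) :
    pdMat i A x = pdMat i B x :=
  Matrix.ext fun a b => pd_congr hU (fun y hy => congrFun (congrFun (h y hy) a) b) i hx

theorem pdMat_transpose (i : Fin 4) (A : R4 → Tensor2) (x : R4) :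
    pdMat i (fun y => (A y).transpose) x = (pdMat i A x).transpose := rfl

theorem pdMat_add (hA : ∀ a b, DifferentiableAt ℝ (fun y => A y a b) x)
    (hB : ∀ a b, DifferentiableAt ℝ (fun y => B y a b) x) (i : Fin 4) :
    pdMat i (fun y => A y + B y) x = pdMat i A x + pdMat i B x :=
  Matrix.ext fun a b => pd_add (hA a b) (hB a b) i

theorem pdMat_smul {f : R4 → ℝ} (hf : DifferentiableAt ℝ f x)
    (hA : ∀ a b, DifferentiableAt ℝ (fun y => A y a b) x) (i : Fin 4) :
    pdMat i (fun y => f y • A y) x = pd i f x • A x + f x • pdMat i A x :=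
  Matrix.ext fun a b => pd_mul hf (hA a b) i

theorem differentiableAt_matrix_mul (hA : ∀ a b, DifferentiableAt ℝ (fun y => A y a b) x)
    (hB : ∀ a b, DifferentiableAt ℝ (fun y => B y a b) x) (a b : Fin 4) :
    DifferentiableAt ℝ (fun y => (A y * B y) a b) x := by
  simp only [Matrix.mul_apply]
  exact DifferentiableAt.fun_sum fun j _ => (hA a j).fun_mul (hB j b)

theorem pdMat_mul (hA : ∀ a b, DifferentiableAt ℝ (fun y => A y a b) x)
    (hB : ∀ a b, DifferentiableAt ℝ (fun y => B y a b) x) (i : Fin 4) :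
    pdMat i (fun y => A y * B y) x = pdMat i A x * B x + A x * pdMat i B x := by
  ext a b
  simp only [pdMat, Matrix.mul_apply, Matrix.add_apply]
  exact pd_sum_mul (hA a) (fun j => hB j b) i

theorem pdMat_comm (hU : IsOpen U) (hA : ∀ a b, ContDiffOn ℝ ∞ (fun y => A y a b) U)
    (i j : Fin 4) (hx : x ∈ U) : pdMat i (pdMat j A) x = pdMat j (pdMat i A) x :=
  Matrix.ext fun a b => pd_comm hU (hA a b) i j hx

end MatrixDerivatives

/-! ### The Levi-Civita connection of a metric in coordinates -/

/-- The components of a nondegenerate smooth metric, of any signature, on the open set `U`. -/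
structure IsMetricOn (g : R4 → Tensor2) (U : Set R4) : Prop where
  isOpen : IsOpen U
  smooth : ∀ i j, ContDiffOn ℝ ∞ (fun y => g y i j) U
  symm : ∀ y ∈ U, (g y).IsSymm
  det_ne : ∀ y ∈ U, (g y).det ≠ 0

/-- The connection matrix `Γ_c = (Γᵃ_{cb})`, with row index `a` and column index `b`. -/
def connMat (g : R4 → Tensor2) (c : Fin 4) (x : R4) : Tensor2 := fun a b => christoffel g x a c b

/-- The curvature matrix `R_{cd} = (Rᵃ_{bcd})`, with row index `a` and column index `b`. -/
def curvMat (g : R4 → Tensor2) (c d : Fin 4) (x : R4) : Tensor2 := fun a b => riemannUp g x a b c d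

/-- The covariant derivative `∇_c T` of the 2-tensor `T` for the Levi-Civita connection of `g`. -/
def covDeriv (g T : R4 → Tensor2) (c : Fin 4) (x : R4) : Tensor2 :=
  pdMat c T x - ((connMat g c x).transpose * T x + T x * connMat g c x)

/-- The symmetries of the curvature tensor of a torsion-free metric connection. -/
structure IsCurvatureTensor (R : Tensor4) : Prop where
  antisymm_left : ∀ a b c d, R b a c d = -R a b c d
  antisymm_right : ∀ a b c d, R a b d c = -R a b c d
  bianchi : ∀ a b c d, R a b c d + R a c d b + R a d b c = 0

theorem IsCurvatureTensor.pair_symm {R : Tensor4} (hR : IsCurvatureTensor R) (a b c d : Fin 4) :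
    R a b c d = R c d a b := by
  have hl := hR.antisymm_left
  have hr := hR.antisymm_right
  linarith [hR.bianchi a b c d, hR.bianchi b c d a, hR.bianchi c d a b, hR.bianchi d a b c,
    hl a c d b, hl b d a c, hl a d b c, hl b a c d, hl a b c d, hl b c d a, hl c d a b,
    hl d a b c, hr c d a b, hr a b c d, hr b c d a, hr d a b c, hr a c d b, hr b d a c,
    hl c a b d, hl d b c a, hr c a b d, hr d b c a, hl b d c a, hl c a d b]

theorem riemann_eq_mul_curvMat (g : R4 → Tensor2) (x : R4) (a b c d : Fin 4) :
    riemann g x a b c d = (g x * curvMat g c d x) a b := rfl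

theorem riemannUp_antisymm (g : R4 → Tensor2) (x : R4) (a b c d : Fin 4) :
    riemannUp g x a b d c = -riemannUp g x a b c d := by
  simp only [riemannUp, Finset.sum_sub_distrib]
  ring

namespace IsMetricOn

variable {g : R4 → Tensor2} {U : Set R4} {x : R4}

theorem isUnit_det (hg : IsMetricOn g U) (hx : x ∈ U) : IsUnit (g x).det :=
  isUnit_iff_ne_zero.2 (hg.det_ne x hx)

theorem pd_symm (hg : IsMetricOn g U) (i j k : Fin 4) (hx : x ∈ U) :
    pd i (fun z => g z j k) x = pd i (fun z => g z k j) x :=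
  pd_congr hg.isOpen (fun z hz => (hg.symm z hz).apply k j) i hx

theorem differentiableAt (hg : IsMetricOn g U) (i j : Fin 4) (hx : x ∈ U) :
    DifferentiableAt ℝ (fun z => g z i j) x :=
  differentiableAt_of_contDiffOn hg.isOpen (hg.smooth i j) hx

theorem contDiffOn_inv (hg : IsMetricOn g U) (i j : Fin 4) :
    ContDiffOn ℝ ∞ (fun y => (g y)⁻¹ i j) U :=
  contDiffOn_matrix_inv hg.smooth hg.det_ne i j

theorem contDiffOn_christoffel (hg : IsMetricOn g U) (k i j : Fin 4) :
    ContDiffOn ℝ ∞ (fun y => christoffel g y k i j) U := by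
  have hpd : ∀ i j k, ContDiffOn ℝ ∞ (fun y => pd i (fun z => g z j k) y) U := fun i j k =>
    contDiffOn_pd hg.isOpen (hg.smooth j k) i
  exact contDiffOn_const.mul <| ContDiffOn.sum fun l _ =>
    (hg.contDiffOn_inv k l).mul (((hpd i l j).add (hpd j l i)).sub (hpd l i j))

theorem differentiableAt_connMat (hg : IsMetricOn g U) (c a b : Fin 4) (hx : x ∈ U) :
    DifferentiableAt ℝ (fun y => connMat g c y a b) x :=
  differentiableAt_of_contDiffOn hg.isOpen (hg.contDiffOn_christoffel a c b) hx

theorem christoffel_symm (hg : IsMetricOn g U) (hx : x ∈ U) (k i j : Fin 4) :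
    christoffel g x k i j = christoffel g x k j i := by
  unfold christoffel
  congr 1
  refine Finset.sum_congr rfl fun l _ => ?_
  rw [hg.pd_symm l i j hx]; ring

theorem mul_connMat_apply (hg : IsMetricOn g U) (hx : x ∈ U) (m i j : Fin 4) :
    (g x * connMat g i x) m j =
      (1 / 2) * (pd i (fun y => g y m j) x + pd j (fun y => g y m i) x
        - pd m (fun y => g y i j) x) := by
  have hΓ : connMat g i x = (g x)⁻¹ * Matrix.of fun l j => (1 / 2) *
      (pd i (fun y => g y l j) x + pd j (fun y => g y l i) x - pd l (fun y => g y i j) x) := by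
    ext k j
    simp only [connMat, christoffel, Matrix.mul_apply, Matrix.of_apply, Finset.mul_sum]
    exact Finset.sum_congr rfl fun l _ => by ring
  rw [hΓ, Matrix.mul_nonsing_inv_cancel_left _ _ (hg.isUnit_det hx), Matrix.of_apply]

theorem pdMat_self (hg : IsMetricOn g U) (hx : x ∈ U) (i : Fin 4) :
    pdMat i g x = (connMat g i x).transpose * g x + g x * connMat g i x := by
  have htr : (connMat g i x).transpose * g x = (g x * connMat g i x).transpose := by
    rw [Matrix.transpose_mul, (hg.symm x hx).eq]
  ext j k
  rw [htr, Matrix.add_apply, Matrix.transpose_apply, hg.mul_connMat_apply hx,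
    hg.mul_connMat_apply hx, hg.pd_symm i k j hx, hg.pd_symm j i k hx, hg.pd_symm k i j hx, pdMat]
  ring

theorem curvMat_eq (hg : IsMetricOn g U) (hx : x ∈ U) (c d : Fin 4) :
    curvMat g c d x = pdMat c (connMat g d) x - pdMat d (connMat g c) x
      + (connMat g c x * connMat g d x - connMat g d x * connMat g c x) := by
  have hpd : ∀ a b c d, pd c (fun y => christoffel g y a b d) x =
      pd c (fun y => christoffel g y a d b) x := fun a b c d =>
    pd_congr hg.isOpen (fun y hy => hg.christoffel_symm hy a b d) c hx
  ext a b
  simp only [curvMat, riemannUp, pdMat, connMat, Matrix.add_apply, Matrix.sub_apply,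
    Matrix.mul_apply, Finset.sum_sub_distrib, hg.christoffel_symm hx _ b _, hpd a b]

theorem ricci_identity (hg : IsMetricOn g U) {T : R4 → Tensor2}
    (hT : ∀ i j, ContDiffOn ℝ ∞ (fun y => T y i j) U)
    (hpar : ∀ y ∈ U, ∀ c, covDeriv g T c y = 0) (hx : x ∈ U) (c d : Fin 4) :
    (curvMat g c d x).transpose * T x + T x * curvMat g c d x = 0 := by
  have hdT : ∀ i j, DifferentiableAt ℝ (fun y => T y i j) x := fun i j =>
    differentiableAt_of_contDiffOn hg.isOpen (hT i j) hx
  have hdΓ : ∀ c a b, DifferentiableAt ℝ (fun y => connMat g c y a b) x := fun c a b =>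
    hg.differentiableAt_connMat c a b hx
  have hdΓt : ∀ c a b, DifferentiableAt ℝ (fun y => (connMat g c y).transpose a b) x :=
    fun c a b => hdΓ c b a
  have pd_T : ∀ c, ∀ y ∈ U,
      pdMat c T y = (connMat g c y).transpose * T y + T y * connMat g c y := fun c y hy =>
    sub_eq_zero.1 (hpar y hy c)
  have pd_pd_T : ∀ c d, pdMat c (pdMat d T) x =
      (pdMat c (connMat g d) x).transpose * T x + (connMat g d x).transpose * pdMat c T x
        + (pdMat c T x * connMat g d x + T x * pdMat c (connMat g d) x) := by
    intro c d
    rw [pdMat_congr hg.isOpen (pd_T d) c hx,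
      pdMat_add (differentiableAt_matrix_mul (hdΓt d) hdT)
        (differentiableAt_matrix_mul hdT (hdΓ d)),
      pdMat_mul (hdΓt d) hdT, pdMat_mul hdT (hdΓ d), pdMat_transpose]
  have hcomm := pdMat_comm hg.isOpen hT c d hx
  rw [pd_pd_T, pd_pd_T, pd_T c x hx, pd_T d x hx, ← sub_eq_zero] at hcomm
  rw [hg.curvMat_eq hx, ← hcomm]
  simp only [Matrix.transpose_add, Matrix.transpose_sub, Matrix.transpose_mul]
  noncomm_ring

theorem riemannUp_bianchi (hg : IsMetricOn g U) (hx : x ∈ U) (a b c d : Fin 4) :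
    riemannUp g x a b c d + riemannUp g x a c d b + riemannUp g x a d b c = 0 := by
  have hpd : ∀ e i j, pd e (fun y => christoffel g y a i j) x =
      pd e (fun y => christoffel g y a j i) x := fun e i j =>
    pd_congr hg.isOpen (fun y hy => hg.christoffel_symm hy a i j) e hx
  simp only [riemannUp, Finset.sum_sub_distrib, hg.christoffel_symm hx _ d b,
    hg.christoffel_symm hx _ c b, hg.christoffel_symm hx _ d c]
  linear_combination hpd c b d + hpd d c b + hpd b d c

theorem isCurvatureTensor_riemann (hg : IsMetricOn g U) (hx : x ∈ U) :
    IsCurvatureTensor (riemann g x) where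
  antisymm_left a b c d := by
    have hpar : ∀ y ∈ U, ∀ c, covDeriv g g c y = 0 := fun y hy c =>
      sub_eq_zero.2 (hg.pdMat_self hy c)
    have hskew := congrFun (congrFun (hg.ricci_identity hg.smooth hpar hx c d) b) a
    have htr : (curvMat g c d x).transpose * g x = (g x * curvMat g c d x).transpose := by
      rw [Matrix.transpose_mul, (hg.symm x hx).eq]
    rw [htr] at hskew
    rw [riemann_eq_mul_curvMat, riemann_eq_mul_curvMat]
    exact eq_neg_of_add_eq_zero_right hskew
  antisymm_right a b c d := by
    simp only [riemann, riemannUp_antisymm g x _ b c d, mul_neg, Finset.sum_neg_distrib]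
  bianchi a b c d := by
    simp only [riemann, ← Finset.sum_add_distrib, ← mul_add, hg.riemannUp_bianchi hx, mul_zero,
      Finset.sum_const_zero]

end IsMetricOn

/-! ### Algebra of double 2-forms -/

section DoubleForms

variable (γ A B C D : Tensor2) (P Q R : Tensor4) (r : ℝ)

theorem extProd_comm : extProd A B = extProd B A := by
  funext a b c d; simp only [extProd]; ring

theorem extProd_add_left : extProd (A + B) C = extProd A C + extProd B C := by
  funext a b c d; simp only [extProd, Matrix.add_apply, Pi.add_apply]; ring

theorem extProd_add_right : extProd A (B + C) = extProd A B + extProd A C := by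
  rw [extProd_comm, extProd_add_left, extProd_comm B, extProd_comm C]

theorem extProd_smul_left : extProd (r • A) B = r • extProd A B := by
  funext a b c d; simp only [extProd, Matrix.smul_apply, Pi.smul_apply, smul_eq_mul]; ring

theorem extProd_smul_right : extProd A (r • B) = r • extProd A B := by
  rw [extProd_comm, extProd_smul_left, extProd_comm]

theorem extProd_zero_left : extProd 0 A = 0 := by
  funext a b c d; simp [extProd]

theorem comp_add_left : comp γ (P + Q) R = comp γ P R + comp γ Q R := by
  funext a b c d
  simp only [comp, Pi.add_apply, add_mul, Finset.sum_add_distrib, mul_add]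

theorem comp_add_right : comp γ P (Q + R) = comp γ P Q + comp γ P R := by
  funext a b c d
  simp only [comp, Pi.add_apply, mul_add, Finset.sum_add_distrib]

theorem comp_smul_left : comp γ (r • P) Q = r • comp γ P Q := by
  funext a b c d
  simp only [comp, Pi.smul_apply, smul_eq_mul, Finset.mul_sum]
  iterate 4 refine Finset.sum_congr rfl fun _ _ => ?_
  ring

theorem comp_smul_right : comp γ P (r • Q) = r • comp γ P Q := by
  funext a b c d
  simp only [comp, Pi.smul_apply, smul_eq_mul, Finset.mul_sum]
  iterate 4 refine Finset.sum_congr rfl fun _ _ => ?_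
  ring

theorem trace4_add : trace4 γ (P + Q) = trace4 γ P + trace4 γ Q := by
  simp only [trace4, Pi.add_apply, mul_add, Finset.sum_add_distrib]

theorem trace4_smul : trace4 γ (r • P) = r * trace4 γ P := by
  simp only [trace4, Pi.smul_apply, smul_eq_mul, Finset.mul_sum]
  iterate 4 refine Finset.sum_congr rfl fun _ _ => ?_
  ring

/-- The tensor product `A_{ac} B_{bd}`, which `extProd` antisymmetrises. -/
def tensorProd : Tensor4 := fun a b c d => A a c * B b d

/-- Exchange of the last two indices of a 4-tensor. -/
def swapLast : Tensor4 := fun a b c d => P a b d c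

theorem extProd_eq_tensorProd : extProd A B = tensorProd A B + tensorProd B A
    + (-1 : ℝ) • (swapLast (tensorProd A B) + swapLast (tensorProd B A)) := by
  funext a b c d
  simp only [extProd, tensorProd, swapLast, Pi.add_apply, Pi.smul_apply, smul_eq_mul]
  ring

theorem mul_mul_apply_eq_sum (a c : Fin 4) :
    (A * B * C) a c = ∑ k, ∑ m, A a k * B k m * C m c := by
  simp only [Matrix.mul_apply, Finset.sum_mul]
  exact Finset.sum_comm

theorem comp_tensorProd : comp γ (tensorProd A B) (tensorProd C D) =
    (1 / 2 : ℝ) • tensorProd (A * γ⁻¹ * C) (B * γ⁻¹ * D) := by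
  funext a b c d
  simp only [comp, tensorProd, Pi.smul_apply, smul_eq_mul, mul_mul_apply_eq_sum,
    Finset.sum_mul_sum]
  congr 1
  iterate 4 refine Finset.sum_congr rfl fun _ _ => ?_
  ring

theorem comp_swapLast_right : comp γ P (swapLast Q) = swapLast (comp γ P Q) := rfl

theorem comp_swapLast_tensorProd : comp γ (swapLast (tensorProd A B)) (tensorProd C D) =
    (1 / 2 : ℝ) • swapLast (tensorProd (A * γ⁻¹ * D) (B * γ⁻¹ * C)) := by
  funext a b c d
  simp only [comp, tensorProd, swapLast, Pi.smul_apply, smul_eq_mul, mul_mul_apply_eq_sum,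
    Finset.sum_mul_sum]
  congr 1
  rw [Finset.sum_comm]
  refine Finset.sum_congr rfl fun _ _ => Finset.sum_congr rfl fun _ _ => ?_
  rw [Finset.sum_comm]
  refine Finset.sum_congr rfl fun _ _ => Finset.sum_congr rfl fun _ _ => ?_
  ring

theorem comp_extProd : comp γ (extProd A B) (extProd C D) =
    extProd (A * γ⁻¹ * C) (B * γ⁻¹ * D) + extProd (A * γ⁻¹ * D) (B * γ⁻¹ * C) := by
  have swap_add : ∀ P Q, swapLast (P + Q) = swapLast P + swapLast Q := fun _ _ => rfl
  have swap_smul : ∀ (s : ℝ) P, swapLast (s • P) = s • swapLast P := fun _ _ => rfl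
  have swap_swap : ∀ P, swapLast (swapLast P) = P := fun _ => rfl
  simp only [extProd_eq_tensorProd, comp_add_left, comp_add_right, comp_smul_left,
    comp_smul_right, comp_swapLast_right, comp_tensorProd, comp_swapLast_tensorProd, swap_add,
    swap_smul, swap_swap]
  module

/-- The Ricci contraction `γ^{ac} P_{abcd}`. -/
def ricciContr : Tensor2 := fun b d => ∑ a, ∑ c, γ⁻¹ a c * P a b c d

theorem ricciContr_add : ricciContr γ (P + Q) = ricciContr γ P + ricciContr γ Q := by
  funext b d
  simp only [ricciContr, Pi.add_apply, mul_add, Finset.sum_add_distrib, Matrix.add_apply]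

theorem ricciContr_smul : ricciContr γ (r • P) = r • ricciContr γ P := by
  funext b d
  simp only [ricciContr, Pi.smul_apply, smul_eq_mul, Matrix.smul_apply, Finset.mul_sum]
  iterate 2 refine Finset.sum_congr rfl fun _ _ => ?_
  ring

/-- The metric trace `γ^{ac} A_{ac}` of a 2-tensor. -/
def mtrace : ℝ := ∑ a, ∑ c, γ⁻¹ a c * A a c

theorem mtrace_add : mtrace γ (A + B) = mtrace γ A + mtrace γ B := by
  simp only [mtrace, Matrix.add_apply, mul_add, Finset.sum_add_distrib]

theorem mtrace_smul : mtrace γ (r • A) = r * mtrace γ A := by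
  simp only [mtrace, Matrix.smul_apply, smul_eq_mul, Finset.mul_sum]
  iterate 2 refine Finset.sum_congr rfl fun _ _ => ?_
  ring

variable {γ} in
theorem ricciContr_extProd (hγ : γ⁻¹.IsSymm) : ricciContr γ (extProd A B) =
    mtrace γ A • B + mtrace γ B • A - B * γ⁻¹ * A - A * γ⁻¹ * B := by
  have contract : ∀ (A B : Tensor2) b d,
      (A * γ⁻¹ * B) b d = ∑ a, ∑ c, A b c * γ⁻¹ a c * B a d := by
    intro A B b d
    rw [mul_mul_apply_eq_sum, Finset.sum_comm]
    simp only [hγ.apply]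
  funext b d
  simp only [Matrix.sub_apply, Matrix.add_apply, Matrix.smul_apply, smul_eq_mul, contract, mtrace,
    Finset.sum_mul, ricciContr, extProd, ← Finset.sum_add_distrib, ← Finset.sum_sub_distrib]
  iterate 2 refine Finset.sum_congr rfl fun _ _ => ?_
  ring

variable {γ} in
theorem trace4_eq_mtrace_ricciContr (hγ : γ⁻¹.IsSymm) :
    trace4 γ P = (1 / 2) * mtrace γ (ricciContr γ P) := by
  simp only [trace4, mtrace, ricciContr, Finset.mul_sum, ← Fintype.sum_prod_type']
  refine Fintype.sum_equiv ⟨fun p => (p.2.2.2, p.2.1, p.2.2.1, p.1),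
    fun p => (p.2.2.2, p.2.1, p.2.2.1, p.1), fun _ => rfl, fun _ => rfl⟩ _ _ fun p => ?_
  simp only [Equiv.coe_fn_mk]
  rw [hγ.apply p.2.2.1 p.1, hγ.apply p.2.2.2 p.2.1]
  ring

end DoubleForms

/-! ### The Weyl tensor of a curvature tensor with pure blocks -/

/-- `γ = v + h` is an orthogonal splitting of the metric `γ` into two metrics of rank two. -/
structure IsSplit (γ v h : Tensor2) : Prop where
  eq_add : γ = v + h
  det_ne : γ.det ≠ 0
  symm_left : v.IsSymm
  symm_right : h.IsSymm
  left_left : v * γ⁻¹ * v = v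
  left_right : v * γ⁻¹ * h = 0
  right_left : h * γ⁻¹ * v = 0
  right_right : h * γ⁻¹ * h = h
  mtrace_left : mtrace γ v = 2
  mtrace_right : mtrace γ h = 2

/-- The identity `½ γ ∧ γ` of the space of 2-forms; it is `bigG`, for a metric at one point. -/
def idForm (γ : Tensor2) : Tensor4 := (1 / 2 : ℝ) • extProd γ γ

/-- The double 2-form `½ v ∧ v + ½ h ∧ h`. For a splitting `γ = v + h` it is the projection onto
the 2-forms that do not mix the two summands. -/
def pureForm (v h : Tensor2) : Tensor4 :=
  (1 / 2 : ℝ) • extProd v v + (1 / 2 : ℝ) • extProd h h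

theorem cbrt_neg_pow (r : ℝ) : cbrt (-r ^ 3) = -r := by
  have habs : |-r ^ 3| ^ (1 / 3 : ℝ) = |r| := by
    rw [abs_neg, abs_pow, ← Real.rpow_natCast, ← Real.rpow_mul (abs_nonneg r)]
    norm_num
  have hsign : SignType.sign (-r ^ 3) = -SignType.sign r := by
    rw [Left.sign_neg, sign_pow, SignType.pow_odd _ (by decide)]
  rw [cbrt, habs, hsign, SignType.coe_neg, neg_mul, sign_mul_abs]

namespace IsSplit

variable {γ v h : Tensor2}

theorem swap (H : IsSplit γ v h) : IsSplit γ h v :=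
  ⟨by rw [H.eq_add, add_comm], H.det_ne, H.symm_right, H.symm_left, H.right_right, H.right_left,
    H.left_right, H.left_left, H.mtrace_right, H.mtrace_left⟩

theorem symm (H : IsSplit γ v h) : γ.IsSymm := by
  rw [H.eq_add]; exact H.symm_left.add H.symm_right

theorem symm_inv (H : IsSplit γ v h) : γ⁻¹.IsSymm := by
  rw [Matrix.IsSymm, Matrix.transpose_nonsing_inv, H.symm.eq]

theorem self_mul_inv (H : IsSplit γ v h) : γ * γ⁻¹ = 1 :=
  Matrix.mul_nonsing_inv _ (isUnit_iff_ne_zero.2 H.det_ne)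

theorem inv_mul_self (H : IsSplit γ v h) : γ⁻¹ * γ = 1 :=
  Matrix.nonsing_inv_mul _ (isUnit_iff_ne_zero.2 H.det_ne)

theorem mtrace_self (H : IsSplit γ v h) : mtrace γ γ = 4 := by
  conv_lhs => arg 2; rw [H.eq_add]
  rw [mtrace_add, H.mtrace_left, H.mtrace_right]; norm_num

theorem comp_id_left (H : IsSplit γ v h) (A B : Tensor2) :
    comp γ (idForm γ) (extProd A B) = extProd A B := by
  simp only [idForm, comp_smul_left, comp_extProd, H.self_mul_inv, one_mul, extProd_comm B A]
  module

theorem comp_id_right (H : IsSplit γ v h) (A B : Tensor2) :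
    comp γ (extProd A B) (idForm γ) = extProd A B := by
  simp only [idForm, comp_smul_right, comp_extProd, mul_assoc, H.inv_mul_self, mul_one]
  module

theorem comp_id_id (H : IsSplit γ v h) : comp γ (idForm γ) (idForm γ) = idForm γ := by
  conv_lhs => arg 3; rw [idForm]
  rw [comp_smul_right, H.comp_id_left, idForm]

theorem comp_id_pure (H : IsSplit γ v h) : comp γ (idForm γ) (pureForm v h) = pureForm v h := by
  simp only [pureForm, comp_add_right, comp_smul_right, H.comp_id_left]

theorem comp_pure_id (H : IsSplit γ v h) : comp γ (pureForm v h) (idForm γ) = pureForm v h := by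
  simp only [pureForm, comp_add_left, comp_smul_left, H.comp_id_right]

theorem comp_pure_pure (H : IsSplit γ v h) :
    comp γ (pureForm v h) (pureForm v h) = pureForm v h := by
  simp only [pureForm, comp_add_left, comp_add_right, comp_smul_left, comp_smul_right,
    comp_extProd, H.left_left, H.left_right, H.right_left, H.right_right, extProd_zero_left]
  module

theorem ricciContr_extProd_left (H : IsSplit γ v h) :
    ricciContr γ (extProd v v) = (2 : ℝ) • v := by
  rw [ricciContr_extProd _ _ H.symm_inv, H.mtrace_left, H.left_left]; module

theorem ricciContr_extProd_right (H : IsSplit γ v h) :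
    ricciContr γ (extProd h h) = (2 : ℝ) • h :=
  H.swap.ricciContr_extProd_left

theorem ricciContr_extProd_self (H : IsSplit γ v h) (T : Tensor2) :
    ricciContr γ (extProd γ T) = (2 : ℝ) • T + mtrace γ T • γ := by
  rw [ricciContr_extProd _ _ H.symm_inv, H.mtrace_self, mul_assoc, H.inv_mul_self,
    H.self_mul_inv, mul_one, one_mul]
  module

theorem trace4_pure (H : IsSplit γ v h) : trace4 γ (pureForm v h) = 2 := by
  rw [trace4_eq_mtrace_ricciContr _ H.symm_inv, pureForm, ricciContr_add, ricciContr_smul,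
    ricciContr_smul, H.ricciContr_extProd_left, H.ricciContr_extProd_right]
  simp only [mtrace_add, mtrace_smul, H.mtrace_left, H.mtrace_right]
  norm_num

theorem trace4_id (H : IsSplit γ v h) : trace4 γ (idForm γ) = 6 := by
  rw [trace4_eq_mtrace_ricciContr _ H.symm_inv, idForm, ricciContr_smul,
    H.ricciContr_extProd_self]
  simp only [mtrace_add, mtrace_smul, H.mtrace_self]
  norm_num

theorem trace4_cube (H : IsSplit γ v h) (r : ℝ) {W : Tensor4}
    (hW : W = r • (idForm γ + (-3 : ℝ) • pureForm v h)) :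
    trace4 γ (comp γ W (comp γ W W)) = -12 * r ^ 3 := by
  have hsq : comp γ W W = r ^ 2 • (idForm γ + (3 : ℝ) • pureForm v h) := by
    simp only [hW, comp_add_left, comp_add_right, comp_smul_left, comp_smul_right, H.comp_id_id,
      H.comp_id_pure, H.comp_pure_id, H.comp_pure_pure]
    module
  have hcube : comp γ W (comp γ W W) = r ^ 3 • (idForm γ + (-9 : ℝ) • pureForm v h) := by
    rw [hsq]
    simp only [hW, comp_add_left, comp_add_right, comp_smul_left, comp_smul_right, H.comp_id_id,
      H.comp_id_pure, H.comp_pure_id, H.comp_pure_pure]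
    module
  rw [hcube]
  simp only [trace4_smul, trace4_add, H.trace4_pure, H.trace4_id]
  ring

theorem extProd_self_left (H : IsSplit γ v h) : extProd γ v = extProd v v + extProd v h := by
  conv_lhs => rw [H.eq_add]
  rw [extProd_add_left, extProd_comm h v]

end IsSplit

section Weyl

variable {g : R4 → Tensor2} {x : R4} {v h : Tensor2}

theorem ricci_eq_ricciContr (hs : (g x)⁻¹.IsSymm) (hd : (g x).det ≠ 0) :
    ricci g x = ricciContr (g x) (riemann g x) := by
  have inv_mul_riemann : ∀ b d e,
      ∑ a, (g x)⁻¹ e a * riemann g x a b e d = riemannUp g x e b e d := by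
    intro b d e
    change ((g x)⁻¹ * (g x * curvMat g e d x)) e b = _
    rw [Matrix.nonsing_inv_mul_cancel_left _ _ (isUnit_iff_ne_zero.2 hd)]
    rfl
  funext b d
  simp only [ricci, ricciContr, ← inv_mul_riemann]
  rw [Finset.sum_comm]
  simp only [hs.apply]

theorem weyl_eq_of_riemann {T : Tensor2} {k l : ℝ} (H : IsSplit (g x) v h)
    (hR : riemann g x = k • extProd v v + l • extProd h h + extProd (g x) T) :
    weyl g x = (-(k + l) / 3) • (idForm (g x) + (-3 : ℝ) • pureForm v h) := by
  have hric : ricci g x = (2 * k) • v + (2 * l) • h + (2 : ℝ) • T + mtrace (g x) T • g x := by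
    rw [ricci_eq_ricciContr H.symm_inv H.det_ne, hR]
    simp only [ricciContr_add, ricciContr_smul, H.ricciContr_extProd_left,
      H.ricciContr_extProd_right, H.ricciContr_extProd_self]
    module
  have hscal : scalarCurv g x = 4 * k + 4 * l + 6 * mtrace (g x) T := by
    change mtrace (g x) (ricci g x) = _
    rw [hric]
    simp only [mtrace_add, mtrace_smul, H.mtrace_left, H.mtrace_right, H.mtrace_self]
    ring
  have hself : extProd (g x) (g x) = extProd v v + extProd h h + (2 : ℝ) • extProd v h := by
    conv_lhs => arg 2; rw [H.eq_add]
    rw [extProd_add_right, H.extProd_self_left, H.swap.extProd_self_left, extProd_comm h v]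
    module
  rw [weyl, hric, hscal, hR, bigG]
  simp only [idForm, pureForm, extProd_add_right, extProd_smul_right, H.extProd_self_left,
    H.swap.extProd_self_left, extProd_comm h v, hself]
  module

theorem rho_eq {r : ℝ} (H : IsSplit (g x) v h)
    (hW : weyl g x = r • (idForm (g x) + (-3 : ℝ) • pureForm v h)) : rho g x = r := by
  have htr : -12 * r ^ 3 / 12 = -r ^ 3 := by ring
  rw [rho, H.trace4_cube r hW, htr, cbrt_neg_pow, neg_neg]

theorem bigS_eq {r : ℝ} (H : IsSplit (g x) v h)
    (hW : weyl g x = r • (idForm (g x) + (-3 : ℝ) • pureForm v h)) (hr : r ≠ 0) :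
    bigS g x = -pureForm v h := by
  have hnum : weyl g x - rho g x • bigG g x = (3 * r) • (-pureForm v h) := by
    rw [hW, rho_eq H hW, bigG, idForm]
    module
  rw [bigS, hnum, rho_eq H hW, smul_smul, one_div, inv_mul_cancel₀ (by simpa using hr), one_smul]

end Weyl

/-! ### Adapted frames -/

section BlockDiag

variable (A D A' D' : Matrix (Fin 2) (Fin 2) ℝ)

theorem blockDiag_apply : blockDiag A D =
    !![A 0 0, A 0 1, 0, 0; A 1 0, A 1 1, 0, 0; 0, 0, D 0 0, D 0 1; 0, 0, D 1 0, D 1 1] := by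
  ext i j
  fin_cases i <;> fin_cases j <;> rfl

theorem blockDiag_mul :
    blockDiag A D * blockDiag A' D' = blockDiag (A * A') (D * D') := by
  simp [blockDiag, Matrix.reindex_apply, Matrix.submatrix_mul_equiv, Matrix.fromBlocks_multiply]

theorem blockDiag_one : blockDiag 1 1 = 1 := by
  simp [blockDiag, Matrix.fromBlocks_one]

theorem blockDiag_zero : blockDiag 0 0 = 0 := by
  simp [blockDiag, Matrix.fromBlocks_zero]

theorem blockDiag_add_blockDiag :
    blockDiag A D + blockDiag A' D' = blockDiag (A + A') (D + D') := by
  ext i j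
  fin_cases i <;> fin_cases j <;> simp [blockDiag_apply]

theorem smul_blockDiag (r : ℝ) : r • blockDiag A D = blockDiag (r • A) (r • D) := by
  ext i j
  fin_cases i <;> fin_cases j <;> simp [blockDiag_apply]

theorem blockDiag_transpose :
    (blockDiag A D).transpose = blockDiag A.transpose D.transpose := by
  simp [blockDiag, Matrix.fromBlocks_transpose, Matrix.reindex_apply]

theorem blockDiag_det : (blockDiag A D).det = A.det * D.det := by
  simp [blockDiag]

variable {A D}

theorem blockDiag_inv (hA : A.det ≠ 0) (hD : D.det ≠ 0) :
    (blockDiag A D)⁻¹ = blockDiag A⁻¹ D⁻¹ := by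
  refine Matrix.inv_eq_right_inv ?_
  rw [blockDiag_mul, Matrix.mul_nonsing_inv _ (isUnit_iff_ne_zero.2 hA),
    Matrix.mul_nonsing_inv _ (isUnit_iff_ne_zero.2 hD), blockDiag_one]

theorem blockDiag_isSymm (hA : A.IsSymm) (hD : D.IsSymm) : (blockDiag A D).IsSymm := by
  rw [Matrix.IsSymm, blockDiag_transpose, hA.eq, hD.eq]

end BlockDiag

/-- The components `Jᵀ X J` of the 2-tensor `X` after the linear change of coordinates `J`. -/
def pullMat (J X : Tensor2) : Tensor2 := J.transpose * X * J

section PullMat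

variable {J K γ X : Tensor2}

theorem pullMat_apply (a b : Fin 4) :
    pullMat J X a b = ∑ i, ∑ j, J i a * X i j * J j b :=
  mul_mul_apply_eq_sum _ _ _ a b

theorem pullMat_add (X Y : Tensor2) : pullMat J (X + Y) = pullMat J X + pullMat J Y := by
  simp only [pullMat, mul_add, add_mul]

theorem pullMat_smul (r : ℝ) (X : Tensor2) : pullMat J (r • X) = r • pullMat J X := by
  simp only [pullMat, Matrix.mul_smul, Matrix.smul_mul]

theorem pullMat_pullMat (J K X : Tensor2) : pullMat K (pullMat J X) = pullMat (J * K) X := by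
  simp only [pullMat, Matrix.transpose_mul, mul_assoc]

theorem pullMat_pullMat_of_mul_eq_one (hJK : J * K = 1) (X : Tensor2) :
    pullMat K (pullMat J X) = X := by
  rw [pullMat_pullMat, hJK, pullMat, Matrix.transpose_one, one_mul, mul_one]

theorem pullMat_injective (hJK : J * K = 1) : Function.Injective (pullMat J) :=
  Function.LeftInverse.injective (pullMat_pullMat_of_mul_eq_one hJK)

theorem pullMat_isSymm (hX : X.IsSymm) : (pullMat J X).IsSymm := by
  simp only [Matrix.IsSymm, pullMat, Matrix.transpose_mul, hX.eq, Matrix.transpose_transpose,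
    mul_assoc]

theorem pullMat_inv (J X : Tensor2) : (pullMat J X)⁻¹ = J⁻¹ * X⁻¹ * J⁻¹.transpose := by
  simp only [pullMat, Matrix.mul_inv_rev, Matrix.transpose_nonsing_inv, mul_assoc]

theorem mul_inv_pullMat_mul_transpose (hJ : J.det ≠ 0) (γ : Tensor2) :
    J * (pullMat J γ)⁻¹ * J.transpose = γ⁻¹ := by
  have hJK : J * J⁻¹ = 1 := Matrix.mul_nonsing_inv _ (isUnit_iff_ne_zero.2 hJ)
  calc J * (pullMat J γ)⁻¹ * J.transpose = (J * J⁻¹) * γ⁻¹ * (J * J⁻¹).transpose := by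
        simp only [pullMat_inv, Matrix.transpose_mul, mul_assoc]
    _ = γ⁻¹ := by rw [hJK, Matrix.transpose_one, one_mul, mul_one]

theorem pullMat_mul_inv_mul_pullMat (hJ : J.det ≠ 0) (γ X Y : Tensor2) :
    pullMat J X * (pullMat J γ)⁻¹ * pullMat J Y = pullMat J (X * γ⁻¹ * Y) := by
  rw [← mul_inv_pullMat_mul_transpose hJ γ]
  simp only [pullMat, mul_assoc]

theorem mtrace_eq_trace (γ A : Tensor2) : mtrace γ A = (γ⁻¹ * A.transpose).trace := by
  simp only [mtrace, Matrix.trace, Matrix.diag_apply, Matrix.mul_apply, Matrix.transpose_apply]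

theorem mtrace_pullMat (hJ : J.det ≠ 0) (γ A : Tensor2) :
    mtrace (pullMat J γ) (pullMat J A) = mtrace γ A := by
  rw [mtrace_eq_trace, mtrace_eq_trace, ← mul_inv_pullMat_mul_transpose hJ γ, mul_assoc J,
    mul_assoc J, Matrix.trace_mul_comm J]
  simp only [pullMat, Matrix.transpose_mul, Matrix.transpose_transpose, mul_assoc]

theorem IsSplit.pullMat {v h : Tensor2} (H : IsSplit γ v h) (hJ : J.det ≠ 0) :
    IsSplit (pullMat J γ) (pullMat J v) (pullMat J h) where
  eq_add := by rw [← pullMat_add, ← H.eq_add]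
  det_ne := by
    rw [Warped22.pullMat, Matrix.det_mul, Matrix.det_mul, Matrix.det_transpose]
    exact mul_ne_zero (mul_ne_zero hJ H.det_ne) hJ
  symm_left := pullMat_isSymm H.symm_left
  symm_right := pullMat_isSymm H.symm_right
  left_left := by rw [pullMat_mul_inv_mul_pullMat hJ, H.left_left]
  left_right := by
    rw [pullMat_mul_inv_mul_pullMat hJ, H.left_right, Warped22.pullMat, mul_zero, zero_mul]
  right_left := by
    rw [pullMat_mul_inv_mul_pullMat hJ, H.right_left, Warped22.pullMat, mul_zero, zero_mul]
  right_right := by rw [pullMat_mul_inv_mul_pullMat hJ, H.right_right]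
  mtrace_left := by rw [mtrace_pullMat hJ, H.mtrace_left]
  mtrace_right := by rw [mtrace_pullMat hJ, H.mtrace_right]

end PullMat

theorem isSplit_blockDiag {V H : Matrix (Fin 2) (Fin 2) ℝ} (hV : V.det ≠ 0) (hH : H.det ≠ 0)
    (hVs : V.IsSymm) (hHs : H.IsSymm) :
    IsSplit (blockDiag V H) (blockDiag V 0) (blockDiag 0 H) := by
  have hV' : V * V⁻¹ = 1 := Matrix.mul_nonsing_inv _ (isUnit_iff_ne_zero.2 hV)
  have hH' : H * H⁻¹ = 1 := Matrix.mul_nonsing_inv _ (isUnit_iff_ne_zero.2 hH)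
  have htrace : ∀ A D : Matrix (Fin 2) (Fin 2) ℝ, (blockDiag A D).trace = A.trace + D.trace := by
    intro A D
    simp only [blockDiag_apply, Matrix.trace, Fin.sum_univ_four, Fin.sum_univ_two]
    simp [add_assoc]
  constructor
  case eq_add => rw [blockDiag_add_blockDiag, add_zero, zero_add]
  case det_ne => rw [blockDiag_det]; exact mul_ne_zero hV hH
  case symm_left => exact blockDiag_isSymm hVs Matrix.isSymm_zero
  case symm_right => exact blockDiag_isSymm Matrix.isSymm_zero hHs
  case mtrace_left | mtrace_right =>
    rw [mtrace_eq_trace, blockDiag_inv hV hH, blockDiag_transpose, blockDiag_mul, htrace]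
    simp [hVs.eq, hHs.eq, hV, hH]
  all_goals simp [blockDiag_inv hV hH, blockDiag_mul, blockDiag_zero, hV', hH']

/-- The data of an adapted coframe: its covectors are the rows of `J`, and `V` and `H` are the
components in it of two metrics of rank two. They make up the metric
`pullMat J (blockDiag V H)`. -/
structure IsAdaptedFrame (J : Tensor2) (V H : Matrix (Fin 2) (Fin 2) ℝ) : Prop where
  det_ne : J.det ≠ 0
  det_left : V.det ≠ 0
  det_right : H.det ≠ 0
  symm_left : V.IsSymm
  symm_right : H.IsSymm

namespace IsAdaptedFrame

variable {J : Tensor2} {V H : Matrix (Fin 2) (Fin 2) ℝ}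

theorem isSplit (hJ : IsAdaptedFrame J V H) : IsSplit (pullMat J (blockDiag V H))
    (pullMat J (blockDiag V 0)) (pullMat J (blockDiag 0 H)) :=
  (isSplit_blockDiag hJ.det_left hJ.det_right hJ.symm_left hJ.symm_right).pullMat hJ.det_ne

theorem smul (hJ : IsAdaptedFrame J V H) {r : ℝ} (hr : r ≠ 0) :
    IsAdaptedFrame J (r • V) (r • H) where
  det_ne := hJ.det_ne
  det_left := by rw [Matrix.det_smul]; exact mul_ne_zero (pow_ne_zero _ hr) hJ.det_left
  det_right := by rw [Matrix.det_smul]; exact mul_ne_zero (pow_ne_zero _ hr) hJ.det_right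
  symm_left := hJ.symm_left.smul r
  symm_right := hJ.symm_right.smul r

theorem mul_inv (hJ : IsAdaptedFrame J V H) : J * J⁻¹ = 1 :=
  Matrix.mul_nonsing_inv _ (isUnit_iff_ne_zero.2 hJ.det_ne)

theorem inv_mul (hJ : IsAdaptedFrame J V H) : J⁻¹ * J = 1 :=
  Matrix.nonsing_inv_mul _ (isUnit_iff_ne_zero.2 hJ.det_ne)

end IsAdaptedFrame

/-! ### Two-forms -/

/-- The exterior product of two covectors. -/
def wedge (α β : Tensor1) : Tensor2 := fun a b => α a * β b - β a * α b

theorem wedge_eq_sub (α β : Tensor1) :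
    wedge α β = Matrix.vecMulVec α β - Matrix.vecMulVec β α := rfl

/-- The tensor product of two 2-forms, a double 2-form. -/
def formProd (σ τ : Tensor2) : Tensor4 := fun a b c d => σ a b * τ c d

/-- The metric pairing `½ σ_{kl} γ^{km} γ^{ln} τ_{mn}` of 2-forms. -/
def formInner (γ σ τ : Tensor2) : ℝ :=
  (1 / 2) * ∑ k, ∑ l, ∑ m, ∑ n, σ k l * γ⁻¹ k m * γ⁻¹ l n * τ m n

theorem comp_formProd (γ σ σ' τ τ' : Tensor2) :
    comp γ (formProd σ σ') (formProd τ τ') = formInner γ σ' τ • formProd σ τ' := by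
  funext a b c d
  simp only [comp, formProd, formInner, Pi.smul_apply, smul_eq_mul, Finset.mul_sum,
    Finset.sum_mul]
  iterate 4 refine Finset.sum_congr rfl fun _ _ => ?_
  ring

theorem formInner_wedge (γ : Tensor2) (α β μ ν : Tensor1) :
    formInner γ (wedge α β) (wedge μ ν) =
      (α ⬝ᵥ γ⁻¹.mulVec μ) * (β ⬝ᵥ γ⁻¹.mulVec ν) - (α ⬝ᵥ γ⁻¹.mulVec ν) * (β ⬝ᵥ γ⁻¹.mulVec μ) := by
  have contract : ∀ α β μ ν : Tensor1, ∑ k, ∑ l, ∑ m, ∑ n,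
      α k * β l * γ⁻¹ k m * γ⁻¹ l n * (μ m * ν n) =
        (α ⬝ᵥ γ⁻¹.mulVec μ) * (β ⬝ᵥ γ⁻¹.mulVec ν) := by
    intro α β μ ν
    have hsum : ∀ α μ : Tensor1, α ⬝ᵥ γ⁻¹.mulVec μ = ∑ k, ∑ m, α k * γ⁻¹ k m * μ m := by
      intro α μ
      simp only [dotProduct, Matrix.mulVec, Finset.mul_sum, mul_assoc]
    simp only [hsum, Finset.sum_mul_sum]
    iterate 4 refine Finset.sum_congr rfl fun _ _ => ?_
    ring
  have expand : ∀ k l m n, wedge α β k l * γ⁻¹ k m * γ⁻¹ l n * wedge μ ν m n =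
      α k * β l * γ⁻¹ k m * γ⁻¹ l n * (μ m * ν n)
        - α k * β l * γ⁻¹ k m * γ⁻¹ l n * (ν m * μ n)
        - β k * α l * γ⁻¹ k m * γ⁻¹ l n * (μ m * ν n)
        + β k * α l * γ⁻¹ k m * γ⁻¹ l n * (ν m * μ n) := by
    intros; simp only [wedge]; ring
  simp only [formInner, expand, Finset.sum_add_distrib, Finset.sum_sub_distrib, contract]
  ring

theorem pullMat_wedge (J : Tensor2) (α β : Tensor1) :
    pullMat J (wedge α β) = wedge (Matrix.vecMul α J) (Matrix.vecMul β J) := by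
  simp only [wedge_eq_sub, pullMat, mul_sub, sub_mul, Matrix.mul_vecMulVec, Matrix.vecMulVec_mul,
    Matrix.mulVec_transpose]

theorem extProd_pullMat_left {V : Matrix (Fin 2) (Fin 2) ℝ} (hV : V.IsSymm) (J : Tensor2) :
    extProd (pullMat J (blockDiag V 0)) (pullMat J (blockDiag V 0)) =
      (2 * V.det) • formProd (wedge (J 0) (J 1)) (wedge (J 0) (J 1)) := by
  funext a b c d
  simp [extProd, pullMat_apply, Fin.sum_univ_four, blockDiag_apply, wedge, formProd,
    Matrix.det_fin_two, hV.apply 0 1]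
  ring

theorem extProd_pullMat_right {H : Matrix (Fin 2) (Fin 2) ℝ} (hH : H.IsSymm) (J : Tensor2) :
    extProd (pullMat J (blockDiag 0 H)) (pullMat J (blockDiag 0 H)) =
      (2 * H.det) • formProd (wedge (J 2) (J 3)) (wedge (J 2) (J 3)) := by
  funext a b c d
  simp [extProd, pullMat_apply, Fin.sum_univ_four, blockDiag_apply, wedge, formProd,
    Matrix.det_fin_two, hH.apply 0 1]
  ring

/-! ### Curvature tensors without mixed components -/

/-- The components of the 4-tensor `P` after the linear change of coordinates `J`. -/
def pullTensor4 (J : Tensor2) (P : Tensor4) : Tensor4 := fun a b c d =>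
  pullMat J (.of fun k l => pullMat J (.of fun i j => P i j k l) a b) c d

theorem pullTensor4_apply (J : Tensor2) (P : Tensor4) (a b c d : Fin 4) :
    pullTensor4 J P a b c d =
      ∑ i, ∑ j, ∑ k, ∑ l, J i a * J j b * J k c * J l d * P i j k l := by
  have hswap : ∀ G : Fin 4 → Fin 4 → Fin 4 → Fin 4 → ℝ,
      ∑ k, ∑ l, ∑ i, ∑ j, G i j k l = ∑ i, ∑ j, ∑ k, ∑ l, G i j k l := by
    intro G
    simp only [← Fintype.sum_prod_type']
    exact Fintype.sum_equiv ⟨fun p => (p.2.2.1, p.2.2.2, p.1, p.2.1),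
      fun p => (p.2.2.1, p.2.2.2, p.1, p.2.1), fun _ => rfl, fun _ => rfl⟩ _ _ fun _ => rfl
  simp only [pullTensor4, pullMat_apply, Matrix.of_apply, Finset.mul_sum, Finset.sum_mul]
  rw [hswap]
  iterate 4 refine Finset.sum_congr rfl fun _ _ => ?_
  ring

theorem pullTensor4_add (J : Tensor2) (P Q : Tensor4) :
    pullTensor4 J (P + Q) = pullTensor4 J P + pullTensor4 J Q := by
  funext a b c d
  simp only [pullTensor4_apply, Pi.add_apply, mul_add, Finset.sum_add_distrib]

theorem pullTensor4_smul (J : Tensor2) (r : ℝ) (P : Tensor4) :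
    pullTensor4 J (r • P) = r • pullTensor4 J P := by
  funext a b c d
  simp only [pullTensor4_apply, Pi.smul_apply, smul_eq_mul, Finset.mul_sum]
  iterate 4 refine Finset.sum_congr rfl fun _ _ => ?_
  ring

theorem pullTensor4_injective {J K : Tensor2} (hJK : J * K = 1) :
    Function.Injective (pullTensor4 J) := by
  intro P Q hPQ
  have hinj := pullMat_injective hJK
  have hlast : ∀ a b, Matrix.of (fun k l => pullMat J (.of fun i j => P i j k l) a b) =
      Matrix.of fun k l => pullMat J (.of fun i j => Q i j k l) a b := fun a b =>
    hinj (congrFun (congrFun hPQ a) b)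
  funext i j k l
  have hfirst : Matrix.of (fun i j => P i j k l) = .of fun i j => Q i j k l :=
    hinj (Matrix.ext fun a b => congrFun (congrFun (hlast a b) k) l)
  exact congrFun (congrFun hfirst i) j

theorem pullTensor4_formProd (J σ τ : Tensor2) :
    pullTensor4 J (formProd σ τ) = formProd (pullMat J σ) (pullMat J τ) := by
  funext a b c d
  have hfirst : Matrix.of (fun k l => pullMat J (.of fun i j => formProd σ τ i j k l) a b) =
      pullMat J σ a b • τ := by
    funext k l
    simp only [Matrix.of_apply, pullMat_apply, formProd, Matrix.smul_apply, smul_eq_mul,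
      Finset.sum_mul]
    iterate 2 refine Finset.sum_congr rfl fun _ _ => ?_
    ring
  rw [pullTensor4, hfirst, pullMat_smul]
  rfl

theorem eq_wedge_of_mixed_eq_zero {X : Tensor2} (hX : ∀ a b, X b a = -X a b)
    (hmix : ∀ a b, a < 2 → 2 ≤ b → X a b = 0) :
    X = X 0 1 • wedge (Pi.single 0 1) (Pi.single 1 1)
      + X 2 3 • wedge (Pi.single 2 1) (Pi.single 3 1) := by
  have hdiag : ∀ a, X a a = 0 := fun a => by linarith [hX a a]
  have hlow : ∀ a b, 2 ≤ a → b < 2 → X a b = 0 := fun a b ha hb => by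
    rw [hX, hmix b a hb ha, neg_zero]
  ext a b
  fin_cases a <;> fin_cases b <;> simp [wedge, hdiag, hlow, hmix, hX 0 1, hX 2 3]

namespace IsCurvatureTensor

variable {R : Tensor4}

theorem pullTensor4 (hR : IsCurvatureTensor R) (J : Tensor2) :
    IsCurvatureTensor (pullTensor4 J R) where
  antisymm_left a b c d := by
    simp only [pullTensor4_apply, ← Finset.sum_neg_distrib]
    rw [Finset.sum_comm]
    iterate 4 refine Finset.sum_congr rfl fun (_ : Fin 4) _ => ?_
    rw [hR.antisymm_left]
    ring
  antisymm_right a b c d := by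
    simp only [pullTensor4_apply, ← Finset.sum_neg_distrib]
    iterate 2 refine Finset.sum_congr rfl fun _ _ => ?_
    rw [Finset.sum_comm]
    iterate 2 refine Finset.sum_congr rfl fun _ _ => ?_
    rw [hR.antisymm_right]
    ring
  bianchi a b c d := by
    have cycle : ∀ G : Fin 4 → Fin 4 → Fin 4 → ℝ,
        ∑ j, ∑ k, ∑ l, G j k l = ∑ j, ∑ k, ∑ l, G k l j := by
      intro G
      refine (Finset.sum_congr rfl fun _ _ => Finset.sum_comm).trans ?_
      exact Finset.sum_comm
    simp only [pullTensor4_apply, ← Finset.sum_add_distrib]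
    refine Finset.sum_eq_zero fun i _ => ?_
    simp only [Finset.sum_add_distrib]
    rw [cycle fun j k l => J i a * J j c * J k d * J l b * R i j k l,
      cycle fun j k l => J i a * J j d * J k b * J l c * R i j k l,
      cycle fun j k l => J i a * J k d * J l b * J j c * R i k l j]
    simp only [← Finset.sum_add_distrib]
    refine Finset.sum_eq_zero fun j _ => Finset.sum_eq_zero fun k _ =>
      Finset.sum_eq_zero fun l _ => ?_
    linear_combination J i a * J j b * J k c * J l d * hR.bianchi i j k l

/-- By the Bianchi identity, `R_{0123}` is a sum of mixed components. -/
theorem eq_of_mixed_eq_zero (hR : IsCurvatureTensor R)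
    (hmix : ∀ a b, a < 2 → 2 ≤ b → ∀ c d, R a b c d = 0) :
    R = R 0 1 0 1 • formProd (wedge (Pi.single 0 1) (Pi.single 1 1))
        (wedge (Pi.single 0 1) (Pi.single 1 1))
      + R 2 3 2 3 • formProd (wedge (Pi.single 2 1) (Pi.single 3 1))
        (wedge (Pi.single 2 1) (Pi.single 3 1)) := by
  have hcross : R 0 1 2 3 = 0 := by
    have h := hR.bianchi 0 1 2 3
    rw [hmix 0 2 (by decide) (by decide), hmix 0 3 (by decide) (by decide)] at h
    linarith
  have hforms : ∀ a b, R a b = R a b 0 1 • wedge (Pi.single 0 1) (Pi.single 1 1)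
      + R a b 2 3 • wedge (Pi.single 2 1) (Pi.single 3 1) := fun a b =>
    eq_wedge_of_mixed_eq_zero (hR.antisymm_right a b) fun c d hc hd => by
      rw [hR.pair_symm, hmix c d hc hd]
  have hcross' : R 2 3 0 1 = 0 := by rw [hR.pair_symm, hcross]
  funext a b c d
  have hab := congrFun (congrFun (hforms a b) c) d
  have hcd := congrFun (congrFun (hforms 0 1) a) b
  have hcd' := congrFun (congrFun (hforms 2 3) a) b
  simp only [hcross, hcross', zero_mul, add_zero, zero_add, Matrix.smul_apply, Matrix.add_apply,
    smul_eq_mul] at hab hcd hcd'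
  rw [hab, hR.pair_symm a b 0 1, hR.pair_symm a b 2 3, hcd, hcd']
  simp only [Pi.add_apply, Pi.smul_apply, smul_eq_mul, formProd]
  ring

end IsCurvatureTensor

namespace IsAdaptedFrame

variable {J : Tensor2} {V H : Matrix (Fin 2) (Fin 2) ℝ}

theorem eq_of_mixed_eq_zero (hJ : IsAdaptedFrame J V H) {R : Tensor4}
    (hR : IsCurvatureTensor R)
    (hmix : ∀ a b, a < 2 → 2 ≤ b → ∀ c d, pullMat J⁻¹ (.of fun i j => R i j c d) a b = 0) :
    ∃ k l : ℝ, R =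
      k • extProd (pullMat J (blockDiag V 0)) (pullMat J (blockDiag V 0))
        + l • extProd (pullMat J (blockDiag 0 H)) (pullMat J (blockDiag 0 H)) := by
  set R' := pullTensor4 J⁻¹ R
  have hR'eq := (hR.pullTensor4 J⁻¹).eq_of_mixed_eq_zero fun a b ha hb c d => by
    have hzero : Matrix.of (fun k l => pullMat J⁻¹ (.of fun i j => R i j k l) a b) = 0 :=
      Matrix.ext fun k l => hmix a b ha hb k l
    rw [pullTensor4, hzero, pullMat, mul_zero, zero_mul, Matrix.zero_apply]
  have hrow : ∀ A, Matrix.vecMul (J A) J⁻¹ = Pi.single A 1 := fun A => by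
    funext b
    change (J * J⁻¹) A b = _
    rw [hJ.mul_inv, Matrix.one_apply, Pi.single_apply]
    exact if_congr eq_comm rfl rfl
  have hwedge : ∀ A B, pullMat J⁻¹ (wedge (J A) (J B)) = wedge (Pi.single A 1) (Pi.single B 1) :=
    fun A B => by rw [pullMat_wedge, hrow, hrow]
  have hV := hJ.det_left
  have hH := hJ.det_right
  refine ⟨R' 0 1 0 1 / (2 * V.det), R' 2 3 2 3 / (2 * H.det),
    pullTensor4_injective hJ.inv_mul ?_⟩
  rw [extProd_pullMat_left hJ.symm_left, extProd_pullMat_right hJ.symm_right, smul_smul,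
    smul_smul, div_mul_cancel₀ _ (by positivity), div_mul_cancel₀ _ (by positivity),
    pullTensor4_add, pullTensor4_smul, pullTensor4_smul, pullTensor4_formProd,
    pullTensor4_formProd, hwedge, hwedge]
  exact hR'eq

/-- In the frame `X` becomes a matrix that is skew for the form `blockDiag V 0`, whose last two
columns therefore vanish. -/
theorem pullMat_inv_mul_eq_zero (hJ : IsAdaptedFrame J V H) {X : Tensor2}
    (hX : X.transpose * pullMat J (blockDiag V 0) + pullMat J (blockDiag V 0) * X = 0)
    {a b : Fin 4} (ha : a < 2) (hb : 2 ≤ b) :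
    pullMat J⁻¹ (pullMat J (blockDiag V H) * X) a b = 0 := by
  set M := J * X * J⁻¹ with hM
  have hframe : ∀ Z, pullMat J⁻¹ (pullMat J Z * X) = Z * M := fun Z => by
    simp only [hM, pullMat, mul_assoc]
    rw [← mul_assoc J⁻¹.transpose, ← Matrix.transpose_mul, hJ.mul_inv, Matrix.transpose_one,
      one_mul]
  have hframe' : ∀ Z, pullMat J⁻¹ (X.transpose * pullMat J Z) = M.transpose * Z := fun Z => by
    simp only [hM, pullMat, Matrix.transpose_mul, mul_assoc, hJ.mul_inv, mul_one]
  have hskew : M.transpose * blockDiag V 0 + blockDiag V 0 * M = 0 := by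
    rw [← hframe, ← hframe', ← pullMat_add, hX, pullMat, mul_zero, zero_mul]
  have hcol : (M.transpose * blockDiag V 0) a b = 0 := by
    rw [Matrix.mul_apply]
    refine Finset.sum_eq_zero fun k _ => ?_
    have hkb : blockDiag V 0 k b = 0 := by
      fin_cases b <;> fin_cases k <;> simp_all [blockDiag_apply]
    exact mul_eq_zero_of_right _ hkb
  have hrow : (blockDiag V H * M) a b = (blockDiag V 0 * M) a b := by
    simp only [Matrix.mul_apply]
    refine Finset.sum_congr rfl fun k _ => ?_
    have hak : blockDiag V H a k = blockDiag V 0 a k := by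
      fin_cases a <;> fin_cases k <;> simp_all [blockDiag_apply]
    exact congrArg (· * M k b) hak
  rw [hframe, hrow]
  simpa [hcol] using congrFun (congrFun hskew a) b

end IsAdaptedFrame

/-! ### The Hodge dual of the pure part -/

section Hodge

variable {γ J : Tensor2} {V H : Matrix (Fin 2) (Fin 2) ℝ}

/-- Laplace expansion, in complementary pairs of rows, of the determinant of four rows of `J`. -/
theorem volElt_eq (γ : Tensor2) (hJ : J.det ≠ 0) : volElt γ = (Real.sqrt |γ.det| / J.det) •
    (formProd (wedge (J 0) (J 1)) (wedge (J 2) (J 3))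
      - formProd (wedge (J 0) (J 2)) (wedge (J 1) (J 3))
      + formProd (wedge (J 0) (J 3)) (wedge (J 1) (J 2))
      + formProd (wedge (J 1) (J 2)) (wedge (J 0) (J 3))
      - formProd (wedge (J 1) (J 3)) (wedge (J 0) (J 2))
      + formProd (wedge (J 2) (J 3)) (wedge (J 0) (J 1))) := by
  funext a b c d
  have hdet : Matrix.det (fun i j : Fin 4 => if ![a, b, c, d] i = j then (1 : ℝ) else 0) * J.det =
      Matrix.det (Matrix.of fun i j : Fin 4 => J j (![a, b, c, d] i)) := by
    change Matrix.det (Matrix.of fun i j : Fin 4 => if ![a, b, c, d] i = j then (1 : ℝ) else 0)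
      * J.det = _
    rw [← Matrix.det_transpose J, ← Matrix.det_mul]
    congr 1
    ext i j
    simp [Matrix.mul_apply]
  rw [volElt, eq_div_of_mul_eq hJ hdet, ← mul_div_assoc, mul_div_right_comm]
  simp only [Pi.smul_apply, smul_eq_mul]
  congr 1
  simp only [Matrix.det_succ_row_zero, Fin.sum_univ_four, Fin.sum_univ_three,
    Matrix.submatrix_apply]
  simp [Fin.succAbove, Fin.sum_univ_succ, formProd, wedge]
  ring

theorem volElt_swap_mid (γ : Tensor2) (a b c d : Fin 4) :
    volElt γ a d c b = -volElt γ a b c d := by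
  simp only [volElt_eq γ (J := 1) (by simp), Pi.add_apply, Pi.sub_apply, Pi.smul_apply,
    smul_eq_mul, formProd, wedge]
  ring

theorem volElt_swap_right (γ : Tensor2) (a b c d : Fin 4) :
    volElt γ a b d c = -volElt γ a b c d := by
  simp only [volElt_eq γ (J := 1) (by simp), Pi.add_apply, Pi.sub_apply, Pi.smul_apply,
    smul_eq_mul, formProd, wedge]
  ring

theorem act22_add (P Q : Tensor4) (x y : Fin 4 → ℝ) :
    act22 (P + Q) x y = act22 P x y + act22 Q x y := by
  funext a b
  simp only [act22, Pi.add_apply, add_mul, Finset.sum_add_distrib, Matrix.add_apply]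

theorem act22_smul (r : ℝ) (P : Tensor4) (x y : Fin 4 → ℝ) :
    act22 (r • P) x y = r • act22 P x y := by
  funext a b
  simp only [act22, Pi.smul_apply, smul_eq_mul, Matrix.smul_apply, Finset.mul_sum]
  iterate 2 refine Finset.sum_congr rfl fun _ _ => ?_
  ring

theorem act22_formProd (σ τ : Tensor2) (x y : Fin 4 → ℝ) :
    act22 (formProd σ τ) x y = Matrix.vecMulVec (σ.mulVec x) (τ.mulVec y) := by
  funext a b
  simp only [act22, formProd, Matrix.vecMulVec_apply, Matrix.mulVec, dotProduct,
    Finset.sum_mul_sum]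
  iterate 2 refine Finset.sum_congr rfl fun _ _ => ?_
  ring

theorem act22_volElt_self (γ : Tensor2) (x : Fin 4 → ℝ) : act22 (volElt γ) x x = 0 := by
  ext a b
  refine self_eq_neg.1 ?_
  conv_lhs => rw [act22, Finset.sum_comm]
  simp only [act22, ← Finset.sum_neg_distrib]
  iterate 2 refine Finset.sum_congr rfl fun _ _ => ?_
  rw [volElt_swap_mid]
  ring

theorem comp_tensorProd_self (hγ : γ⁻¹ * γ = 1) (P : Tensor4) :
    comp γ P (tensorProd γ γ) = (1 / 2 : ℝ) • P := by
  funext a b c d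
  have hcontract : ∀ k l, ∑ m, ∑ n, P a b k l * γ⁻¹ k m * γ⁻¹ l n * (γ m c * γ n d) =
      P a b k l * ((γ⁻¹ * γ) k c * (γ⁻¹ * γ) l d) := by
    intro k l
    rw [Matrix.mul_apply, Matrix.mul_apply, Finset.sum_mul_sum, Finset.mul_sum]
    simp only [Finset.mul_sum]
    iterate 2 refine Finset.sum_congr rfl fun _ _ => ?_
    ring
  simp only [comp, tensorProd, hcontract, hγ]
  simp [Matrix.one_apply]

theorem comp_idForm_right (hγ : γ⁻¹ * γ = 1) {P : Tensor4}
    (hP : ∀ a b c d, P a b d c = -P a b c d) : comp γ P (idForm γ) = P := by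
  have hswap : swapLast P = -P := by funext a b c d; exact hP a b c d
  have hswap_smul : ∀ r : ℝ, swapLast (r • P) = r • swapLast P := fun _ => rfl
  simp only [idForm, extProd_eq_tensorProd, comp_smul_right, comp_add_right, comp_swapLast_right,
    comp_tensorProd_self hγ, hswap_smul, hswap]
  module

theorem act22_hodge_add_smul (hγ : γ⁻¹ * γ = 1) (r s : ℝ) (P : Tensor4) (x : Fin 4 → ℝ) :
    act22 (hodge γ (r • (idForm γ + s • P))) x x = (r * s) • act22 (hodge γ P) x x := by
  rw [hodge, comp_smul_right, comp_add_right, comp_smul_right,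
    comp_idForm_right hγ (volElt_swap_right γ), act22_smul, act22_add, act22_smul,
    act22_volElt_self, zero_add, smul_smul, hodge]

theorem wedge_mulVec (α β : Tensor1) (x : Fin 4 → ℝ) :
    (wedge α β).mulVec x = (β ⬝ᵥ x) • α - (α ⬝ᵥ x) • β := by
  simp [wedge_eq_sub, Matrix.sub_mulVec, Matrix.vecMulVec_mulVec]

theorem wedge_mulVec_eq_zero_iff {α β : Tensor1} (hαβ : LinearIndependent ℝ ![α, β])
    (x : Fin 4 → ℝ) : (wedge α β).mulVec x = 0 ↔ α ⬝ᵥ x = 0 ∧ β ⬝ᵥ x = 0 := by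
  rw [wedge_mulVec]
  constructor
  · intro h
    rw [LinearIndependent.pair_iff] at hαβ
    obtain ⟨hβ, hα⟩ := hαβ (β ⬝ᵥ x) (-(α ⬝ᵥ x)) (by rw [neg_smul, ← sub_eq_add_neg, h])
    exact ⟨neg_eq_zero.1 hα, hβ⟩
  · rintro ⟨hα, hβ⟩
    rw [hα, hβ, zero_smul, zero_smul, sub_zero]

theorem vecMulVec_add_vecMulVec_eq_zero_iff {ι : Type*} (α β : ι → ℝ) :
    Matrix.vecMulVec β α + Matrix.vecMulVec α β = 0 ↔ α = 0 ∨ β = 0 := by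
  constructor
  · intro h
    have hab : ∀ a b, β a * α b + α a * β b = 0 := fun a b => congrFun (congrFun h a) b
    by_contra! hne
    obtain ⟨⟨a, ha⟩, ⟨b, hb⟩⟩ := hne.imp Function.ne_iff.1 Function.ne_iff.1
    have hβa : β a = 0 := by
      have := hab a a
      exact (mul_eq_zero.1 (by linarith : α a * β a = 0)).resolve_left ha
    have := hab a b
    rw [hβa, zero_mul, zero_add] at this
    exact mul_ne_zero ha hb this
  · rintro (rfl | rfl) <;> ext <;> simp

end Hodge

namespace IsAdaptedFrame

variable {J : Tensor2} {V H : Matrix (Fin 2) (Fin 2) ℝ}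

theorem mul_inv_mul_transpose (hJ : IsAdaptedFrame J V H) :
    J * (pullMat J (blockDiag V H))⁻¹ * J.transpose = blockDiag V⁻¹ H⁻¹ := by
  rw [mul_inv_pullMat_mul_transpose hJ.det_ne, blockDiag_inv hJ.det_left hJ.det_right]

theorem linearIndependent_pair (hJ : IsAdaptedFrame J V H) {A B : Fin 4} (hAB : A ≠ B) :
    LinearIndependent ℝ ![J A, J B] := by
  have hrows : LinearIndependent ℝ J.row :=
    Matrix.linearIndependent_rows_iff_isUnit.2
      ((Matrix.isUnit_iff_isUnit_det J).2 (isUnit_iff_ne_zero.2 hJ.det_ne))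
  have hinj : Function.Injective ![A, B] := by
    intro i j
    fin_cases i <;> fin_cases j <;> simp [hAB, hAB.symm]
  convert hrows.comp _ hinj using 1
  funext i
  fin_cases i <;> rfl

theorem pureForm_eq (hJ : IsAdaptedFrame J V H) :
    pureForm (pullMat J (blockDiag V 0)) (pullMat J (blockDiag 0 H)) =
      V.det • formProd (wedge (J 0) (J 1)) (wedge (J 0) (J 1))
        + H.det • formProd (wedge (J 2) (J 3)) (wedge (J 2) (J 3)) := by
  rw [pureForm, extProd_pullMat_left hJ.symm_left, extProd_pullMat_right hJ.symm_right]
  module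

theorem hodge_pureForm (hJ : IsAdaptedFrame J V H) :
    hodge (pullMat J (blockDiag V H))
        (pureForm (pullMat J (blockDiag V 0)) (pullMat J (blockDiag 0 H))) =
      (Real.sqrt |(pullMat J (blockDiag V H)).det| / J.det) •
        (formProd (wedge (J 2) (J 3)) (wedge (J 0) (J 1))
          + formProd (wedge (J 0) (J 1)) (wedge (J 2) (J 3))) := by
  have hdetV : V.det * (V⁻¹ 0 0 * V⁻¹ 1 1 - V⁻¹ 0 1 * V⁻¹ 1 0) = 1 := by
    rw [← Matrix.det_fin_two, ← Matrix.det_mul,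
      Matrix.mul_nonsing_inv _ (isUnit_iff_ne_zero.2 hJ.det_left), Matrix.det_one]
  have hdetH : H.det * (H⁻¹ 0 0 * H⁻¹ 1 1 - H⁻¹ 0 1 * H⁻¹ 1 0) = 1 := by
    rw [← Matrix.det_fin_two, ← Matrix.det_mul,
      Matrix.mul_nonsing_inv _ (isUnit_iff_ne_zero.2 hJ.det_right), Matrix.det_one]
  have hinner : ∀ A B C D, formInner (pullMat J (blockDiag V H)) (wedge (J A) (J B))
      (wedge (J C) (J D)) = blockDiag V⁻¹ H⁻¹ A C * blockDiag V⁻¹ H⁻¹ B D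
        - blockDiag V⁻¹ H⁻¹ A D * blockDiag V⁻¹ H⁻¹ B C := fun A B C D => by
    have hrows : ∀ A C, J A ⬝ᵥ (pullMat J (blockDiag V H))⁻¹.mulVec (J C) =
        blockDiag V⁻¹ H⁻¹ A C := fun A C => by
      rw [← hJ.mul_inv_mul_transpose, mul_assoc]; rfl
    rw [formInner_wedge, hrows, hrows, hrows, hrows]
  rw [hodge, volElt_eq _ hJ.det_ne, hJ.pureForm_eq]
  simp only [sub_eq_add_neg, ← neg_one_smul ℝ (formProd _ _), comp_add_left, comp_add_right,
    comp_smul_left, comp_smul_right, comp_formProd, hinner, blockDiag_apply V⁻¹ H⁻¹]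
  simp only [Matrix.of_apply, Matrix.cons_val', Matrix.cons_val_zero, Matrix.cons_val_fin_one,
      Matrix.cons_val, Matrix.cons_val_one, mul_zero, neg_zero, add_zero, zero_smul, smul_zero,
      zero_add, zero_mul, smul_add]
  linear_combination (norm := module)
    ((Real.sqrt |(pullMat J (blockDiag V H)).det| / J.det) * hdetV) •
        formProd (wedge (J 2) (J 3)) (wedge (J 0) (J 1))
      + ((Real.sqrt |(pullMat J (blockDiag V H)).det| / J.det) * hdetH) •
        formProd (wedge (J 0) (J 1)) (wedge (J 2) (J 3))

theorem act22_hodge_pureForm_eq_zero_iff (hJ : IsAdaptedFrame J V H) (x : Fin 4 → ℝ) :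
    act22 (hodge (pullMat J (blockDiag V H))
        (pureForm (pullMat J (blockDiag V 0)) (pullMat J (blockDiag 0 H)))) x x = 0 ↔
      (J.mulVec x 0 = 0 ∧ J.mulVec x 1 = 0) ∨ (J.mulVec x 2 = 0 ∧ J.mulVec x 3 = 0) := by
  have hscale : Real.sqrt |(pullMat J (blockDiag V H)).det| / J.det ≠ 0 :=
    div_ne_zero (Real.sqrt_ne_zero'.2 (abs_pos.2 hJ.isSplit.det_ne)) hJ.det_ne
  rw [hJ.hodge_pureForm, act22_smul, smul_eq_zero_iff_right hscale, act22_add, act22_formProd,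
    act22_formProd, vecMulVec_add_vecMulVec_eq_zero_iff,
    wedge_mulVec_eq_zero_iff (hJ.linearIndependent_pair (by decide)),
    wedge_mulVec_eq_zero_iff (hJ.linearIndependent_pair (by decide))]
  rfl

theorem mulVec_raise (hJ : IsAdaptedFrame J V H) (l : Fin 4 → ℝ) :
    J.mulVec (raise (pullMat J (blockDiag V H)) (J.transpose.mulVec l)) =
      (blockDiag V⁻¹ H⁻¹).mulVec l := by
  have hraise : ∀ γ α, raise γ α = Matrix.mulVec γ⁻¹ α := fun _ _ => rfl
  rw [hraise, Matrix.mulVec_mulVec, Matrix.mulVec_mulVec, hJ.mul_inv_mul_transpose]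

theorem act22_hodge_raise_eq_zero_iff (hJ : IsAdaptedFrame J V H) (l : Fin 4 → ℝ) :
    act22 (hodge (pullMat J (blockDiag V H))
        (pureForm (pullMat J (blockDiag V 0)) (pullMat J (blockDiag 0 H))))
        (raise (pullMat J (blockDiag V H)) (J.transpose.mulVec l))
        (raise (pullMat J (blockDiag V H)) (J.transpose.mulVec l)) = 0 ↔
      (l 0 = 0 ∧ l 1 = 0) ∨ (l 2 = 0 ∧ l 3 = 0) := by
  have hpair : ∀ (A : Matrix (Fin 2) (Fin 2) ℝ), A.det ≠ 0 → ∀ p q,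
      (A⁻¹ 0 0 * p + A⁻¹ 0 1 * q = 0 ∧ A⁻¹ 1 0 * p + A⁻¹ 1 1 * q = 0) ↔ p = 0 ∧ q = 0 := by
    intro A hA p q
    have hinv : A⁻¹.det ≠ 0 := (A.isUnit_nonsing_inv_det (isUnit_iff_ne_zero.2 hA)).ne_zero
    constructor
    · rintro ⟨h0, h1⟩
      have hpq : ![p, q] = 0 := Matrix.eq_zero_of_mulVec_eq_zero hinv <| by
        ext i
        fin_cases i <;> simp [Matrix.mulVec, dotProduct, h0, h1]
      exact ⟨congrFun hpq 0, congrFun hpq 1⟩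
    · rintro ⟨rfl, rfl⟩
      simp
  rw [hJ.act22_hodge_pureForm_eq_zero_iff, hJ.mulVec_raise, ← hpair V hJ.det_left (l 0) (l 1),
    ← hpair H hJ.det_right (l 2) (l 3)]
  simp [blockDiag_apply, Matrix.mulVec, dotProduct, Fin.sum_univ_four]

end IsAdaptedFrame

theorem row_dotProduct_mulVec (A B : Tensor2) (p : Tensor1) (b : Fin 4) :
    A b ⬝ᵥ B.mulVec p = (A * B).mulVec p b := by
  rw [← Matrix.mulVec_mulVec]; rfl

/-! ### Conformal changes of metric -/

/-- The covariant derivative `∇_c α` of the 1-form `α` for the Levi-Civita connection of `g`. -/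
def covVec (g : R4 → Tensor2) (α : R4 → Tensor1) (c : Fin 4) (x : R4) : Tensor1 :=
  pdVec c α x - (connMat g c x).transpose.mulVec (α x)

theorem covDeriv_wedge (g : R4 → Tensor2) {α β : R4 → Tensor1} {x : R4}
    (hα : ∀ a, DifferentiableAt ℝ (fun y => α y a) x)
    (hβ : ∀ a, DifferentiableAt ℝ (fun y => β y a) x) (c : Fin 4) :
    covDeriv g (fun y => wedge (α y) (β y)) c x =
      wedge (covVec g α c x) (β x) + wedge (α x) (covVec g β c x) := by
  have hpd : pdMat c (fun y => wedge (α y) (β y)) x =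
      wedge (pdVec c α x) (β x) + wedge (α x) (pdVec c β x) := by
    ext a b
    simp only [pdMat, wedge, pdVec, Matrix.add_apply]
    rw [pd_sub ((hα a).fun_mul (hβ b)) ((hβ a).fun_mul (hα b)), pd_mul (hα a) (hβ b),
      pd_mul (hβ a) (hα b)]
    ring
  rw [covDeriv, hpd]
  simp only [covVec, wedge_eq_sub, mul_sub, sub_mul, Matrix.mul_vecMulVec, Matrix.vecMulVec_mul,
    ← Matrix.mulVec_transpose, Matrix.sub_vecMulVec, Matrix.vecMulVec_sub]
  abel

/-- The components `∂ᵢλ` of the differential `dλ`. -/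
def dLam (lam : R4 → ℝ) (x : R4) : Tensor1 := fun i => pd i lam x

/-- The squared norm of `dλ` in the metric `g`. -/
def normSq (g : R4 → Tensor2) (lam : R4 → ℝ) (x : R4) : ℝ :=
  dLam lam x ⬝ᵥ (g x)⁻¹.mulVec (dLam lam x)

/-- The covariant Hessian `∇dλ` for the metric `g`. -/
def hess (g : R4 → Tensor2) (lam : R4 → ℝ) (x : R4) : Tensor2 :=
  fun c => covVec g (dLam lam) c x

/-- `γ = e^{2λ} g` on `U`. -/
structure IsConformalOn (g γ : R4 → Tensor2) (lam : R4 → ℝ) (U : Set R4) : Prop where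
  metric : IsMetricOn g U
  smooth : ContDiffOn ℝ ∞ lam U
  eq : ∀ y ∈ U, γ y = Real.exp (2 * lam y) • g y

/-- `e_c ⊗ dλ - grad λ ⊗ g_c`, the trace-free part of the difference of the connection matrices
of `e^{2λ} g` and of `g`. -/
def confMat (g : R4 → Tensor2) (lam : R4 → ℝ) (c : Fin 4) (x : R4) : Tensor2 :=
  (g x)⁻¹ * wedge (g x c) (dLam lam x)

namespace IsMetricOn

variable {g : R4 → Tensor2} {U : Set R4} {x : R4}

theorem covVec_row (hg : IsMetricOn g U) (hx : x ∈ U) (c d : Fin 4) :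
    covVec g (fun y => g y d) c x = ((connMat g c x).transpose * g x) d := by
  have hrow : (connMat g c x).transpose.mulVec (g x d) = (g x * connMat g c x) d := by
    rw [Matrix.mulVec_transpose]; rfl
  have hpd : pdVec c (fun y => g y d) x = pdMat c g x d := rfl
  rw [covVec, hrow, hpd, hg.pdMat_self hx]
  exact add_sub_cancel_right _ _

theorem covVec_row_comm (hg : IsMetricOn g U) (hx : x ∈ U) (c d : Fin 4) :
    covVec g (fun y => g y d) c x = covVec g (fun y => g y c) d x := by
  rw [hg.covVec_row hx, hg.covVec_row hx]
  funext a
  simp only [Matrix.mul_apply, Matrix.transpose_apply, connMat, hg.christoffel_symm hx _ c d]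

theorem inv_mulVec_row (hg : IsMetricOn g U) (hx : x ∈ U) (c : Fin 4) :
    (g x)⁻¹.mulVec (g x c) = Pi.single c 1 := by
  have hcol : g x c = (g x).mulVec (Pi.single c 1) := by
    funext a
    simp [(hg.symm x hx).apply]
  rw [hcol, Matrix.mulVec_mulVec, Matrix.nonsing_inv_mul _ (hg.isUnit_det hx), Matrix.one_mulVec]

theorem dotProduct_inv_mulVec_row (hg : IsMetricOn g U) (hx : x ∈ U) (c : Fin 4) (l : Tensor1) :
    l ⬝ᵥ (g x)⁻¹.mulVec (g x c) = l c := by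
  rw [hg.inv_mulVec_row hx, dotProduct_single, mul_one]

theorem row_dotProduct_inv_mulVec (hg : IsMetricOn g U) (hx : x ∈ U) (c : Fin 4) (l : Tensor1) :
    g x c ⬝ᵥ (g x)⁻¹.mulVec l = l c := by
  rw [row_dotProduct_mulVec, Matrix.mul_nonsing_inv _ (hg.isUnit_det hx), Matrix.one_mulVec]

theorem wedge_mul_inv_mul_wedge (hg : IsMetricOn g U) (hx : x ∈ U) (c d : Fin 4) (l : Tensor1) :
    wedge (g x c) l * (g x)⁻¹ * wedge (g x d) l - wedge (g x d) l * (g x)⁻¹ * wedge (g x c) l =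
      l d • wedge (g x c) l - l c • wedge (g x d) l
        - (l ⬝ᵥ (g x)⁻¹.mulVec l) • wedge (g x c) (g x d) := by
  have hcontr : ∀ α β μ ν : Tensor1, Matrix.vecMulVec α β * (g x)⁻¹ * Matrix.vecMulVec μ ν =
      (β ⬝ᵥ (g x)⁻¹.mulVec μ) • Matrix.vecMulVec α ν := by
    intro α β μ ν
    rw [mul_assoc, Matrix.mul_vecMulVec, Matrix.vecMulVec_mul_vecMulVec, Matrix.vecMulVec_smul]
  simp only [wedge_eq_sub, sub_mul, mul_sub, hcontr, hg.dotProduct_inv_mulVec_row hx,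
    hg.row_dotProduct_inv_mulVec hx, (hg.symm x hx).apply c d]
  module

end IsMetricOn

namespace IsConformalOn

variable {g γ : R4 → Tensor2} {lam : R4 → ℝ} {U : Set R4} {x : R4}

theorem differentiableAt_lam (h : IsConformalOn g γ lam U) (hx : x ∈ U) :
    DifferentiableAt ℝ lam x :=
  differentiableAt_of_contDiffOn h.metric.isOpen h.smooth hx

theorem apply_eq (h : IsConformalOn g γ lam U) (hx : x ∈ U) (i j : Fin 4) :
    γ x i j = Real.exp (2 * lam x) * g x i j := by
  rw [h.eq x hx]; rfl

theorem isMetricOn (h : IsConformalOn g γ lam U) : IsMetricOn γ U where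
  isOpen := h.metric.isOpen
  smooth i j := ContDiffOn.congr ((contDiffOn_const.mul h.smooth).exp.mul (h.metric.smooth i j))
    fun y hy => h.apply_eq hy i j
  symm y hy := by rw [h.eq y hy]; exact (h.metric.symm y hy).smul _
  det_ne y hy := by
    rw [h.eq y hy, Matrix.det_smul]
    exact mul_ne_zero (pow_ne_zero _ (Real.exp_ne_zero _)) (h.metric.det_ne y hy)

theorem pd_apply (h : IsConformalOn g γ lam U) (hx : x ∈ U) (i j k : Fin 4) :
    pd i (fun y => γ y j k) x =
      Real.exp (2 * lam x) * (2 * pd i lam x * g x j k + pd i (fun y => g y j k) x) := by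
  have hd := h.differentiableAt_lam hx
  rw [pd_congr h.metric.isOpen (fun y hy => h.apply_eq hy j k) i hx,
    pd_mul (hd.const_mul 2).exp (h.metric.differentiableAt j k hx), pd_exp_two_mul hd]
  ring

theorem self_mul_confMat (h : IsConformalOn g γ lam U) (hx : x ∈ U) (c : Fin 4) :
    g x * confMat g lam c x = wedge (g x c) (dLam lam x) :=
  Matrix.mul_nonsing_inv_cancel_left _ _ (h.metric.isUnit_det hx)

theorem connMat_eq (h : IsConformalOn g γ lam U) (hx : x ∈ U) (c : Fin 4) :
    connMat γ c x = connMat g c x + pd c lam x • 1 + confMat g lam c x := by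
  have hlower :
      γ x * connMat γ c x = γ x * (connMat g c x + pd c lam x • 1 + confMat g lam c x) := by
    conv_rhs => rw [h.eq x hx, Matrix.smul_mul, mul_add, mul_add, h.self_mul_confMat hx]
    ext m j
    simp only [Matrix.smul_apply, Matrix.add_apply, mul_smul_comm, mul_one, smul_eq_mul,
      h.isMetricOn.mul_connMat_apply hx, h.metric.mul_connMat_apply hx, h.pd_apply hx, wedge, dLam,
      (h.metric.symm x hx).apply c m]
    ring
  simpa only [Matrix.nonsing_inv_mul_cancel_left _ _ (h.isMetricOn.isUnit_det hx)] using
    congrArg ((γ x)⁻¹ * ·) hlower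

theorem differentiableAt_pd_lam (h : IsConformalOn g γ lam U) (hx : x ∈ U) (i : Fin 4) :
    DifferentiableAt ℝ (fun y => pd i lam y) x :=
  differentiableAt_of_contDiffOn h.metric.isOpen (contDiffOn_pd h.metric.isOpen h.smooth i) hx

theorem differentiableAt_wedge (h : IsConformalOn g γ lam U) (hx : x ∈ U) (c a b : Fin 4) :
    DifferentiableAt ℝ (fun y => wedge (g y c) (dLam lam y) a b) x :=
  ((h.metric.differentiableAt c a hx).fun_mul (h.differentiableAt_pd_lam hx b)).fun_sub
    ((h.differentiableAt_pd_lam hx a).fun_mul (h.metric.differentiableAt c b hx))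

theorem differentiableAt_confMat (h : IsConformalOn g γ lam U) (hx : x ∈ U) (c a b : Fin 4) :
    DifferentiableAt ℝ (fun y => confMat g lam c y a b) x :=
  differentiableAt_matrix_mul
    (fun i j => differentiableAt_of_contDiffOn h.metric.isOpen (h.metric.contDiffOn_inv i j) hx)
    (h.differentiableAt_wedge hx c) a b

theorem hess_symm (h : IsConformalOn g γ lam U) (hx : x ∈ U) : (hess g lam x).IsSymm := by
  refine Matrix.IsSymm.ext fun c b => ?_
  simp only [hess, covVec, pdVec, dLam, Pi.sub_apply, Matrix.mulVec, dotProduct,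
    Matrix.transpose_apply, connMat, h.metric.christoffel_symm hx _ b c,
    pd_comm h.metric.isOpen h.smooth b c hx]

theorem self_mul_pdMat_confMat (h : IsConformalOn g γ lam U) (hx : x ∈ U) (c d : Fin 4) :
    g x * (pdMat c (confMat g lam d) x + connMat g c x * confMat g lam d x
        - confMat g lam d x * connMat g c x) =
      covDeriv g (fun y => wedge (g y d) (dLam lam y)) c x := by
  have hleibniz : pdMat c (fun y => wedge (g y d) (dLam lam y)) x =
      pdMat c g x * confMat g lam d x + g x * pdMat c (confMat g lam d) x := by
    rw [← pdMat_mul (fun i j => h.metric.differentiableAt i j hx)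
      (h.differentiableAt_confMat hx d)]
    exact pdMat_congr h.metric.isOpen (fun y hy => (h.self_mul_confMat hy d).symm) c hx
  rw [covDeriv, hleibniz, h.metric.pdMat_self hx, ← h.self_mul_confMat hx]
  noncomm_ring

theorem covDeriv_wedge_sub (h : IsConformalOn g γ lam U) (hx : x ∈ U) (c d : Fin 4) :
    covDeriv g (fun y => wedge (g y d) (dLam lam y)) c x
        - covDeriv g (fun y => wedge (g y c) (dLam lam y)) d x =
      wedge (g x d) (hess g lam x c) - wedge (g x c) (hess g lam x d) := by
  have hcov : ∀ c d, covDeriv g (fun y => wedge (g y d) (dLam lam y)) c x =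
      wedge (covVec g (fun y => g y d) c x) (dLam lam x) + wedge (g x d) (hess g lam x c) :=
    fun c d => covDeriv_wedge g (α := fun y => g y d) (β := dLam lam)
      (fun a => h.metric.differentiableAt d a hx) (h.differentiableAt_pd_lam hx) c
  rw [hcov, hcov, h.metric.covVec_row_comm hx c d, add_sub_add_left_eq_sub]

theorem curvMat_eq (h : IsConformalOn g γ lam U) (hx : x ∈ U) (c d : Fin 4) :
    curvMat γ c d x = curvMat g c d x
      + (pdMat c (confMat g lam d) x + connMat g c x * confMat g lam d x
        - confMat g lam d x * connMat g c x)
      - (pdMat d (confMat g lam c) x + connMat g d x * confMat g lam c x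
        - confMat g lam c x * connMat g d x)
      + (confMat g lam c x * confMat g lam d x - confMat g lam d x * confMat g lam c x) := by
  have hpd : ∀ c d, pdMat c (connMat γ d) x = pdMat c (connMat g d) x
      + pd c (fun y => pd d lam y) x • 1 + pdMat c (confMat g lam d) x := by
    intro c d
    have hscalar : ∀ a b, DifferentiableAt ℝ (fun y => (pd d lam y • (1 : Tensor2)) a b) x :=
      fun a b => (h.differentiableAt_pd_lam hx d).mul_const _
    have hconst : pdMat c (fun _ => (1 : Tensor2)) x = 0 := by
      ext a b; exact pd_const c _ x
    rw [pdMat_congr h.metric.isOpen (fun y hy => h.connMat_eq hy d) c hx,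
      pdMat_add (A := fun y => connMat g d y + pd d lam y • 1)
        (fun a b => (h.metric.differentiableAt_connMat d a b hx).fun_add (hscalar a b))
        (h.differentiableAt_confMat hx d),
      pdMat_add (fun a b => h.metric.differentiableAt_connMat d a b hx) hscalar,
      pdMat_smul (h.differentiableAt_pd_lam hx d) (A := fun _ => 1)
        (fun a b => differentiableAt_const _), hconst,
      smul_zero, add_zero]
  rw [h.isMetricOn.curvMat_eq hx, h.metric.curvMat_eq hx, hpd, hpd, h.connMat_eq hx,
    h.connMat_eq hx, pd_comm h.metric.isOpen h.smooth c d hx]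
  simp only [add_mul, mul_add, smul_mul_assoc, mul_smul_comm, one_mul, mul_one]
  module

theorem self_mul_commutator (h : IsConformalOn g γ lam U) (hx : x ∈ U) (c d : Fin 4) :
    g x * (confMat g lam c x * confMat g lam d x - confMat g lam d x * confMat g lam c x) =
      dLam lam x d • wedge (g x c) (dLam lam x) - dLam lam x c • wedge (g x d) (dLam lam x)
        - normSq g lam x • wedge (g x c) (g x d) := by
  rw [mul_sub, ← mul_assoc, ← mul_assoc, h.self_mul_confMat hx, h.self_mul_confMat hx, confMat,
    confMat, ← mul_assoc, ← mul_assoc, h.metric.wedge_mul_inv_mul_wedge hx, normSq]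

theorem exists_riemann_eq (h : IsConformalOn g γ lam U) (hx : x ∈ U) :
    ∃ T : Tensor2, riemann γ x = Real.exp (2 * lam x) • riemann g x + extProd (γ x) T := by
  set T : Tensor2 := -(hess g lam x - Matrix.vecMulVec (dLam lam x) (dLam lam x)
    + (1 / 2 * normSq g lam x) • g x) with hT
  have hTsymm : T.IsSymm := by
    refine (((h.hess_symm hx).sub ?_).add ((h.metric.symm x hx).smul _)).neg
    exact Matrix.transpose_vecMulVec _ _
  have hcurv : ∀ c d, g x * curvMat γ c d x =
      g x * curvMat g c d x + (wedge (g x c) (T d) - wedge (g x d) (T c)) := by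
    intro c d
    rw [h.curvMat_eq hx, mul_add, h.self_mul_commutator hx, mul_sub, mul_add,
      h.self_mul_pdMat_confMat hx, h.self_mul_pdMat_confMat hx, add_sub_assoc,
      h.covDeriv_wedge_sub hx, add_assoc]
    congr 1
    ext a b
    simp only [hT, wedge, Matrix.add_apply, Matrix.sub_apply, Matrix.smul_apply, Matrix.neg_apply,
      Matrix.vecMulVec_apply, smul_eq_mul]
    ring
  refine ⟨T, ?_⟩
  funext a b c d
  rw [riemann_eq_mul_curvMat, h.eq x hx, Matrix.smul_mul, hcurv]
  simp only [Matrix.smul_apply, Matrix.add_apply, Matrix.sub_apply, Pi.add_apply, Pi.smul_apply,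
    smul_eq_mul, extProd, wedge, ← riemann_eq_mul_curvMat, hTsymm.apply c b, hTsymm.apply c a,
    (h.metric.symm x hx).apply a c, (h.metric.symm x hx).apply b c,
    hTsymm.apply d b, hTsymm.apply d a, (h.metric.symm x hx).apply a d,
    (h.metric.symm x hx).apply b d]
  ring

theorem covDeriv_exp_smul (h : IsConformalOn g γ lam U) {T : R4 → Tensor2}
    (hT : ∀ i j, ContDiffOn ℝ ∞ (fun y => T y i j) U) (hx : x ∈ U) (c : Fin 4) :
    covDeriv γ (fun y => Real.exp (2 * lam y) • T y) c x = Real.exp (2 * lam x) •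
      (covDeriv g T c x - ((confMat g lam c x).transpose * T x + T x * confMat g lam c x)) := by
  have hd := h.differentiableAt_lam hx
  have hdT : ∀ a b, DifferentiableAt ℝ (fun y => T y a b) x := fun a b =>
    differentiableAt_of_contDiffOn h.metric.isOpen (hT a b) hx
  rw [covDeriv, covDeriv, pdMat_smul (hd.const_mul 2).exp hdT, pd_exp_two_mul hd,
    h.connMat_eq hx]
  simp only [Matrix.transpose_add, Matrix.transpose_smul, Matrix.transpose_one, add_mul, mul_add,
    smul_mul_assoc, mul_smul_comm, one_mul, mul_one]
  module

end IsConformalOn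

/-! ### Divergence of the Weyl tensor of a conformally product metric -/

/-- The covariant derivative `∇_e P` of the 4-tensor `P` for the Levi-Civita connection of `g`. -/
def covDeriv4 (g : R4 → Tensor2) (P : R4 → Tensor4) (e : Fin 4) (x : R4) : Tensor4 :=
  fun a b c d => pd e (fun y => P y a b c d) x
    - ∑ f, (christoffel g x f e a * P x f b c d + christoffel g x f e b * P x a f c d
      + christoffel g x f e c * P x a b f d + christoffel g x f e d * P x a b c f)

theorem diverg_apply (g : R4 → Tensor2) (P : R4 → Tensor4) (x : R4) (b c d : Fin 4) :
    diverg g P x b c d = mtrace (g x) (.of fun e a => covDeriv4 g P e x a b c d) := rfl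

section CovariantDerivative

variable (g : R4 → Tensor2) {P Q : R4 → Tensor4} {x : R4}

theorem covDeriv4_congr {U : Set R4} (hU : IsOpen U) (h : ∀ y ∈ U, P y = Q y) (hx : x ∈ U)
    (e : Fin 4) : covDeriv4 g P e x = covDeriv4 g Q e x := by
  funext a b c d
  simp only [covDeriv4, h x hx,
    pd_congr hU (fun y hy => congrFun (congrFun (congrFun (congrFun (h y hy) a) b) c) d) e hx]

theorem covDeriv4_add (hP : ∀ a b c d, DifferentiableAt ℝ (fun y => P y a b c d) x)
    (hQ : ∀ a b c d, DifferentiableAt ℝ (fun y => Q y a b c d) x) (e : Fin 4) :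
    covDeriv4 g (fun y => P y + Q y) e x = covDeriv4 g P e x + covDeriv4 g Q e x := by
  funext a b c d
  simp only [covDeriv4, Pi.add_apply, pd_add (hP a b c d) (hQ a b c d), mul_add,
    Finset.sum_add_distrib]
  ring

theorem covDeriv4_extProd {A B : R4 → Tensor2} (hA : ∀ a b, DifferentiableAt ℝ (fun y => A y a b) x)
    (hB : ∀ a b, DifferentiableAt ℝ (fun y => B y a b) x) (e : Fin 4) :
    covDeriv4 g (fun y => extProd (A y) (B y)) e x =
      extProd (covDeriv g A e x) (B x) + extProd (A x) (covDeriv g B e x) := by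
  funext a b c d
  have hpd : pd e (fun y => extProd (A y) (B y) a b c d) x =
      (extProd (pdMat e A x) (B x) + extProd (A x) (pdMat e B x)) a b c d := by
    have hAB := fun i j k l => (hA i j).fun_mul (hB k l)
    simp only [extProd]
    rw [pd_sub (((hAB a c b d).fun_add (hAB b d a c)).fun_sub (hAB a d b c)) (hAB b c a d),
      pd_sub ((hAB a c b d).fun_add (hAB b d a c)) (hAB a d b c),
      pd_add (hAB a c b d) (hAB b d a c), pd_mul (hA a c) (hB b d), pd_mul (hA b d) (hB a c),
      pd_mul (hA a d) (hB b c), pd_mul (hA b c) (hB a d)]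
    simp only [Pi.add_apply, extProd, pdMat]
    ring
  rw [covDeriv4, hpd]
  simp only [covDeriv, extProd, Pi.add_apply, Matrix.sub_apply, Matrix.add_apply,
    Matrix.mul_apply, Matrix.transpose_apply, connMat, Fin.sum_univ_four]
  ring

end CovariantDerivative

theorem differentiableAt_extProd {A B : R4 → Tensor2} {x : R4}
    (hA : ∀ a b, DifferentiableAt ℝ (fun y => A y a b) x)
    (hB : ∀ a b, DifferentiableAt ℝ (fun y => B y a b) x) (a b c d : Fin 4) :
    DifferentiableAt ℝ (fun y => extProd (A y) (B y) a b c d) x :=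
  ((((hA a c).fun_mul (hB b d)).fun_add ((hA b d).fun_mul (hB a c))).fun_sub
    ((hA a d).fun_mul (hB b c))).fun_sub ((hA b c).fun_mul (hB a d))

theorem mtrace_vecMulVec (γ : Tensor2) (p q : Tensor1) :
    mtrace γ (Matrix.vecMulVec p q) = p ⬝ᵥ γ⁻¹.mulVec q := by
  simp only [mtrace, Matrix.vecMulVec_apply, dotProduct, Matrix.mulVec, Finset.mul_sum]
  iterate 2 refine Finset.sum_congr rfl fun _ _ => ?_
  ring

/-- `γ_e ⊙ p - v_e ⊙ l` with `p = v γ⁻¹ l`, where `⊙` is the symmetric product and `γ_e`, `v_e` are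
rows. For `l = dλ` this is `∇_e v` when `e^{-2λ} v` is parallel for `e^{-2λ} γ`. -/
def confDeriv (γ v : Tensor2) (l : Tensor1) (e : Fin 4) : Tensor2 :=
  Matrix.vecMulVec ((v * γ⁻¹).mulVec l) (γ e) + Matrix.vecMulVec (γ e) ((v * γ⁻¹).mulVec l)
    - Matrix.vecMulVec (v e) l - Matrix.vecMulVec l (v e)

namespace IsSplit

variable {γ v h : Tensor2}

theorem row_dotProduct_row (H : IsSplit γ v h) (b c : Fin 4) :
    v b ⬝ᵥ γ⁻¹.mulVec (v c) = v b c := by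
  have hrow : v b ⬝ᵥ γ⁻¹.mulVec (v c) = (v * γ⁻¹ * v.transpose) b c := by
    rw [mul_assoc]; rfl
  rw [hrow, H.symm_left.eq, H.left_left]

theorem row_dotProduct_row_right (H : IsSplit γ v h) (b c : Fin 4) :
    v b ⬝ᵥ γ⁻¹.mulVec (h c) = 0 := by
  have hrow : v b ⬝ᵥ γ⁻¹.mulVec (h c) = (v * γ⁻¹ * h.transpose) b c := by
    rw [mul_assoc]; rfl
  rw [hrow, H.symm_right.eq, H.left_right, Matrix.zero_apply]

theorem self_row_dotProduct (H : IsSplit γ v h) (p : Tensor1) (c : Fin 4) :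
    γ c ⬝ᵥ γ⁻¹.mulVec p = p c := by
  rw [row_dotProduct_mulVec, H.self_mul_inv, Matrix.one_mulVec]

theorem mtrace_confDeriv (H : IsSplit γ v h) (l : Tensor1) (c : Fin 4) :
    mtrace γ (.of fun e a => confDeriv γ v l e a c) = 4 * (v * γ⁻¹).mulVec l c - 2 * l c := by
  set p := (v * γ⁻¹).mulVec l with hp
  have hmat : (Matrix.of fun e a => confDeriv γ v l e a c) =
      Matrix.vecMulVec (γ c) p + p c • γ + (-l c) • v + (-1 : ℝ) • Matrix.vecMulVec (v c) l := by
    ext e a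
    simp only [confDeriv, ← hp, Matrix.of_apply, Matrix.add_apply, Matrix.sub_apply,
      Matrix.smul_apply, Matrix.vecMulVec_apply, smul_eq_mul, H.symm.apply c e,
      H.symm_left.apply c e]
    ring
  rw [hmat]
  simp only [mtrace_add, mtrace_smul, mtrace_vecMulVec, H.self_row_dotProduct, H.mtrace_self,
    H.mtrace_left, row_dotProduct_mulVec, ← hp]
  ring

theorem mtrace_row_mul_confDeriv (H : IsSplit γ v h) (l : Tensor1) (b c d : Fin 4) :
    mtrace γ (.of fun e a => v a c * confDeriv γ v l e b d) =
      ((v * γ⁻¹).mulVec l b - l b) * v c d + ((v * γ⁻¹).mulVec l d - l d) * v b c := by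
  set p := (v * γ⁻¹).mulVec l with hp
  have hmat : (Matrix.of fun e a => v a c * confDeriv γ v l e b d) =
      p b • Matrix.vecMulVec (γ d) (v c) + p d • Matrix.vecMulVec (γ b) (v c)
        + (-l d) • Matrix.vecMulVec (v b) (v c) + (-l b) • Matrix.vecMulVec (v d) (v c) := by
    ext e a
    simp only [confDeriv, ← hp, Matrix.of_apply, Matrix.add_apply, Matrix.sub_apply,
      Matrix.smul_apply, Matrix.vecMulVec_apply, smul_eq_mul, H.symm.apply d e,
      H.symm.apply b e, H.symm_left.apply d e, H.symm_left.apply b e, H.symm_left.apply c a]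
    ring
  rw [hmat]
  simp only [mtrace_add, mtrace_smul, mtrace_vecMulVec, H.self_row_dotProduct,
    H.row_dotProduct_row, H.symm_left.apply c d, H.symm_left.apply c b]
  ring

theorem mtrace_extProd_confDeriv (H : IsSplit γ v h) (l : Tensor1) (b c d : Fin 4) :
    mtrace γ (.of fun e a => extProd (confDeriv γ v l e) v a b c d) =
      wedge ((3 : ℝ) • (v * γ⁻¹).mulVec l - l) (v b) c d := by
  have hmat : (Matrix.of fun e a => extProd (confDeriv γ v l e) v a b c d) =
      v b d • (.of fun e a => confDeriv γ v l e a c)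
        + (.of fun e a => v a c * confDeriv γ v l e b d)
        + (-v b c) • (.of fun e a => confDeriv γ v l e a d)
        + (-1 : ℝ) • (.of fun e a => v a d * confDeriv γ v l e b c) := by
    ext e a
    simp only [extProd, Matrix.of_apply, Matrix.add_apply, Matrix.smul_apply, smul_eq_mul]
    ring
  rw [hmat]
  simp only [mtrace_add, mtrace_smul, H.mtrace_confDeriv, H.mtrace_row_mul_confDeriv, wedge,
    Pi.sub_apply, Pi.smul_apply, smul_eq_mul, H.symm_left.apply c d]
  ring

end IsSplit

theorem pureForm_apply (v h : Tensor2) (a b : Fin 4) :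
    pureForm v h a b = wedge (v a) (v b) + wedge (h a) (h b) := by
  funext c d
  simp only [pureForm, extProd, wedge, Pi.add_apply, Matrix.add_apply, Pi.smul_apply, smul_eq_mul]
  ring

theorem formInner_add_left (γ σ σ' τ : Tensor2) :
    formInner γ (σ + σ') τ = formInner γ σ τ + formInner γ σ' τ := by
  simp only [formInner, Matrix.add_apply, add_mul, Finset.sum_add_distrib, mul_add]

theorem formInner_add_right (γ σ τ τ' : Tensor2) :
    formInner γ σ (τ + τ') = formInner γ σ τ + formInner γ σ τ' := by
  simp only [formInner, Matrix.add_apply, Finset.sum_add_distrib, mul_add]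

theorem formInner_neg_neg (γ σ τ : Tensor2) : formInner γ (-σ) (-τ) = formInner γ σ τ := by
  simp only [formInner, Matrix.neg_apply, neg_mul, mul_neg, neg_neg]

theorem IsSplit.formInner_left_left {γ v h : Tensor2} (H : IsSplit γ v h) (p : Tensor1)
    (l a b : Fin 4) :
    formInner γ (wedge (v a) (v b)) (wedge p (v l)) = wedge ((v * γ⁻¹).mulVec p) (v l) a b := by
  refine (formInner_wedge γ (v a) (v b) p (v l)).trans ?_
  rw [row_dotProduct_mulVec v γ⁻¹ p a, row_dotProduct_mulVec v γ⁻¹ p b, H.row_dotProduct_row b l,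
    H.row_dotProduct_row a l, H.symm_left.apply l a, H.symm_left.apply l b]
  rfl

theorem IsSplit.formInner_left_right {γ v h : Tensor2} (H : IsSplit γ v h) (p : Tensor1)
    (l a b : Fin 4) : formInner γ (wedge (v a) (v b)) (wedge p (h l)) = 0 := by
  refine (formInner_wedge γ (v a) (v b) p (h l)).trans ?_
  rw [H.row_dotProduct_row_right b l, H.row_dotProduct_row_right a l, mul_zero, zero_mul, sub_zero]

theorem IsSplit.act3_neg_pureForm {γ v h : Tensor2} (H : IsSplit γ v h) (p q : Tensor1) :
    act3 γ (-pureForm v h) (fun b => -(wedge p (v b) + wedge q (h b))) = fun b =>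
      wedge ((v * γ⁻¹).mulVec p) (v b) + wedge ((h * γ⁻¹).mulVec q) (h b) := by
  funext l a b
  refine (formInner_neg_neg γ (pureForm v h a b) (wedge p (v l) + wedge q (h l))).trans ?_
  rw [pureForm_apply, formInner_add_left, formInner_add_right, formInner_add_right,
    H.formInner_left_left, H.formInner_left_right, H.swap.formInner_left_left,
    H.swap.formInner_left_right, add_zero, zero_add]
  rfl

theorem trace3_add (γ : Tensor2) (Y Z : Tensor3) :
    trace3 γ (Y + Z) = trace3 γ Y + trace3 γ Z := by
  funext a
  simp only [trace3, Pi.add_apply, mul_add, Finset.sum_add_distrib]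

theorem IsSplit.trace3_wedge {γ v h : Tensor2} (H : IsSplit γ v h) (p : Tensor1) :
    trace3 γ (fun b => wedge p (v b)) = (v * γ⁻¹).mulVec p - (2 : ℝ) • p := by
  funext a
  have hmat : trace3 γ (fun b => wedge p (v b)) a =
      mtrace γ (Matrix.vecMulVec (v a) p + (-p a) • v) := by
    refine Finset.sum_congr rfl fun l _ => Finset.sum_congr rfl fun m _ => ?_
    simp only [wedge, Matrix.add_apply, Matrix.smul_apply, Matrix.vecMulVec_apply, smul_eq_mul,
      H.symm_left.apply a l]
    ring
  rw [hmat, mtrace_add, mtrace_smul, mtrace_vecMulVec, row_dotProduct_mulVec, H.mtrace_left,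
    Pi.sub_apply, Pi.smul_apply, smul_eq_mul]
  ring

theorem IsSplit.mulVec_mulVec_left {γ v h : Tensor2} (H : IsSplit γ v h) (l : Tensor1) :
    (v * γ⁻¹).mulVec ((v * γ⁻¹).mulVec l) = (v * γ⁻¹).mulVec l := by
  rw [Matrix.mulVec_mulVec, ← mul_assoc, H.left_left]

theorem diverg_neg_pureForm {γ v w : R4 → Tensor2} {x : R4} {l : Tensor1}
    (H : IsSplit (γ x) (v x) (w x)) (hv : ∀ a b, DifferentiableAt ℝ (fun y => v y a b) x)
    (hw : ∀ a b, DifferentiableAt ℝ (fun y => w y a b) x)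
    (hdv : ∀ e, covDeriv γ v e x = confDeriv (γ x) (v x) l e)
    (hdw : ∀ e, covDeriv γ w e x = confDeriv (γ x) (w x) l e) :
    diverg γ (fun y => -pureForm (v y) (w y)) x = fun b =>
      -(wedge ((3 : ℝ) • (v x * (γ x)⁻¹).mulVec l - l) (v x b)
        + wedge ((3 : ℝ) • (w x * (γ x)⁻¹).mulVec l - l) (w x b)) := by
  have hsum : (fun y => -pureForm (v y) (w y)) = fun y =>
      extProd ((-1 / 2 : ℝ) • v y) (v y) + extProd ((-1 / 2 : ℝ) • w y) (w y) := by
    funext y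
    rw [pureForm, extProd_smul_left, extProd_smul_left]
    module
  have hsmul : ∀ {T : R4 → Tensor2}, (∀ a b, DifferentiableAt ℝ (fun y => T y a b) x) →
      ∀ a b, DifferentiableAt ℝ (fun y => ((-1 / 2 : ℝ) • T y) a b) x :=
    fun hT a b => (hT a b).const_mul _
  have hcov : ∀ e, covDeriv4 γ (fun y => -pureForm (v y) (w y)) e x =
      -(extProd (confDeriv (γ x) (v x) l e) (v x) + extProd (confDeriv (γ x) (w x) l e) (w x)) := by
    have hhalf : ∀ {T : R4 → Tensor2}, (∀ a b, DifferentiableAt ℝ (fun y => T y a b) x) → ∀ e,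
        covDeriv4 γ (fun y => extProd ((-1 / 2 : ℝ) • T y) (T y)) e x =
          -extProd (covDeriv γ T e x) (T x) := by
      intro T hT e
      have hd : covDeriv γ (fun y => (-1 / 2 : ℝ) • T y) e x = (-1 / 2 : ℝ) • covDeriv γ T e x := by
        rw [covDeriv, covDeriv, pdMat_smul (differentiableAt_const _) hT, pd_const, zero_smul,
          zero_add, mul_smul_comm, smul_mul_assoc, ← smul_add, ← smul_sub]
      rw [covDeriv4_extProd γ (hsmul hT) hT, hd, extProd_smul_left, extProd_smul_left,
        extProd_comm (T x)]
      module
    intro e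
    rw [hsum, covDeriv4_add γ (differentiableAt_extProd (hsmul hv) hv)
      (differentiableAt_extProd (hsmul hw) hw), hhalf hv, hhalf hw, hdv, hdw, neg_add]
  funext b c d
  have hmat : (Matrix.of fun e a =>
      covDeriv4 γ (fun y => -pureForm (v y) (w y)) e x a b c d) =
      (-1 : ℝ) • ((.of fun e a => extProd (confDeriv (γ x) (v x) l e) (v x) a b c d)
        + .of fun e a => extProd (confDeriv (γ x) (w x) l e) (w x) a b c d) := by
    ext e a
    rw [Matrix.of_apply, hcov, neg_one_smul]
    rfl
  rw [diverg_apply, hmat, mtrace_smul, mtrace_add, H.mtrace_extProd_confDeriv,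
    H.swap.mtrace_extProd_confDeriv, neg_one_mul]
  rfl

theorem IsConformalOn.covDeriv_eq_confDeriv {g γ a : R4 → Tensor2} {lam : R4 → ℝ} {U : Set R4}
    {x : R4} (h : IsConformalOn g γ lam U) (ha : ∀ i j, ContDiffOn ℝ ∞ (fun y => a y i j) U)
    (hx : x ∈ U) (hs : (a x).IsSymm) {c : Fin 4} (hpar : covDeriv g a c x = 0) :
    covDeriv γ (fun y => Real.exp (2 * lam y) • a y) c x =
      confDeriv (γ x) (Real.exp (2 * lam x) • a x) (dLam lam x) c := by
  set E := Real.exp (2 * lam x) with hE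
  have hinv : (E • a x) * (γ x)⁻¹ = a x * (g x)⁻¹ := by
    have hγ : (γ x)⁻¹ = E⁻¹ • (g x)⁻¹ := by
      refine Matrix.inv_eq_right_inv ?_
      rw [h.eq x hx, smul_mul_smul_comm, mul_inv_cancel₀ (Real.exp_ne_zero _), one_smul,
        Matrix.mul_nonsing_inv _ (h.metric.isUnit_det hx)]
    rw [hγ, smul_mul_smul_comm, mul_inv_cancel₀ (Real.exp_ne_zero _), one_smul]
  have hmul : a x * confMat g lam c x = Matrix.vecMulVec (a x c) (dLam lam x)
      - Matrix.vecMulVec ((a x * (g x)⁻¹).mulVec (dLam lam x)) (g x c) := by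
    have hcol : (a x).mulVec (Pi.single c 1) = a x c := by
      rw [Matrix.mulVec_single_one]
      exact congrFun hs.eq c
    rw [confMat, ← mul_assoc, wedge_eq_sub, mul_sub, Matrix.mul_vecMulVec, Matrix.mul_vecMulVec,
      ← Matrix.mulVec_mulVec, h.metric.inv_mulVec_row hx, hcol]
  have htr : (confMat g lam c x).transpose * a x = (a x * confMat g lam c x).transpose := by
    rw [Matrix.transpose_mul, hs.eq]
  rw [h.covDeriv_exp_smul ha hx, hpar, htr, hmul, confDeriv, hinv, h.eq x hx, ← hE]
  ext i j
  simp only [Matrix.transpose_sub, Matrix.transpose_vecMulVec, Matrix.sub_apply,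
    Matrix.add_apply, Matrix.smul_apply, Matrix.vecMulVec_apply, smul_eq_mul, Matrix.zero_apply]
  ring

theorem IsConformalOn.phi_eq {g γ a b : R4 → Tensor2} {lam : R4 → ℝ} {U : Set R4} {x : R4}
    (h : IsConformalOn g γ lam U) (ha : ∀ i j, ContDiffOn ℝ ∞ (fun y => a y i j) U)
    (hb : ∀ i j, ContDiffOn ℝ ∞ (fun y => b y i j) U) (hx : x ∈ U)
    (hapar : ∀ c, covDeriv g a c x = 0) (hbpar : ∀ c, covDeriv g b c x = 0)
    (hsymm_a : (a x).IsSymm) (hsymm_b : (b x).IsSymm)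
    (H : IsSplit (γ x) (Real.exp (2 * lam x) • a x) (Real.exp (2 * lam x) • b x))
    (hS : ∀ y ∈ U, bigS γ y =
      -pureForm (Real.exp (2 * lam y) • a y) (Real.exp (2 * lam y) • b y)) :
    phi γ x = (-2 : ℝ) • dLam lam x := by
  set l := dLam lam x
  set v : R4 → Tensor2 := fun y => Real.exp (2 * lam y) • a y
  set w : R4 → Tensor2 := fun y => Real.exp (2 * lam y) • b y
  change IsSplit (γ x) (v x) (w x) at H
  have hdiff : ∀ {T : R4 → Tensor2}, (∀ i j, ContDiffOn ℝ ∞ (fun y => T y i j) U) →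
      ∀ i j, DifferentiableAt ℝ (fun y => (Real.exp (2 * lam y) • T y) i j) x := fun hT i j =>
    ((h.differentiableAt_lam hx).const_mul 2).exp.fun_mul
      (differentiableAt_of_contDiffOn h.metric.isOpen (hT i j) hx)
  have hdiv : diverg γ (bigS γ) x = fun b =>
      -(wedge ((3 : ℝ) • (v x * (γ x)⁻¹).mulVec l - l) (v x b)
        + wedge ((3 : ℝ) • (w x * (γ x)⁻¹).mulVec l - l) (w x b)) := by
    rw [← diverg_neg_pureForm H (hdiff ha) (hdiff hb)
      (fun e => h.covDeriv_eq_confDeriv ha hx hsymm_a (hapar e))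
      (fun e => h.covDeriv_eq_confDeriv hb hx hsymm_b (hbpar e))]
    funext b c d
    simp only [diverg_apply, covDeriv4_congr γ h.metric.isOpen hS hx]
    rfl
  have hl_add : (v x * (γ x)⁻¹).mulVec l + (w x * (γ x)⁻¹).mulVec l = l := by
    rw [← Matrix.add_mulVec, ← add_mul, ← H.eq_add, H.self_mul_inv, Matrix.one_mulVec]
  have hpart : ∀ {A B : Tensor2}, IsSplit (γ x) A B → (A * (γ x)⁻¹).mulVec
      ((3 : ℝ) • (A * (γ x)⁻¹).mulVec l - l) = (2 : ℝ) • (A * (γ x)⁻¹).mulVec l := by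
    intro A B HA
    rw [Matrix.mulVec_sub, Matrix.mulVec_smul, HA.mulVec_mulVec_left]
    module
  rw [phi, hdiv, hS x hx, H.act3_neg_pureForm, hpart H, hpart H.swap]
  refine (trace3_add (γ x) (fun b => wedge _ (v x b)) fun b => wedge _ (w x b)).trans ?_
  rw [H.trace3_wedge, H.swap.trace3_wedge, Matrix.mulVec_smul, Matrix.mulVec_smul,
    H.mulVec_mulVec_left, H.swap.mulVec_mulVec_left]
  conv_rhs => rw [← hl_add]
  module

/-! ### Parallel splittings -/

/-- The Christoffel symbols of the first kind `[c j, m]` of `T`, as a matrix in `m` and `j`. -/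
def firstKind (T : R4 → Tensor2) (c : Fin 4) (x : R4) : Tensor2 := .of fun m j =>
  (1 / 2) * (pd c (fun y => T y m j) x + pd j (fun y => T y m c) x - pd m (fun y => T y c j) x)

section FirstKind

variable {a b g : R4 → Tensor2} {U : Set R4} {x : R4}

theorem firstKind_congr (hU : IsOpen U) (h : ∀ y ∈ U, a y = b y) (c : Fin 4) (hx : x ∈ U) :
    firstKind a c x = firstKind b c x := by
  have hpd : ∀ i j k, pd i (fun y => a y j k) x = pd i (fun y => b y j k) x := fun i j k =>
    pd_congr hU (fun y hy => by rw [h y hy]) i hx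
  ext m j
  simp only [firstKind, Matrix.of_apply, hpd]

theorem firstKind_add (ha : ∀ i j, DifferentiableAt ℝ (fun y => a y i j) x)
    (hb : ∀ i j, DifferentiableAt ℝ (fun y => b y i j) x) (c : Fin 4) :
    firstKind (fun y => a y + b y) c x = firstKind a c x + firstKind b c x := by
  ext m j
  simp only [firstKind, Matrix.of_apply, Matrix.add_apply, pd_add (ha _ _) (hb _ _)]
  ring

theorem firstKind_add_transpose (hU : IsOpen U) (ha : ∀ y ∈ U, (a y).IsSymm) (c : Fin 4)
    (hx : x ∈ U) : firstKind a c x + (firstKind a c x).transpose = pdMat c a x := by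
  have hsymm : ∀ i j k, pd i (fun y => a y j k) x = pd i (fun y => a y k j) x := fun i j k =>
    pd_congr hU (fun y hy => (ha y hy).apply k j) i hx
  ext m j
  simp only [firstKind, pdMat, Matrix.of_apply, Matrix.add_apply, Matrix.transpose_apply,
    hsymm _ c, hsymm c j m]
  ring

theorem IsMetricOn.mul_connMat (hg : IsMetricOn g U) (hx : x ∈ U) (c : Fin 4) :
    g x * connMat g c x = firstKind g c x :=
  Matrix.ext fun m j => hg.mul_connMat_apply hx m c j

theorem IsMetricOn.covDeriv_eq_zero_of_isSplit (hg : IsMetricOn g U)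
    (H : ∀ y ∈ U, IsSplit (g y) (a y) (b y))
    (ha : ∀ i j, ContDiffOn ℝ ∞ (fun y => a y i j) U)
    (hb : ∀ i j, ContDiffOn ℝ ∞ (fun y => b y i j) U) {c : Fin 4} (hx : x ∈ U)
    (hrange_a : ∃ Z, firstKind a c x = a x * Z) (hrange_b : ∃ Z, firstKind b c x = b x * Z) :
    covDeriv g a c x = 0 := by
  obtain ⟨Y, hY⟩ := hrange_a
  obtain ⟨Z, hZ⟩ := hrange_b
  have hconn : a x * connMat g c x = firstKind a c x := by
    have hsum : g x * connMat g c x = a x * Y + b x * Z := by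
      rw [hg.mul_connMat hx, firstKind_congr hg.isOpen (fun y hy => (H y hy).eq_add) c hx,
        firstKind_add (fun i j => differentiableAt_of_contDiffOn hg.isOpen (ha i j) hx)
          (fun i j => differentiableAt_of_contDiffOn hg.isOpen (hb i j) hx), hY, hZ]
    calc a x * connMat g c x = a x * (g x)⁻¹ * (g x * connMat g c x) := by
          rw [← mul_assoc, mul_assoc (a x), (H x hx).inv_mul_self, mul_one]
      _ = a x * (g x)⁻¹ * a x * Y + a x * (g x)⁻¹ * b x * Z := by
          rw [hsum, mul_add, ← mul_assoc, ← mul_assoc]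
      _ = firstKind a c x := by
          rw [(H x hx).left_left, (H x hx).left_right, zero_mul, add_zero, hY]
  have htranspose : (connMat g c x).transpose * a x = (firstKind a c x).transpose := by
    rw [← hconn, Matrix.transpose_mul, (H x hx).symm_left.eq]
  rw [covDeriv, htranspose, hconn, add_comm,
    firstKind_add_transpose hg.isOpen (fun y hy => (H y hy).symm_left) c hx, sub_self]

end FirstKind

/-! ### Pullbacks of surface metrics -/

theorem pd_comp {E : Type*} [NormedAddCommGroup E] [NormedSpace ℝ E] {G : R4 → E} {f : E → ℝ}
    {y : R4} (hf : DifferentiableAt ℝ f (G y)) (hG : DifferentiableAt ℝ G y) (i : Fin 4) :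
    pd i (fun z => f (G z)) y =
      fderiv ℝ f (G y) (fderiv ℝ G y (EuclideanSpace.single i 1)) := by
  rw [pd, fderiv_fun_comp y hf hG, ContinuousLinearMap.comp_apply]

/-- The Jacobian matrix of the map `R4 → ℝ²` with components `ξ`. -/
def pairJacobian (ξ : Fin 2 → R4 → ℝ) (y : R4) : Matrix (Fin 2) (Fin 4) ℝ :=
  .of fun A i => pd i (ξ A) y

/-- The pullback of the metric `w` on `ℝ²` by the map with components `ξ`. -/
def pullPair (w : (Fin 2 → ℝ) → Matrix (Fin 2) (Fin 2) ℝ) (ξ : Fin 2 → R4 → ℝ) (y : R4) :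
    Tensor2 :=
  (pairJacobian ξ y).transpose * w (fun C => ξ C y) * pairJacobian ξ y

section PullPair

variable {w : (Fin 2 → ℝ) → Matrix (Fin 2) (Fin 2) ℝ} {ξ : Fin 2 → R4 → ℝ} {U : Set R4}
  {s : Set (Fin 2 → ℝ)}

theorem pullPair_apply (y : R4) (j k : Fin 4) : pullPair w ξ y j k =
    ∑ B, ∑ A, pd j (ξ A) y * w (fun C => ξ C y) A B * pd k (ξ B) y := by
  simp only [pullPair, pairJacobian, Matrix.mul_apply, Matrix.transpose_apply, Matrix.of_apply,
    Finset.sum_mul]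

theorem contDiffOn_comp_pair {f : (Fin 2 → ℝ) → ℝ} (hf : ContDiffOn ℝ ∞ f s)
    (hξ : ∀ C, ContDiffOn ℝ ∞ (ξ C) U) (hmaps : ∀ y ∈ U, (fun C => ξ C y) ∈ s) :
    ContDiffOn ℝ ∞ (fun y => f (fun C => ξ C y)) U :=
  hf.comp (contDiffOn_pi.2 hξ) hmaps

theorem contDiffOn_pullPair (hU : IsOpen U) (hw : ∀ i j, ContDiffOn ℝ ∞ (fun u => w u i j) s)
    (hξ : ∀ C, ContDiffOn ℝ ∞ (ξ C) U) (hmaps : ∀ y ∈ U, (fun C => ξ C y) ∈ s) (j k : Fin 4) :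
    ContDiffOn ℝ ∞ (fun y => pullPair w ξ y j k) U := by
  simp only [pullPair_apply]
  exact ContDiffOn.sum fun B _ => ContDiffOn.sum fun A _ =>
    ((contDiffOn_pd hU (hξ A) j).mul (contDiffOn_comp_pair (hw A B) hξ hmaps)).mul
      (contDiffOn_pd hU (hξ B) k)

theorem pd_comp_pair {f : (Fin 2 → ℝ) → ℝ} {y : R4}
    (hf : DifferentiableAt ℝ f (fun C => ξ C y)) (hξ : ∀ C, DifferentiableAt ℝ (ξ C) y)
    (i : Fin 4) : pd i (fun z => f (fun C => ξ C z)) y =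
      ∑ C, pd i (ξ C) y * fderiv ℝ f (fun C => ξ C y) (Pi.single C 1) := by
  have hdir : fderiv ℝ (fun z C => ξ C z) y (EuclideanSpace.single i 1) =
      ∑ C, pd i (ξ C) y • (Pi.single C (1 : ℝ) : Fin 2 → ℝ) := by
    rw [fderiv_pi hξ, ← pi_eq_sum_univ']
    rfl
  simp only [pd_comp (G := fun z C => ξ C z) hf (differentiableAt_pi.2 hξ), hdir, map_sum,
    map_smul, smul_eq_mul]

theorem pd_pullPair {y : R4} (hξ : ∀ C, DifferentiableAt ℝ (ξ C) y)
    (hdξ : ∀ C j, DifferentiableAt ℝ (pd j (ξ C)) y)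
    (hw : ∀ A B, DifferentiableAt ℝ (fun u => w u A B) (fun C => ξ C y)) (i j k : Fin 4) :
    pd i (fun z => pullPair w ξ z j k) y = ∑ B, ∑ A,
      ((pd i (pd j (ξ A)) y * w (fun C => ξ C y) A B + pd j (ξ A) y *
        ∑ C, pd i (ξ C) y * fderiv ℝ (fun u => w u A B) (fun C => ξ C y) (Pi.single C 1))
          * pd k (ξ B) y + pd j (ξ A) y * w (fun C => ξ C y) A B * pd i (pd k (ξ B)) y) := by
  have hwξ : ∀ A B, DifferentiableAt ℝ (fun z => w (fun C => ξ C z) A B) y := fun A B =>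
    DifferentiableAt.fun_comp' (f := fun z C => ξ C z) y (hw A B) (differentiableAt_pi.2 hξ)
  have hterm : ∀ A B, DifferentiableAt ℝ
      (fun z => pd j (ξ A) z * w (fun C => ξ C z) A B * pd k (ξ B) z) y := fun A B =>
    ((hdξ A j).fun_mul (hwξ A B)).fun_mul (hdξ B k)
  simp only [pullPair_apply]
  rw [pd_sum _ fun B _ => DifferentiableAt.fun_sum fun A _ => hterm A B]
  refine Finset.sum_congr rfl fun B _ => ?_
  rw [pd_sum _ fun A _ => hterm A B]
  refine Finset.sum_congr rfl fun A _ => ?_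
  rw [pd_mul ((hdξ A j).fun_mul (hwξ A B)) (hdξ B k), pd_mul (hdξ A j) (hwξ A B),
    pd_comp_pair (hw A B) hξ]

theorem exists_firstKind_pullPair_eq (hU : IsOpen U) (hs : IsOpen s)
    (hw : ∀ i j, ContDiffOn ℝ ∞ (fun u => w u i j) s) (hsymm : ∀ u ∈ s, (w u).IsSymm)
    (hξ : ∀ C, ContDiffOn ℝ ∞ (ξ C) U) (hmaps : ∀ y ∈ U, (fun C => ξ C y) ∈ s) {y : R4}
    (hy : y ∈ U) (c : Fin 4) :
    ∃ Y : Matrix (Fin 2) (Fin 4) ℝ,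
      firstKind (pullPair w ξ) c y = (pairJacobian ξ y).transpose * Y := by
  have hdξ : ∀ C j, DifferentiableAt ℝ (pd j (ξ C)) y := fun C j =>
    differentiableAt_of_contDiffOn hU (contDiffOn_pd hU (hξ C) j) hy
  have hpd := pd_pullPair (fun C => differentiableAt_of_contDiffOn hU (hξ C) hy) hdξ
    fun A B => differentiableAt_of_contDiffOn hs (hw A B) (hmaps y hy)
  let q : Fin 2 → Fin 2 → Fin 2 → ℝ := fun C A B =>
    fderiv ℝ (fun u => w u A B) (fun C => ξ C y) (Pi.single C 1)
  set W := w (fun C => ξ C y)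
  have hW : W 1 0 = W 0 1 := (hsymm _ (hmaps y hy)).apply 0 1
  have hlocal : (fun u => w u 1 0) =ᶠ[𝓝 (fun C => ξ C y)] fun u => w u 0 1 :=
    Filter.eventually_of_mem (hs.mem_nhds (hmaps y hy)) fun u hu => (hsymm u hu).apply 0 1
  have hcomm : ∀ A i j, pd i (pd j (ξ A)) y = pd j (pd i (ξ A)) y := fun A i j =>
    pd_comm hU (hξ A) i j hy
  refine ⟨.of fun B j => ∑ A, W A B * pd c (pd j (ξ A)) y + (1 / 2) * ∑ A, ∑ C,
    (q C A B * pd c (ξ C) y * pd j (ξ A) y + q C A B * pd j (ξ C) y * pd c (ξ A) y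
      - q B A C * pd c (ξ A) y * pd j (ξ C) y), ?_⟩
  ext m j
  simp only [firstKind, pairJacobian, hpd, Matrix.mul_apply, Matrix.transpose_apply,
    Matrix.of_apply, Fin.sum_univ_two, q, hW, hlocal.fderiv_eq, hcomm _ j c, hcomm _ m c,
    hcomm _ m j]
  ring

theorem exists_firstKind_pullPair_eq_mul (hU : IsOpen U) (hs : IsOpen s)
    (hw : ∀ i j, ContDiffOn ℝ ∞ (fun u => w u i j) s) (hsymm : ∀ u ∈ s, (w u).IsSymm)
    (hdet : ∀ u ∈ s, (w u).det ≠ 0) (hξ : ∀ C, ContDiffOn ℝ ∞ (ξ C) U)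
    (hmaps : ∀ y ∈ U, (fun C => ξ C y) ∈ s) {y : R4} (hy : y ∈ U)
    {K : Matrix (Fin 4) (Fin 2) ℝ} (hK : pairJacobian ξ y * K = 1) (c : Fin 4) :
    ∃ Z, firstKind (pullPair w ξ) c y = pullPair w ξ y * Z := by
  obtain ⟨Y, hY⟩ := exists_firstKind_pullPair_eq hU hs hw hsymm hξ hmaps hy c
  refine ⟨K * (w (fun C => ξ C y))⁻¹ * Y, ?_⟩
  calc firstKind (pullPair w ξ) c y
      = (pairJacobian ξ y).transpose * (w (fun C => ξ C y)
          * (pairJacobian ξ y * K) * (w (fun C => ξ C y))⁻¹) * Y := by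
        rw [hY, hK, Matrix.mul_one,
          Matrix.mul_nonsing_inv _ (isUnit_iff_ne_zero.2 (hdet _ (hmaps y hy))), Matrix.mul_one]
    _ = pullPair w ξ y * (K * (w (fun C => ξ C y))⁻¹ * Y) := by
        simp only [pullPair, Matrix.mul_assoc]

end PullPair

/-! ### Conformal products in arbitrary coordinates -/

/-- `firstPair` as a continuous linear map. -/
def firstPairL : R4 →L[ℝ] (Fin 2 → ℝ) :=
  ContinuousLinearMap.pi fun i => EuclideanSpace.proj (Fin.castAdd 2 i)

/-- `lastPair` as a continuous linear map. -/
def lastPairL : R4 →L[ℝ] (Fin 2 → ℝ) :=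
  ContinuousLinearMap.pi fun i => EuclideanSpace.proj (Fin.natAdd 2 i)

/-- The point of `ℝ⁴` whose first two coordinates are `u` and whose last two are `t`. -/
def joinPair (u t : Fin 2 → ℝ) : R4 := WithLp.toLp 2 (Fin.append u t)

theorem firstPair_joinPair (u t : Fin 2 → ℝ) : firstPair (joinPair u t) = u :=
  funext fun i => Fin.append_left u t i

theorem lastPair_joinPair (u t : Fin 2 → ℝ) : lastPair (joinPair u t) = t :=
  funext fun i => Fin.append_right u t i

theorem firstPairL_surjective : Function.Surjective firstPairL := fun u =>
  ⟨joinPair u 0, firstPair_joinPair u 0⟩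

theorem lastPairL_surjective : Function.Surjective lastPairL := fun t =>
  ⟨joinPair 0 t, lastPair_joinPair 0 t⟩

theorem isOpenMap_firstPair : IsOpenMap firstPair := firstPairL.isOpenMap firstPairL_surjective

theorem isOpenMap_lastPair : IsOpenMap lastPair := lastPairL.isOpenMap lastPairL_surjective

/-- The Jacobian matrix of `F`. -/
def jacobian (F : R4 → R4) (y : R4) : Tensor2 := .of fun A i => pd i (fun z => F z A) y

theorem fderiv_single_apply {F : R4 → R4} {x : R4} (hF : DifferentiableAt ℝ F x) (A i : Fin 4) :
    fderiv ℝ F x (EuclideanSpace.single i 1) A = jacobian F x A i := by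
  have h := pd_comp (EuclideanSpace.proj (𝕜 := ℝ) A).differentiableAt hF i
  rw [ContinuousLinearMap.fderiv] at h
  exact h.symm

theorem dLam_comp {F : R4 → R4} {f : R4 → ℝ} {x : R4} (hF : DifferentiableAt ℝ F x)
    (hf : DifferentiableAt ℝ f (F x)) :
    dLam (fun y => f (F y)) x = (jacobian F x).transpose.mulVec (dLam f (F x)) := by
  funext i
  rw [dLam, pd_comp hf hF, fderiv_apply_eq_sum_pd]
  simp only [fderiv_single_apply hF]
  rfl

theorem dLam_eq_zero_iff {f : R4 → ℝ} {x : R4} : dLam f x = 0 ↔ fderiv ℝ f x = 0 := by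
  refine ⟨fun h => ?_, fun h => ?_⟩
  · ext w
    rw [fderiv_apply_eq_sum_pd]
    exact Finset.sum_eq_zero fun i _ => by rw [show pd i f x = 0 from congrFun h i, mul_zero]
  · funext i
    rw [dLam, pd, h]
    rfl

/-- The differential of `f` at `x` involves only the first two or only the last two coordinates. -/
def HasPureDifferentialAt (f : R4 → ℝ) (x : R4) : Prop :=
  (∀ i < 2, pd i f x = 0) ∨ ∀ i ≥ 2, pd i f x = 0

theorem hasPureDifferentialAt_iff {f : R4 → ℝ} {x : R4} : HasPureDifferentialAt f x ↔
    (pd 0 f x = 0 ∧ pd 1 f x = 0) ∨ (pd 2 f x = 0 ∧ pd 3 f x = 0) := by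
  simp [HasPureDifferentialAt, Fin.forall_fin_succ]

/-- On `U`, `γ` is the pullback by `F` of the conformal product `e^{2λ} (v + h)` on `O`. -/
structure IsPulledBack (γ : R4 → Tensor2) (U : Set R4) (F : R4 → R4) (O : Set R4)
    (v h : (Fin 2 → ℝ) → Matrix (Fin 2) (Fin 2) ℝ) (lam : R4 → ℝ) : Prop where
  isOpen_source : IsOpen U
  isOpen_target : IsOpen O
  smooth_map : ContDiffOn ℝ ∞ F U
  mapsTo : MapsTo F U O
  det_ne : ∀ y ∈ U, (jacobian F y).det ≠ 0
  lorentz : IsLorentz2 v (firstPair '' O)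
  riemannian : IsRiemann2 h (lastPair '' O)
  smooth : ContDiffOn ℝ ∞ lam O
  eq : ∀ y ∈ U, γ y = pullMat (jacobian F y)
    (blockDiag (Real.exp (2 * lam (F y)) • v (firstPair (F y)))
      (Real.exp (2 * lam (F y)) • h (lastPair (F y))))

/-- The pullback by `F` of the metric `v` in the first two coordinates. -/
def leftPart (F : R4 → R4) (v : (Fin 2 → ℝ) → Matrix (Fin 2) (Fin 2) ℝ) (y : R4) : Tensor2 :=
  pullMat (jacobian F y) (blockDiag (v (firstPair (F y))) 0)

/-- The pullback by `F` of the metric `h` in the last two coordinates. -/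
def rightPart (F : R4 → R4) (h : (Fin 2 → ℝ) → Matrix (Fin 2) (Fin 2) ℝ) (y : R4) : Tensor2 :=
  pullMat (jacobian F y) (blockDiag 0 (h (lastPair (F y))))

/-- The pullback by `F` of the product metric `v + h`. -/
def prodMetric (F : R4 → R4) (v h : (Fin 2 → ℝ) → Matrix (Fin 2) (Fin 2) ℝ) (y : R4) : Tensor2 :=
  pullMat (jacobian F y) (blockDiag (v (firstPair (F y))) (h (lastPair (F y))))

theorem leftPart_eq_pullPair (F : R4 → R4) (v : (Fin 2 → ℝ) → Matrix (Fin 2) (Fin 2) ℝ) :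
    leftPart F v = pullPair v fun A y => F y (Fin.castAdd 2 A) := by
  funext y j k
  have hpair : (fun C => F y (Fin.castAdd 2 C)) = firstPair (F y) := rfl
  rw [pullPair_apply, hpair, leftPart, pullMat_apply, Finset.sum_comm]
  simp [Fin.sum_univ_four, Fin.sum_univ_two, blockDiag_apply, jacobian]

theorem rightPart_eq_pullPair (F : R4 → R4) (h : (Fin 2 → ℝ) → Matrix (Fin 2) (Fin 2) ℝ) :
    rightPart F h = pullPair h fun A y => F y (Fin.natAdd 2 A) := by
  funext y j k
  have hpair : (fun C => F y (Fin.natAdd 2 C)) = lastPair (F y) := rfl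
  rw [pullPair_apply, hpair, rightPart, pullMat_apply, Finset.sum_comm]
  simp [Fin.sum_univ_four, Fin.sum_univ_two, blockDiag_apply, jacobian]

theorem submatrix_mul_submatrix_eq_one {J K : Tensor2} (hJK : J * K = 1) {e : Fin 2 → Fin 4}
    (he : Function.Injective e) : J.submatrix e id * K.submatrix id e = 1 := by
  rw [← Matrix.submatrix_mul J K e id e Function.bijective_id, hJK, Matrix.submatrix_one e he]

namespace IsPulledBack

variable {γ : R4 → Tensor2} {U : Set R4} {F : R4 → R4} {O : Set R4}
  {v h : (Fin 2 → ℝ) → Matrix (Fin 2) (Fin 2) ℝ} {lam : R4 → ℝ} {x : R4}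

theorem isAdaptedFrame (P : IsPulledBack γ U F O v h lam) (hx : x ∈ U) :
    IsAdaptedFrame (jacobian F x) (v (firstPair (F x))) (h (lastPair (F x))) where
  det_ne := P.det_ne x hx
  det_left := (P.lorentz.det_neg _ (mem_image_of_mem _ (P.mapsTo hx))).ne
  det_right := (P.riemannian.posDef _ (mem_image_of_mem _ (P.mapsTo hx))).det_pos.ne'
  symm_left := P.lorentz.symm _ (mem_image_of_mem _ (P.mapsTo hx))
  symm_right := (P.riemannian.posDef _ (mem_image_of_mem _ (P.mapsTo hx))).isHermitian

theorem isSplit (P : IsPulledBack γ U F O v h lam) (hx : x ∈ U) :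
    IsSplit (prodMetric F v h x) (leftPart F v x) (rightPart F h x) :=
  (P.isAdaptedFrame hx).isSplit

theorem contDiffOn_apply (P : IsPulledBack γ U F O v h lam) (A : Fin 4) :
    ContDiffOn ℝ ∞ (fun y => F y A) U :=
  contDiffOn_euclidean.1 P.smooth_map A

theorem contDiffOn_leftPart (P : IsPulledBack γ U F O v h lam) (i j : Fin 4) :
    ContDiffOn ℝ ∞ (fun y => leftPart F v y i j) U := by
  rw [leftPart_eq_pullPair]
  exact contDiffOn_pullPair P.isOpen_source P.lorentz.smooth (fun _ => P.contDiffOn_apply _)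
    (fun y hy => mem_image_of_mem firstPair (P.mapsTo hy)) i j

theorem contDiffOn_rightPart (P : IsPulledBack γ U F O v h lam) (i j : Fin 4) :
    ContDiffOn ℝ ∞ (fun y => rightPart F h y i j) U := by
  rw [rightPart_eq_pullPair]
  exact contDiffOn_pullPair P.isOpen_source P.riemannian.smooth (fun _ => P.contDiffOn_apply _)
    (fun y hy => mem_image_of_mem lastPair (P.mapsTo hy)) i j

theorem isMetricOn (P : IsPulledBack γ U F O v h lam) : IsMetricOn (prodMetric F v h) U where
  isOpen := P.isOpen_source
  smooth i j := ((P.contDiffOn_leftPart i j).add (P.contDiffOn_rightPart i j)).congr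
    fun y hy => by rw [(P.isSplit hy).eq_add, Matrix.add_apply]
  symm y hy := (P.isSplit hy).symm
  det_ne y hy := (P.isSplit hy).det_ne

theorem isConformalOn (P : IsPulledBack γ U F O v h lam) :
    IsConformalOn (prodMetric F v h) γ (fun y => lam (F y)) U where
  metric := P.isMetricOn
  smooth := P.smooth.comp P.smooth_map P.mapsTo
  eq y hy := by rw [P.eq y hy, ← smul_blockDiag, pullMat_smul, prodMetric]

theorem exists_firstKind_leftPart (P : IsPulledBack γ U F O v h lam) (hx : x ∈ U) (c : Fin 4) :
    ∃ Z, firstKind (leftPart F v) c x = leftPart F v x * Z := by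
  rw [leftPart_eq_pullPair]
  exact exists_firstKind_pullPair_eq_mul P.isOpen_source (isOpenMap_firstPair O P.isOpen_target)
    P.lorentz.smooth P.lorentz.symm (fun u hu => (P.lorentz.det_neg u hu).ne)
    (fun _ => P.contDiffOn_apply _) (fun y hy => mem_image_of_mem firstPair (P.mapsTo hy)) hx
    (submatrix_mul_submatrix_eq_one (P.isAdaptedFrame hx).mul_inv
      (Fin.castAdd_injective 2 2)) c

theorem exists_firstKind_rightPart (P : IsPulledBack γ U F O v h lam) (hx : x ∈ U) (c : Fin 4) :
    ∃ Z, firstKind (rightPart F h) c x = rightPart F h x * Z := by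
  rw [rightPart_eq_pullPair]
  exact exists_firstKind_pullPair_eq_mul P.isOpen_source (isOpenMap_lastPair O P.isOpen_target)
    P.riemannian.smooth (fun u hu => (P.riemannian.posDef u hu).isHermitian)
    (fun u hu => (P.riemannian.posDef u hu).det_pos.ne')
    (fun _ => P.contDiffOn_apply _) (fun y hy => mem_image_of_mem lastPair (P.mapsTo hy)) hx
    (submatrix_mul_submatrix_eq_one (P.isAdaptedFrame hx).mul_inv (Fin.natAdd_injective 2 2)) c

theorem covDeriv_leftPart (P : IsPulledBack γ U F O v h lam) (hx : x ∈ U) (c : Fin 4) :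
    covDeriv (prodMetric F v h) (leftPart F v) c x = 0 :=
  P.isMetricOn.covDeriv_eq_zero_of_isSplit (fun _ => P.isSplit) P.contDiffOn_leftPart
    P.contDiffOn_rightPart hx (P.exists_firstKind_leftPart hx c) (P.exists_firstKind_rightPart hx c)

theorem covDeriv_rightPart (P : IsPulledBack γ U F O v h lam) (hx : x ∈ U) (c : Fin 4) :
    covDeriv (prodMetric F v h) (rightPart F h) c x = 0 :=
  P.isMetricOn.covDeriv_eq_zero_of_isSplit (fun _ hy => (P.isSplit hy).swap)
    P.contDiffOn_rightPart P.contDiffOn_leftPart hx (P.exists_firstKind_rightPart hx c)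
    (P.exists_firstKind_leftPart hx c)

theorem exists_riemann_prodMetric_eq (P : IsPulledBack γ U F O v h lam) (hx : x ∈ U) :
    ∃ k l : ℝ, riemann (prodMetric F v h) x =
      k • extProd (leftPart F v x) (leftPart F v x)
        + l • extProd (rightPart F h x) (rightPart F h x) := by
  refine (P.isAdaptedFrame hx).eq_of_mixed_eq_zero (P.isMetricOn.isCurvatureTensor_riemann hx)
    fun a b ha hb c d => ?_
  have hricci := P.isMetricOn.ricci_identity P.contDiffOn_leftPart
    (fun y hy c => P.covDeriv_leftPart hy c) hx c d
  exact (P.isAdaptedFrame hx).pullMat_inv_mul_eq_zero hricci ha hb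

theorem isSplit_conformal (P : IsPulledBack γ U F O v h lam) (hx : x ∈ U) :
    IsSplit (γ x) (Real.exp (2 * lam (F x)) • leftPart F v x)
      (Real.exp (2 * lam (F x)) • rightPart F h x) := by
  have hsplit := ((P.isAdaptedFrame hx).smul (Real.exp_ne_zero (2 * lam (F x)))).isSplit
  rw [← P.eq x hx] at hsplit
  simpa only [leftPart, rightPart, ← pullMat_smul, smul_blockDiag, smul_zero] using hsplit

theorem exists_weyl_eq (P : IsPulledBack γ U F O v h lam) (hx : x ∈ U) :
    ∃ r : ℝ, weyl γ x = r • (idForm (γ x) + (-3 : ℝ) • pureForm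
      (Real.exp (2 * lam (F x)) • leftPart F v x)
      (Real.exp (2 * lam (F x)) • rightPart F h x)) := by
  obtain ⟨k, l, hkl⟩ := P.exists_riemann_prodMetric_eq hx
  obtain ⟨T, hT⟩ := P.isConformalOn.exists_riemann_eq hx
  have hE := Real.exp_ne_zero (2 * lam (F x))
  refine ⟨_, weyl_eq_of_riemann (k := k / Real.exp (2 * lam (F x)))
    (l := l / Real.exp (2 * lam (F x))) (T := T) (P.isSplit_conformal hx) ?_⟩
  rw [hT, hkl]
  simp only [extProd_smul_left, extProd_smul_right, smul_add, smul_smul]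
  congr 3 <;> field_simp

theorem exists_weyl_eq_of_ne_zero (P : IsPulledBack γ U F O v h lam) (hx : x ∈ U)
    (hW : weyl γ x ≠ 0) : ∃ r : ℝ, r ≠ 0 ∧ weyl γ x = r • (idForm (γ x) + (-3 : ℝ) • pureForm
      (Real.exp (2 * lam (F x)) • leftPart F v x)
      (Real.exp (2 * lam (F x)) • rightPart F h x)) := by
  obtain ⟨r, hr⟩ := P.exists_weyl_eq hx
  refine ⟨r, ?_, hr⟩
  rintro rfl
  exact hW (by rw [hr, zero_smul])

theorem bigS_eq_neg_pureForm (P : IsPulledBack γ U F O v h lam) (hx : x ∈ U)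
    (hW : weyl γ x ≠ 0) : bigS γ x = -pureForm
      (Real.exp (2 * lam (F x)) • leftPart F v x)
      (Real.exp (2 * lam (F x)) • rightPart F h x) := by
  obtain ⟨r, hr0, hr⟩ := P.exists_weyl_eq_of_ne_zero hx hW
  exact bigS_eq (P.isSplit_conformal hx) hr hr0

theorem phi_eq_mulVec (P : IsPulledBack γ U F O v h lam) (hW : ∀ y ∈ U, weyl γ y ≠ 0)
    (hx : x ∈ U) :
    phi γ x = (jacobian F x).transpose.mulVec ((-2 : ℝ) • dLam lam (F x)) := by
  have hF : DifferentiableAt ℝ F x :=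
    (P.smooth_map.contDiffAt (P.isOpen_source.mem_nhds hx)).differentiableAt (by simp)
  have hlam : DifferentiableAt ℝ lam (F x) :=
    differentiableAt_of_contDiffOn P.isOpen_target P.smooth (P.mapsTo hx)
  rw [Matrix.mulVec_smul, ← dLam_comp hF hlam]
  exact P.isConformalOn.phi_eq P.contDiffOn_leftPart P.contDiffOn_rightPart hx
    (P.covDeriv_leftPart hx) (P.covDeriv_rightPart hx) (P.isSplit hx).symm_left
    (P.isSplit hx).symm_right (P.isSplit_conformal hx)
    fun y hy => P.bigS_eq_neg_pureForm hy (hW y hy)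

theorem phi_eq_zero_iff (P : IsPulledBack γ U F O v h lam) (hW : ∀ y ∈ U, weyl γ y ≠ 0)
    (hx : x ∈ U) : phi γ x = 0 ↔ fderiv ℝ lam (F x) = 0 := by
  have hJ : IsUnit (jacobian F x).transpose := by
    rw [Matrix.isUnit_iff_isUnit_det, Matrix.det_transpose]
    exact isUnit_iff_ne_zero.2 (P.det_ne x hx)
  rw [P.phi_eq_mulVec hW hx, ← Matrix.mulVec_zero (jacobian F x).transpose,
    (Matrix.mulVec_injective_of_isUnit hJ).eq_iff, smul_eq_zero_iff_right (by norm_num),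
    dLam_eq_zero_iff]

theorem act22_hodge_pureForm_eq_zero_iff (P : IsPulledBack γ U F O v h lam)
    (hW : ∀ y ∈ U, weyl γ y ≠ 0) (hx : x ∈ U) :
    act22 (hodge (γ x) (pureForm (Real.exp (2 * lam (F x)) • leftPart F v x)
      (Real.exp (2 * lam (F x)) • rightPart F h x))) (raise (γ x) (phi γ x))
      (raise (γ x) (phi γ x)) = 0 ↔ HasPureDifferentialAt lam (F x) := by
  have hframe := (P.isAdaptedFrame hx).smul (Real.exp_ne_zero (2 * lam (F x)))
  have hcrit := hframe.act22_hodge_raise_eq_zero_iff ((-2 : ℝ) • dLam lam (F x))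
  rw [← P.phi_eq_mulVec hW hx, ← P.eq x hx] at hcrit
  simpa [leftPart, rightPart, ← pullMat_smul, smul_blockDiag, hasPureDifferentialAt_iff,
    dLam] using hcrit

theorem starSPhi_eq_zero_iff (P : IsPulledBack γ U F O v h lam) (hW : ∀ y ∈ U, weyl γ y ≠ 0)
    (hx : x ∈ U) : starSPhi γ x = 0 ↔ HasPureDifferentialAt lam (F x) := by
  rw [← P.act22_hodge_pureForm_eq_zero_iff hW hx, starSPhi,
    P.bigS_eq_neg_pureForm hx (hW x hx), ← neg_one_smul ℝ (pureForm _ _), hodge,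
    comp_smul_right, act22_smul, smul_eq_zero_iff_right (by norm_num), hodge]

theorem starWPhi_eq_zero_iff (P : IsPulledBack γ U F O v h lam) (hW : ∀ y ∈ U, weyl γ y ≠ 0)
    (hx : x ∈ U) : starWPhi γ x = 0 ↔ HasPureDifferentialAt lam (F x) := by
  obtain ⟨r, hr0, hr⟩ := P.exists_weyl_eq_of_ne_zero hx (hW x hx)
  rw [← P.act22_hodge_pureForm_eq_zero_iff hW hx, starWPhi, hr,
    act22_hodge_add_smul (P.isSplit_conformal hx).inv_mul_self,
    smul_eq_zero_iff_right (mul_ne_zero hr0 (by norm_num))]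

end IsPulledBack

/-! ### Functions on a box -/

section PartialDerivatives

variable {f : R4 → ℝ} {K : Set R4} {z z' : R4}

theorem eq_of_pd_eq_zero (hc : Convex ℝ K) (hf : ∀ y ∈ K, DifferentiableAt ℝ f y) (hz : z ∈ K)
    (hz' : z' ∈ K) (h : ∀ i, z' i ≠ z i → ∀ y ∈ K, pd i f y = 0) : f z' = f z := by
  obtain ⟨y, hy, hfy⟩ :=
    domain_mvt (fun y hy => (hf y hy).hasFDerivAt.hasFDerivWithinAt) hc hz hz'
  rw [← sub_eq_zero, hfy, fderiv_apply_eq_sum_pd]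
  refine Finset.sum_eq_zero fun i _ => ?_
  by_cases hi : z' i = z i
  · rw [PiLp.sub_apply, hi, sub_self, zero_mul]
  · rw [h i hi y (hc.segment_subset hz hz' hy), mul_zero]

theorem ne_zero_of_pd_eq_zero (hc : Convex ℝ K) (hf : ∀ y ∈ K, DifferentiableAt ℝ f y)
    (hz : z ∈ K) (hz' : z' ∈ K) (h : ∀ i, z' i ≠ z i → ∀ y ∈ K, f y ≠ 0 → pd i f y = 0)
    (hfz : f z ≠ 0) : f z' ≠ 0 := by
  have hsq : f z' * f z' = f z * f z := by
    refine eq_of_pd_eq_zero (f := fun y => f y * f y) hc (fun y hy => (hf y hy).fun_mul (hf y hy))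
      hz hz' fun i hi y hy => ?_
    rw [pd_mul (hf y hy) (hf y hy)]
    by_cases hfy : f y = 0
    · rw [hfy, mul_zero, zero_mul, add_zero]
    · rw [h i hi y hy hfy, mul_zero, zero_mul, add_zero]
  exact fun hfz' => hfz (mul_self_eq_zero.1 (by rw [← hsq, hfz', mul_zero]))

theorem pd_pd_eq_zero (hK : IsOpen K) (hf : ContDiffOn ℝ ∞ f K) {A B : Fin 4}
    (h : ∀ y ∈ K, pd A f y ≠ 0 → pd B f y = 0) {y : R4} (hy : y ∈ K) (hAy : pd A f y ≠ 0) :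
    pd B (pd A f) y = 0 := by
  have hN : IsOpen (K ∩ pd A f ⁻¹' {0}ᶜ) :=
    (contDiffOn_pd hK hf A).continuousOn.isOpen_inter_preimage hK isOpen_compl_singleton
  refine (pd_comm hK hf B A hy).trans ?_
  rw [pd_congr hN (k := fun _ => 0) (fun z hz => h z hz.1 hz.2) A ⟨hy, hAy⟩, pd_const]

end PartialDerivatives

theorem joinPair_firstPair_lastPair (x : R4) : joinPair (firstPair x) (lastPair x) = x := by
  ext i
  fin_cases i <;> rfl

theorem contDiff_joinPair :
    ContDiff ℝ ∞ fun p : (Fin 2 → ℝ) × (Fin 2 → ℝ) => joinPair p.1 p.2 := by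
  refine contDiff_euclidean.2 (Fin.addCases (m := 2) (n := 2) (fun i => ?_) fun i => ?_)
  · simp only [joinPair, Fin.append_left]
    fun_prop
  · simp only [joinPair, Fin.append_right]
    fun_prop

theorem two_le_of_firstPair_eq {x y : R4} (h : firstPair x = firstPair y) {i : Fin 4}
    (hi : x i ≠ y i) : 2 ≤ i := by
  by_contra! hlt
  exact hi (congrFun h ⟨i, hlt⟩)

theorem lt_two_of_lastPair_eq {x y : R4} (h : lastPair x = lastPair y) {i : Fin 4}
    (hi : x i ≠ y i) : i < 2 := by
  have h0 := congrFun h 0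
  have h1 := congrFun h 1
  fin_cases i
  exacts [by decide, by decide, absurd h0 hi, absurd h1 hi]

/-- The box `s × t`. -/
def box (s t : Set (Fin 2 → ℝ)) : Set R4 := firstPair ⁻¹' s ∩ lastPair ⁻¹' t

section Box

variable {s t : Set (Fin 2 → ℝ)} {f : R4 → ℝ}

theorem joinPair_mem_box {u w : Fin 2 → ℝ} (hu : u ∈ s) (hw : w ∈ t) : joinPair u w ∈ box s t :=
  ⟨by rwa [mem_preimage, firstPair_joinPair], by rwa [mem_preimage, lastPair_joinPair]⟩

theorem isOpen_box (hs : IsOpen s) (ht : IsOpen t) : IsOpen (box s t) :=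
  (hs.preimage firstPairL.continuous).inter (ht.preimage lastPairL.continuous)

theorem convex_box (hs : Convex ℝ s) (ht : Convex ℝ t) : Convex ℝ (box s t) :=
  (hs.linear_preimage firstPairL.toLinearMap).inter (ht.linear_preimage lastPairL.toLinearMap)

theorem exists_box_subset {O : Set R4} (hO : IsOpen O) {x : R4} (hx : x ∈ O) :
    ∃ s t : Set (Fin 2 → ℝ), IsOpen s ∧ IsOpen t ∧ Convex ℝ s ∧ Convex ℝ t ∧ x ∈ box s t ∧
      box s t ⊆ O := by
  have hmem : (firstPair x, lastPair x) ∈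
      (fun p : (Fin 2 → ℝ) × (Fin 2 → ℝ) => joinPair p.1 p.2) ⁻¹' O := by
    rwa [mem_preimage, joinPair_firstPair_lastPair]
  obtain ⟨ε, hε, hball⟩ := Metric.isOpen_iff.1 (hO.preimage contDiff_joinPair.continuous) _ hmem
  refine ⟨Metric.ball (firstPair x) ε, Metric.ball (lastPair x) ε, Metric.isOpen_ball,
    Metric.isOpen_ball, convex_ball _ _, convex_ball _ _,
    ⟨Metric.mem_ball_self hε, Metric.mem_ball_self hε⟩, fun y hy => ?_⟩
  rw [← joinPair_firstPair_lastPair y]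
  exact hball ((ball_prod_same _ _ ε).subset (mk_mem_prod hy.1 hy.2))

/-- If `∂_A f ≠ 0` at `x` for some `A < 2` and `∂_B f ≠ 0` at `y` for some `B ≥ 2`, then both are
nonzero at the point with the first coordinates of `x` and the last ones of `y`: where `∂_A f` does
not vanish it does not depend on the last coordinates, and symmetrically for `∂_B f`. -/
theorem pd_eq_zero_or_pd_eq_zero_of_hasPureDifferentialAt (hs : IsOpen s) (ht : IsOpen t)
    (hsc : Convex ℝ s) (htc : Convex ℝ t) (hf : ContDiffOn ℝ ∞ f (box s t))
    (h : ∀ y ∈ box s t, HasPureDifferentialAt f y) :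
    (∀ y ∈ box s t, ∀ i < 2, pd i f y = 0) ∨ ∀ y ∈ box s t, ∀ i ≥ 2, pd i f y = 0 := by
  have hK := isOpen_box hs ht
  have hc := convex_box hsc htc
  have hpd : ∀ i, ∀ y ∈ box s t, DifferentiableAt ℝ (pd i f) y := fun i y hy =>
    differentiableAt_of_contDiffOn hK (contDiffOn_pd hK hf i) hy
  by_contra! hcon
  obtain ⟨⟨x, hx, A, hA, hAx⟩, y, hy, B, hB, hBy⟩ := hcon
  have hleft : ∀ w ∈ box s t, pd A f w ≠ 0 → ∀ i ≥ 2, pd i f w = 0 := fun w hw hne =>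
    (h w hw).resolve_left fun hzero => hne (hzero A hA)
  have hright : ∀ w ∈ box s t, pd B f w ≠ 0 → ∀ i < 2, pd i f w = 0 := fun w hw hne =>
    (h w hw).resolve_right fun hzero => hne (hzero B hB)
  have hz : joinPair (firstPair x) (lastPair y) ∈ box s t := joinPair_mem_box hx.1 hy.2
  have hAz : pd A f (joinPair (firstPair x) (lastPair y)) ≠ 0 :=
    ne_zero_of_pd_eq_zero hc (hpd A) hx hz (fun i hi w hw hne => pd_pd_eq_zero hK hf
      (fun w hw hne => hleft w hw hne i
        (two_le_of_firstPair_eq (firstPair_joinPair _ _) hi)) hw hne) hAx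
  have hBz : pd B f (joinPair (firstPair x) (lastPair y)) ≠ 0 :=
    ne_zero_of_pd_eq_zero hc (hpd B) hy hz (fun i hi w hw hne => pd_pd_eq_zero hK hf
      (fun w hw hne => hright w hw hne i
        (lt_two_of_lastPair_eq (lastPair_joinPair _ _) hi)) hw hne) hBy
  exact hBz (hleft _ hz hAz B hB)

theorem exists_eq_comp_lastPair (hs : IsOpen s) (ht : IsOpen t) (hsc : Convex ℝ s)
    (htc : Convex ℝ t) (hne : s.Nonempty) (hf : ContDiffOn ℝ ∞ f (box s t))
    (h : ∀ y ∈ box s t, ∀ i < 2, pd i f y = 0) :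
    ∃ m : (Fin 2 → ℝ) → ℝ, ContDiffOn ℝ ∞ m t ∧ ∀ x ∈ box s t, f x = m (lastPair x) := by
  obtain ⟨u, hu⟩ := hne
  refine ⟨fun w => f (joinPair u w), hf.comp (contDiff_joinPair.comp
    (contDiff_prodMk_right u)).contDiffOn fun w hw => joinPair_mem_box hu hw, fun x hx => ?_⟩
  exact eq_of_pd_eq_zero (convex_box hsc htc)
    (fun y hy => differentiableAt_of_contDiffOn (isOpen_box hs ht) hf hy)
    (joinPair_mem_box hu hx.2) hx fun i hi y hy =>
      h y hy i (lt_two_of_lastPair_eq (lastPair_joinPair _ _).symm hi)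

theorem exists_eq_comp_firstPair (hs : IsOpen s) (ht : IsOpen t) (hsc : Convex ℝ s)
    (htc : Convex ℝ t) (hne : t.Nonempty) (hf : ContDiffOn ℝ ∞ f (box s t))
    (h : ∀ y ∈ box s t, ∀ i ≥ 2, pd i f y = 0) :
    ∃ m : (Fin 2 → ℝ) → ℝ, ContDiffOn ℝ ∞ m s ∧ ∀ x ∈ box s t, f x = m (firstPair x) := by
  obtain ⟨w, hw⟩ := hne
  refine ⟨fun u => f (joinPair u w), hf.comp (contDiff_joinPair.comp
    (contDiff_prodMk_left w)).contDiffOn fun u hu => joinPair_mem_box hu hw, fun x hx => ?_⟩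
  exact eq_of_pd_eq_zero (convex_box hsc htc)
    (fun y hy => differentiableAt_of_contDiffOn (isOpen_box hs ht) hf hy)
    (joinPair_mem_box hx.1 hw) hx fun i hi y hy =>
      h y hy i (two_le_of_firstPair_eq (firstPair_joinPair _ _).symm hi)

end Box

/-! ### Change of chart -/

section Jacobian

variable {F G : R4 → R4} {y : R4}

theorem jacobian_comp (hF : DifferentiableAt ℝ F y) (hG : DifferentiableAt ℝ G (F y)) :
    jacobian (G ∘ F) y = jacobian G (F y) * jacobian F y := by
  ext A i
  refine (pd_comp (differentiableAt_euclidean.1 hG A) hF i).trans ?_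
  rw [fderiv_apply_eq_sum_pd, Matrix.mul_apply]
  simp only [fderiv_single_apply hF, mul_comm]
  rfl

theorem jacobian_id (y : R4) : jacobian id y = 1 := by
  ext A i
  rw [← fderiv_single_apply differentiableAt_id, fderiv_id]
  simp [Matrix.one_apply]

theorem jacobian_congr {U : Set R4} (hU : IsOpen U) (h : EqOn F G U) (hy : y ∈ U) :
    jacobian F y = jacobian G y := by
  ext A i
  exact pd_congr hU (fun z hz => congrArg (fun w : R4 => w A) (h hz)) i hy

theorem fderiv_single_eq_sum (hF : DifferentiableAt ℝ F y) (i : Fin 4) :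
    fderiv ℝ F y (EuclideanSpace.single i 1) =
      ∑ A, jacobian F y A i • EuclideanSpace.single A (1 : ℝ) := by
  ext k
  rw [fderiv_single_apply hF]
  simp [Pi.single_apply]

end Jacobian

section Transition

variable {M : Type*} [TopologicalSpace M]

theorem isOpen_transition (φ ψ : OpenPartialHomeomorph M R4) :
    IsOpen (φ.target ∩ φ.symm ⁻¹' ψ.source) :=
  φ.symm.isOpen_inter_preimage ψ.open_source

variable [ChartedSpace R4 M] {φ ψ : OpenPartialHomeomorph M R4}

theorem contDiffOn_transition (hφ : φ ∈ IsManifold.maximalAtlas (𝓡 4) ∞ M)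
    (hψ : ψ ∈ IsManifold.maximalAtlas (𝓡 4) ∞ M) :
    ContDiffOn ℝ ∞ (ψ ∘ φ.symm) (φ.target ∩ φ.symm ⁻¹' ψ.source) := by
  rw [← contMDiffOn_iff_contDiffOn]
  exact (contMDiffOn_of_mem_maximalAtlas hψ).comp
    ((contMDiffOn_symm_of_mem_maximalAtlas hφ).mono inter_subset_left) fun y hy => hy.2

theorem differentiableAt_transition (hφ : φ ∈ IsManifold.maximalAtlas (𝓡 4) ∞ M)
    (hψ : ψ ∈ IsManifold.maximalAtlas (𝓡 4) ∞ M) {y : R4}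
    (hy : y ∈ φ.target ∩ φ.symm ⁻¹' ψ.source) : DifferentiableAt ℝ (ψ ∘ φ.symm) y :=
  ((contDiffOn_transition hφ hψ).contDiffAt
    ((isOpen_transition φ ψ).mem_nhds hy)).differentiableAt (by simp)

theorem jacobian_transition_mul (hφ : φ ∈ IsManifold.maximalAtlas (𝓡 4) ∞ M)
    (hψ : ψ ∈ IsManifold.maximalAtlas (𝓡 4) ∞ M) {y : R4}
    (hy : y ∈ φ.target ∩ φ.symm ⁻¹' ψ.source) :
    jacobian (φ ∘ ψ.symm) ((ψ ∘ φ.symm) y) * jacobian (ψ ∘ φ.symm) y = 1 := by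
  have hy' : (ψ ∘ φ.symm) y ∈ ψ.target ∩ ψ.symm ⁻¹' φ.source := by
    refine ⟨ψ.map_source hy.2, ?_⟩
    simp only [Function.comp, mem_preimage, ψ.left_inv hy.2]
    exact φ.map_target hy.1
  have hid : EqOn ((φ ∘ ψ.symm) ∘ (ψ ∘ φ.symm)) id (φ.target ∩ φ.symm ⁻¹' ψ.source) := by
    intro z hz
    have hz' : ψ.symm (ψ (φ.symm z)) = φ.symm z := ψ.left_inv hz.2
    simp only [Function.comp, hz', φ.right_inv hz.1, id]
  rw [← jacobian_comp (differentiableAt_transition hφ hψ hy)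
    (differentiableAt_transition hψ hφ hy'), jacobian_congr (isOpen_transition φ ψ) hid hy,
    jacobian_id]

theorem mfderiv_symm_eq_comp (hφ : φ ∈ IsManifold.maximalAtlas (𝓡 4) ∞ M)
    (hψ : ψ ∈ IsManifold.maximalAtlas (𝓡 4) ∞ M) {y : R4}
    (hy : y ∈ φ.target ∩ φ.symm ⁻¹' ψ.source) :
    mfderiv (𝓡 4) (𝓡 4) φ.symm y =
      (mfderiv (𝓡 4) (𝓡 4) ψ.symm ((ψ ∘ φ.symm) y)).comp (fderiv ℝ (ψ ∘ φ.symm) y) := by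
  have hψs : MDifferentiableAt (𝓡 4) (𝓡 4) ψ.symm ((ψ ∘ φ.symm) y) :=
    ((contMDiffOn_symm_of_mem_maximalAtlas hψ).contMDiffAt
      (ψ.open_target.mem_nhds (ψ.map_source hy.2))).mdifferentiableAt (by simp)
  have hev : φ.symm =ᶠ[𝓝 y] ψ.symm ∘ (ψ ∘ φ.symm) :=
    Filter.eventually_of_mem ((isOpen_transition φ ψ).mem_nhds hy)
      fun z hz => (ψ.left_inv hz.2).symm
  have hcomp := mfderiv_comp y hψs (differentiableAt_transition hφ hψ hy).mdifferentiableAt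
  rw [mfderiv_eq_fderiv] at hcomp
  exact hev.mfderiv_eq.trans hcomp

variable [IsManifold (𝓡 4) ∞ M]

/-- Stated for fixed vectors of the model space, because `g.val p` and `g.val q` act on the
a priori different tangent spaces at `p` and `q`. -/
theorem LorentzMetric.val_congr (g : LorentzMetric M) {p q : M} (h : p = q) (u w : R4) :
    (g.val p : R4 →L[ℝ] R4 →L[ℝ] ℝ) u w = (g.val q : R4 →L[ℝ] R4 →L[ℝ] ℝ) u w := by
  subst h
  rfl

theorem bilin_sum_smul (B : R4 →L[ℝ] R4 →L[ℝ] ℝ) (D : R4 →L[ℝ] R4) (J : Tensor2) (i j : Fin 4) :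
    B (D (∑ A, J A i • EuclideanSpace.single A (1 : ℝ)))
      (D (∑ A, J A j • EuclideanSpace.single A (1 : ℝ))) =
    pullMat J (.of fun A A' => B (D (EuclideanSpace.single A 1)) (D (EuclideanSpace.single A' 1)))
      i j := by
  rw [pullMat_apply]
  simp only [map_sum, map_smul, sum_apply, smul_apply, smul_eq_mul, Finset.mul_sum, Matrix.of_apply]
  rw [Finset.sum_comm]
  refine Finset.sum_congr rfl fun _ _ => Finset.sum_congr rfl fun _ _ => ?_
  ring

theorem metricIn_transition (g : LorentzMetric M) (hφ : φ ∈ IsManifold.maximalAtlas (𝓡 4) ∞ M)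
    (hψ : ψ ∈ IsManifold.maximalAtlas (𝓡 4) ∞ M) {y : R4}
    (hy : y ∈ φ.target ∩ φ.symm ⁻¹' ψ.source) :
    metricIn g φ y = pullMat (jacobian (ψ ∘ φ.symm) y) (metricIn g ψ ((ψ ∘ φ.symm) y)) := by
  ext i j
  have hF := differentiableAt_transition hφ hψ hy
  refine (g.val_congr (ψ.left_inv hy.2).symm _ _).trans ?_
  rw [mfderiv_symm_eq_comp hφ hψ hy]
  refine Eq.trans ?_ (bilin_sum_smul (g.val (ψ.symm ((ψ ∘ φ.symm) y)))
    (mfderiv (𝓡 4) (𝓡 4) ψ.symm ((ψ ∘ φ.symm) y)) (jacobian (ψ ∘ φ.symm) y) i j)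
  rw [← fderiv_single_eq_sum hF, ← fderiv_single_eq_sum hF]
  rfl

/-- `g = e^{2λ} (v + h)` on `O`: the data whose existence is asserted by `IsConfProductOn`. -/
structure IsConfProductWith (g : R4 → Tensor2) (O : Set R4)
    (v h : (Fin 2 → ℝ) → Matrix (Fin 2) (Fin 2) ℝ) (lam : R4 → ℝ) : Prop where
  lorentz : IsLorentz2 v (firstPair '' O)
  riemannian : IsRiemann2 h (lastPair '' O)
  smooth : ContDiffOn ℝ ∞ lam O
  eq : ∀ x ∈ O, g x = blockDiag (Real.exp (2 * lam x) • v (firstPair x))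
      (Real.exp (2 * lam x) • h (lastPair x))

theorem isPulledBack_transition (g : LorentzMetric M)
    (hφ : φ ∈ IsManifold.maximalAtlas (𝓡 4) ∞ M) (hψ : ψ ∈ IsManifold.maximalAtlas (𝓡 4) ∞ M)
    {v h : (Fin 2 → ℝ) → Matrix (Fin 2) (Fin 2) ℝ} {lam : R4 → ℝ}
    (hd : IsConfProductWith (metricIn g ψ) ψ.target v h lam) :
    IsPulledBack (metricIn g φ) (φ.target ∩ φ.symm ⁻¹' ψ.source) (ψ ∘ φ.symm) ψ.target v h lam where
  isOpen_source := isOpen_transition φ ψ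
  isOpen_target := ψ.open_target
  smooth_map := contDiffOn_transition hφ hψ
  mapsTo _ hy := ψ.map_source hy.2
  det_ne _ hy := (Matrix.isUnit_det_of_left_inverse (jacobian_transition_mul hφ hψ hy)).ne_zero
  lorentz := hd.lorentz
  riemannian := hd.riemannian
  smooth := hd.smooth
  eq y hy := by
    rw [metricIn_transition g hφ hψ hy, hd.eq ((ψ ∘ φ.symm) y) (ψ.map_source hy.2)]

end Transition

/-! ### Warped products as conformal products -/

section WarpedProducts

theorem fderiv_comp_eq_zero_iff {E F G : Type*} [NormedAddCommGroup E] [NormedSpace ℝ E]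
    [NormedAddCommGroup F] [NormedSpace ℝ F] [NormedAddCommGroup G] [NormedSpace ℝ G]
    {A : E →L[ℝ] F} (hA : Function.Surjective A) {m : F → G} {x : E}
    (hm : DifferentiableAt ℝ m (A x)) :
    fderiv ℝ (fun y => m (A y)) x = 0 ↔ fderiv ℝ m (A x) = 0 := by
  rw [fderiv_fun_comp x hm A.differentiableAt, A.fderiv]
  refine ⟨fun h => ?_, fun h => by rw [h, ContinuousLinearMap.zero_comp]⟩
  ext w
  obtain ⟨z, rfl⟩ := hA w
  exact congrArg (fun L : E →L[ℝ] G => L z) h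

theorem firstPairL_single {i : Fin 4} (hi : 2 ≤ i) :
    firstPairL (EuclideanSpace.single i 1) = 0 := by
  ext C
  have hlt : Fin.castAdd 2 C < i := C.isLt.trans_le (Fin.le_def.1 hi)
  exact Pi.single_eq_of_ne hlt.ne 1

theorem lastPairL_single {i : Fin 4} (hi : i < 2) :
    lastPairL (EuclideanSpace.single i 1) = 0 := by
  ext C
  have hlt : i < Fin.natAdd 2 C := (Fin.lt_def.1 hi).trans_le (Nat.le_add_right 2 C)
  exact Pi.single_eq_of_ne hlt.ne' 1

theorem hasPureDifferentialAt_comp_lastPair {m : (Fin 2 → ℝ) → ℝ} {x : R4}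
    (hm : DifferentiableAt ℝ m (lastPair x)) :
    HasPureDifferentialAt (fun y => m (lastPair y)) x := by
  refine Or.inl fun i hi => ?_
  refine (pd_comp (G := lastPairL) hm lastPairL.differentiableAt i).trans ?_
  rw [lastPairL.fderiv, lastPairL_single hi, map_zero]

theorem hasPureDifferentialAt_comp_firstPair {m : (Fin 2 → ℝ) → ℝ} {x : R4}
    (hm : DifferentiableAt ℝ m (firstPair x)) :
    HasPureDifferentialAt (fun y => m (firstPair y)) x := by
  refine Or.inr fun i hi => ?_
  refine (pd_comp (G := firstPairL) hm firstPairL.differentiableAt i).trans ?_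
  rw [firstPairL.fderiv, firstPairL_single hi, map_zero]

variable {g : R4 → Tensor2} {O : Set R4} {C : ((Fin 2 → ℝ) →L[ℝ] ℝ) → Prop}
  {v h : (Fin 2 → ℝ) → Matrix (Fin 2) (Fin 2) ℝ} {s : Set (Fin 2 → ℝ)} {m : (Fin 2 → ℝ) → ℝ}

theorem IsLorentz2.exp_smul (hv : IsLorentz2 v s) (hm : ContDiffOn ℝ ∞ m s) :
    IsLorentz2 (fun u => Real.exp (m u) • v u) s where
  smooth i j := hm.exp.mul (hv.smooth i j)
  symm u hu := (hv.symm u hu).smul _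
  det_neg u hu := by
    rw [Matrix.det_smul]
    exact mul_neg_of_pos_of_neg (pow_pos (Real.exp_pos _) _) (hv.det_neg u hu)

theorem IsRiemann2.exp_smul (hh : IsRiemann2 h s) (hm : ContDiffOn ℝ ∞ m s) :
    IsRiemann2 (fun u => Real.exp (m u) • h u) s where
  smooth i j := hm.exp.mul (hh.smooth i j)
  posDef u hu := (hh.posDef u hu).smul (Real.exp_pos _)

theorem exp_smul_exp_neg_smul (p : ℝ) (A : Matrix (Fin 2) (Fin 2) ℝ) :
    Real.exp (2 * p) • Real.exp (-2 * p) • A = A := by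
  rw [smul_smul, ← Real.exp_add, neg_mul, add_neg_cancel, Real.exp_zero, one_smul]

theorem IsLorentz2.mono {s' : Set (Fin 2 → ℝ)} (hv : IsLorentz2 v s) (hs : s' ⊆ s) :
    IsLorentz2 v s' where
  smooth i j := (hv.smooth i j).mono hs
  symm u hu := hv.symm u (hs hu)
  det_neg u hu := hv.det_neg u (hs hu)

theorem IsRiemann2.mono {s' : Set (Fin 2 → ℝ)} (hh : IsRiemann2 h s) (hs : s' ⊆ s) :
    IsRiemann2 h s' where
  smooth i j := (hh.smooth i j).mono hs
  posDef u hu := hh.posDef u (hs hu)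

theorem IsConfProductWith.mono {lam : R4 → ℝ} {O' : Set R4} (hd : IsConfProductWith g O v h lam)
    (hO : O' ⊆ O) : IsConfProductWith g O' v h lam where
  lorentz := hd.lorentz.mono (image_mono hO)
  riemannian := hd.riemannian.mono (image_mono hO)
  smooth := hd.smooth.mono hO
  eq x hx := hd.eq x (hO hx)

theorem IsConfProductWith.congr {lam lam' : R4 → ℝ} (hd : IsConfProductWith g O v h lam)
    (hlam : ∀ x ∈ O, lam x = lam' x) : IsConfProductWith g O v h lam' where
  lorentz := hd.lorentz
  riemannian := hd.riemannian
  smooth := hd.smooth.congr fun x hx => (hlam x hx).symm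
  eq x hx := by rw [hd.eq x hx, hlam x hx]

theorem isTWarpedOn_iff : IsTWarpedOn C g O ↔
    ∃ v h m, IsConfProductWith g O v h (fun x => m (lastPair x)) ∧
      ContDiffOn ℝ ∞ m (lastPair '' O) ∧ ∀ u ∈ lastPair '' O, C (fderiv ℝ m u) := by
  constructor
  · rintro ⟨v, h, m, hv, hh, hm, hC, heq⟩
    refine ⟨v, fun u => Real.exp (-2 * m u) • h u, m,
      ⟨hv, hh.exp_smul (contDiffOn_const.mul hm),
        hm.comp lastPairL.contDiff.contDiffOn (mapsTo_image lastPair O), fun x hx => ?_⟩, hm, hC⟩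
    rw [heq x hx, exp_smul_exp_neg_smul]
  · rintro ⟨v, h, m, hd, hm, hC⟩
    exact ⟨v, fun u => Real.exp (2 * m u) • h u, m, hd.lorentz,
      hd.riemannian.exp_smul (contDiffOn_const.mul hm), hm, hC, hd.eq⟩

theorem isSWarpedOn_iff : IsSWarpedOn C g O ↔
    ∃ v h m, IsConfProductWith g O v h (fun x => m (firstPair x)) ∧
      ContDiffOn ℝ ∞ m (firstPair '' O) ∧ ∀ u ∈ firstPair '' O, C (fderiv ℝ m u) := by
  constructor
  · rintro ⟨v, h, m, hv, hh, hm, hC, heq⟩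
    refine ⟨fun u => Real.exp (-2 * m u) • v u, h, m,
      ⟨hv.exp_smul (contDiffOn_const.mul hm), hh,
        hm.comp firstPairL.contDiff.contDiffOn (mapsTo_image firstPair O), fun x hx => ?_⟩, hm, hC⟩
    rw [heq x hx, exp_smul_exp_neg_smul]
  · rintro ⟨v, h, m, hd, hm, hC⟩
    exact ⟨fun u => Real.exp (2 * m u) • v u, h, m,
      hd.lorentz.exp_smul (contDiffOn_const.mul hm), hd.riemannian, hm, hC, hd.eq⟩

theorem isTWarpedOn_ne_zero_iff (hO : IsOpen O) : IsTWarpedOn (fun l => l ≠ 0) g O ↔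
    ∃ v h m, IsConfProductWith g O v h (fun x => m (lastPair x)) ∧
      ContDiffOn ℝ ∞ m (lastPair '' O) ∧ ∀ x ∈ O, fderiv ℝ (fun y => m (lastPair y)) x ≠ 0 := by
  rw [isTWarpedOn_iff]
  refine exists₃_congr fun v h m => and_congr_right fun _ => and_congr_right fun hm => ?_
  rw [forall_mem_image]
  refine forall₂_congr fun x hx => (fderiv_comp_eq_zero_iff lastPairL_surjective ?_).not.symm
  exact differentiableAt_of_contDiffOn (isOpenMap_lastPair O hO) hm (mem_image_of_mem _ hx)

theorem isSWarpedOn_ne_zero_iff (hO : IsOpen O) : IsSWarpedOn (fun l => l ≠ 0) g O ↔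
    ∃ v h m, IsConfProductWith g O v h (fun x => m (firstPair x)) ∧
      ContDiffOn ℝ ∞ m (firstPair '' O) ∧ ∀ x ∈ O, fderiv ℝ (fun y => m (firstPair y)) x ≠ 0 := by
  rw [isSWarpedOn_iff]
  refine exists₃_congr fun v h m => and_congr_right fun _ => and_congr_right fun hm => ?_
  rw [forall_mem_image]
  refine forall₂_congr fun x hx => (fderiv_comp_eq_zero_iff firstPairL_surjective ?_).not.symm
  exact differentiableAt_of_contDiffOn (isOpenMap_firstPair O hO) hm (mem_image_of_mem _ hx)

theorem exists_isConfProductWith_of_isWarpedOn (hO : IsOpen O)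
    (hg : IsTWarpedOn C g O ∨ IsSWarpedOn C g O) :
    ∃ v h lam, IsConfProductWith g O v h lam ∧ ∀ x ∈ O, HasPureDifferentialAt lam x := by
  rcases hg with hT | hS
  · obtain ⟨v, h, m, hd, hm, -⟩ := isTWarpedOn_iff.1 hT
    exact ⟨v, h, _, hd, fun x hx => hasPureDifferentialAt_comp_lastPair
      (differentiableAt_of_contDiffOn (isOpenMap_lastPair O hO) hm (mem_image_of_mem _ hx))⟩
  · obtain ⟨v, h, m, hd, hm, -⟩ := isSWarpedOn_iff.1 hS
    exact ⟨v, h, _, hd, fun x hx => hasPureDifferentialAt_comp_firstPair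
      (differentiableAt_of_contDiffOn (isOpenMap_firstPair O hO) hm (mem_image_of_mem _ hx))⟩

theorem IsConfProductWith.isWarpedOn_box {s t : Set (Fin 2 → ℝ)} {lam : R4 → ℝ}
    (hd : IsConfProductWith g (box s t) v h lam) (hs : IsOpen s) (ht : IsOpen t)
    (hsc : Convex ℝ s) (htc : Convex ℝ t) (hne : (box s t).Nonempty)
    (hpure : ∀ x ∈ box s t, HasPureDifferentialAt lam x) :
    IsTWarpedOn (fun _ => True) g (box s t) ∨ IsSWarpedOn (fun _ => True) g (box s t) := by
  obtain ⟨x, hxs, hxt⟩ := hne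
  rcases pd_eq_zero_or_pd_eq_zero_of_hasPureDifferentialAt hs ht hsc htc hd.smooth hpure
    with h0 | h0
  · obtain ⟨m, hm, hlam⟩ := exists_eq_comp_lastPair hs ht hsc htc ⟨_, hxs⟩ hd.smooth h0
    exact Or.inl (isTWarpedOn_iff.2 ⟨v, h, m, hd.congr hlam,
      hm.mono (image_subset_iff.2 inter_subset_right), fun _ _ => trivial⟩)
  · obtain ⟨m, hm, hlam⟩ := exists_eq_comp_firstPair hs ht hsc htc ⟨_, hxt⟩ hd.smooth h0
    exact Or.inr (isSWarpedOn_iff.2 ⟨v, h, m, hd.congr hlam,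
      hm.mono (image_subset_iff.2 inter_subset_left), fun _ _ => trivial⟩)

end WarpedProducts

/-! ### Warped spacetimes -/

section WarpedSpacetimes

variable {M : Type*} [TopologicalSpace M] [ChartedSpace R4 M] [IsManifold (𝓡 4) ∞ M]

theorem exists_restr_target_eq {ψ : OpenPartialHomeomorph M R4}
    (hψ : ψ ∈ IsManifold.maximalAtlas (𝓡 4) ∞ M) {K : Set R4} (hK : IsOpen K)
    (hsub : K ⊆ ψ.target) :
    ∃ ψ' ∈ IsManifold.maximalAtlas (𝓡 4) ∞ M, ψ'.source = ψ.source ∩ ψ ⁻¹' K ∧ ψ'.target = K ∧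
      ∀ g : LorentzMetric M, metricIn g ψ' = metricIn g ψ := by
  have hopen : IsOpen (ψ.source ∩ ψ ⁻¹' K) := ψ.isOpen_inter_preimage hK
  refine ⟨ψ.restr (ψ.source ∩ ψ ⁻¹' K), restr_mem_maximalAtlas _ hψ hopen, ?_, ?_, fun g => rfl⟩
  · rw [ψ.restr_source' _ hopen, ← inter_assoc, inter_self]
  · rw [ψ.restr_target, hopen.interior_eq]
    ext x
    refine ⟨fun hx => ?_, fun hx => ⟨hsub hx, ψ.map_target (hsub hx), ?_⟩⟩
    · simpa only [mem_preimage, ψ.right_inv hx.1] using hx.2.2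
    · rwa [mem_preimage, ψ.right_inv (hsub hx)]

theorem isWarpedWide_iff (g : LorentzMetric M) : IsWarpedWide g ↔ Locally g fun γ O =>
    ∃ v h lam, IsConfProductWith γ O v h lam ∧ ∀ x ∈ O, HasPureDifferentialAt lam x := by
  refine ⟨fun hw p => ?_, fun hw p => ?_⟩
  · obtain ⟨ψ, hψ, hp, hform⟩ := hw p
    exact ⟨ψ, hψ, hp, exists_isConfProductWith_of_isWarpedOn ψ.open_target hform⟩
  · obtain ⟨ψ, hψ, hp, v, h, lam, hd, hpure⟩ := hw p
    obtain ⟨s, t, hs, ht, hsc, htc, hmem, hsub⟩ :=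
      exists_box_subset ψ.open_target (ψ.map_source hp)
    obtain ⟨ψ', hψ', hsource, htarget, hmetric⟩ :=
      exists_restr_target_eq hψ (isOpen_box hs ht) hsub
    refine ⟨ψ', hψ', hsource ▸ ⟨hp, hmem⟩, ?_⟩
    rw [htarget, hmetric]
    exact (hd.mono hsub).isWarpedOn_box hs ht hsc htc ⟨_, hmem⟩ fun x hx => hpure x (hsub hx)

variable {g : LorentzMetric M}

theorem isWarpedWide_iff_everywhere {P : (R4 → Tensor2) → R4 → Prop} (hprod : IsConfProduct g)
    (hflat : NonConfFlat g)
    (hP : ∀ {γ U F O v h lam x}, IsPulledBack γ U F O v h lam → (∀ y ∈ U, weyl γ y ≠ 0) → x ∈ U →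
      (P γ x ↔ HasPureDifferentialAt lam (F x))) :
    IsWarpedWide g ↔ Everywhere g P := by
  rw [isWarpedWide_iff]
  refine ⟨fun hw φ hφ x hx => ?_, fun hw p => ?_⟩
  · obtain ⟨ψ, hψ, hp, v, h, lam, hd, hpure⟩ := hw (φ.symm x)
    exact (hP (isPulledBack_transition g hφ hψ hd) (fun y hy => hflat φ hφ y hy.1) ⟨hx, hp⟩).2
      (hpure _ (ψ.map_source hp))
  · obtain ⟨ψ, hψ, hp, v, h, lam, hv, hh, hlam, heq⟩ := hprod p
    have hd : IsConfProductWith (metricIn g ψ) ψ.target v h lam := ⟨hv, hh, hlam, heq⟩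
    refine ⟨ψ, hψ, hp, v, h, lam, hd, fun x hx => ?_⟩
    have hpure := (hP (isPulledBack_transition g hψ hψ hd) (fun y hy => hflat ψ hψ y hy.1)
      ⟨hx, ψ.map_target hx⟩).1 (hw ψ hψ x hx)
    rwa [Function.comp_apply, ψ.right_inv hx] at hpure

theorem isWarpedWide_iff_starSPhi (hprod : IsConfProduct g) (hflat : NonConfFlat g) :
    IsWarpedWide g ↔ Everywhere g fun γ x => starSPhi γ x = 0 :=
  isWarpedWide_iff_everywhere hprod hflat fun P => P.starSPhi_eq_zero_iff

theorem isWarpedWide_iff_starWPhi (hprod : IsConfProduct g) (hflat : NonConfFlat g) :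
    IsWarpedWide g ↔ Everywhere g fun γ x => starWPhi γ x = 0 :=
  isWarpedWide_iff_everywhere hprod hflat fun P => P.starWPhi_eq_zero_iff

theorem phi_metricIn_eq_zero_iff (hflat : NonConfFlat g) {φ ψ : OpenPartialHomeomorph M R4}
    (hφ : φ ∈ IsManifold.maximalAtlas (𝓡 4) ∞ M) (hψ : ψ ∈ IsManifold.maximalAtlas (𝓡 4) ∞ M)
    {v h : (Fin 2 → ℝ) → Matrix (Fin 2) (Fin 2) ℝ} {lam : R4 → ℝ}
    (hd : IsConfProductWith (metricIn g ψ) ψ.target v h lam) {x : R4} (hx : x ∈ φ.target)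
    (hx' : φ.symm x ∈ ψ.source) :
    phi (metricIn g φ) x = 0 ↔ fderiv ℝ lam (ψ (φ.symm x)) = 0 :=
  (isPulledBack_transition g hφ hψ hd).phi_eq_zero_iff (fun y hy => hflat φ hφ y hy.1) ⟨hx, hx'⟩

theorem isWarped_iff (hflat : NonConfFlat g) :
    IsWarped g ↔ Everywhere g (fun γ x => phi γ x ≠ 0) ∧ IsWarpedWide g := by
  refine ⟨fun hw => ⟨fun φ hφ x hx => ?_, (isWarpedWide_iff g).2 fun p => ?_⟩, fun hw p => ?_⟩
  · obtain ⟨ψ, hψ, hp, hT | hS⟩ := hw (φ.symm x)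
    · obtain ⟨v, h, m, hd, -, hne⟩ := (isTWarpedOn_ne_zero_iff ψ.open_target).1 hT
      exact (phi_metricIn_eq_zero_iff hflat hφ hψ hd hx hp).not.2 (hne _ (ψ.map_source hp))
    · obtain ⟨v, h, m, hd, -, hne⟩ := (isSWarpedOn_ne_zero_iff ψ.open_target).1 hS
      exact (phi_metricIn_eq_zero_iff hflat hφ hψ hd hx hp).not.2 (hne _ (ψ.map_source hp))
  · obtain ⟨ψ, hψ, hp, hform⟩ := hw p
    exact ⟨ψ, hψ, hp, exists_isConfProductWith_of_isWarpedOn ψ.open_target hform⟩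
  · obtain ⟨ψ, hψ, hp, hform⟩ := hw.2 p
    have hne : ∀ {v h lam}, IsConfProductWith (metricIn g ψ) ψ.target v h lam →
        ∀ x ∈ ψ.target, fderiv ℝ lam x ≠ 0 := fun hd x hx => by
      have hphi := (phi_metricIn_eq_zero_iff hflat hψ hψ hd hx (ψ.map_target hx)).not.1
        (hw.1 ψ hψ x hx)
      rwa [ψ.right_inv hx] at hphi
    refine ⟨ψ, hψ, hp, hform.imp (fun hT => ?_) fun hS => ?_⟩
    · obtain ⟨v, h, m, hd, hm, -⟩ := isTWarpedOn_iff.1 hT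
      exact (isTWarpedOn_ne_zero_iff ψ.open_target).2 ⟨v, h, m, hd, hm, hne hd⟩
    · obtain ⟨v, h, m, hd, hm, -⟩ := isSWarpedOn_iff.1 hS
      exact (isSWarpedOn_ne_zero_iff ψ.open_target).2 ⟨v, h, m, hd, hm, hne hd⟩

end WarpedSpacetimes

end Warped22

end

theorem mainTheorem11 {M : Type*} [TopologicalSpace M] [ChartedSpace Warped22.R4 M]
    [IsManifold (𝓡 4) ∞ M] (g : Warped22.LorentzMetric M)
    (hprod : Warped22.IsConfProduct g) (hflat : Warped22.NonConfFlat g) :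
    (Warped22.IsWarped g ↔
      Warped22.Everywhere g (fun γ x => Warped22.phi γ x ≠ 0) ∧
      Warped22.Everywhere g (fun γ x => Warped22.starSPhi γ x = 0)) ∧
    (Warped22.IsWarped g ↔
      Warped22.Everywhere g (fun γ x => Warped22.phi γ x ≠ 0) ∧
      Warped22.Everywhere g (fun γ x => Warped22.starWPhi γ x = 0)) ∧
    (Warped22.IsWarpedWide g ↔
      Warped22.Everywhere g (fun γ x => Warped22.starSPhi γ x = 0)) ∧
    (Warped22.IsWarpedWide g ↔
      Warped22.Everywhere g (fun γ x => Warped22.starWPhi γ x = 0)) := by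
  have hS := Warped22.isWarpedWide_iff_starSPhi hprod hflat
  have hW := Warped22.isWarpedWide_iff_starWPhi hprod hflat
  have hphi := Warped22.isWarped_iff hflat
  exact ⟨hphi.trans (and_congr_right' hS), hphi.trans (and_congr_right' hW), hS, hW⟩
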